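/- **Theorem (Bayesian cumulative regret of IRGP-UCB on a continuous domain).** Let $d\ge 1$, $r>0$, let $\mathcal X\subset[0,r]^d$ be compact and convex, and let $\sigma>0$. Let $f$ be a centered Gaussian process on $\mathcal X$ whose covariance function is a positive semidefinite kernel $k$ with $k(x,x)\le 1$ for all $x\in\mathcal X$. Assume that the sample paths of $f$ are almost surely continuous on $\mathcal X$ and have first-order partial derivatives (taken at the interior points of $\mathcal X$; if $\mathcal X$ has empty interior, $\partial f/\partial x_j$ denotes the $j$-th coordinate of a gradient of $f$ relative to $\mathcal X$), and that there are constants $a,b>0$ with $$\Pr\Bigl(\sup_{x\in\mathcal X}\Bigl|\frac{\partial f}{\partial x_j}(x)\Bigr|>L\Bigr)\le a\,e^{-(L/b)^2}\qquad\text{for all } j\in\{1,\dots,d\},\ L>0 .$$ Put $$s_t = 2d\log\Bigl(bdr\,t^2\bigl(\sqrt{\log(ad)}+\tfrac{\sqrt\pi}{2}\bigr)\Bigr)-2\log 2 ,\qquad t\ge1,$$ let $\epsilon_1,\epsilon_2,\dots$ be i.i.d. $\mathcal N(0,\sigma^2)$, and let $\zeta_1,\zeta_2,\dots$ be independent, $\zeta_t$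 being distributed as $s_t+Z_t$ where $Z_t$ is exponential with rate $\lambda=1/2$; $f$, $(\epsilon_t)$ and $(\zeta_t)$ are independent. IRGP-UCB chooses, for $t=1,2,\dots$, $$x_t\in\operatorname*{arg\,max}_{x\in\mathcal X}\ \mu_{t-1}(x)+\zeta_t^{1/2}\sigma_{t-1}(x)$$ and observes $y_t=f(x_t)+\epsilon_t$. Here $$\mu_{t-1}(x)=\mathbf k_{t-1}(x)^\top(\mathbf K+\sigma^2\mathbf I)^{-1}\mathbf y_{t-1},\qquad \sigma_{t-1}^2(x)=k(x,x)-\mathbf k_{t-1}(x)^\top(\mathbf K+\sigma^2\mathbf I)^{-1}\mathbf k_{t-1}(x),$$ with $\mathbf k_{t-1}(x)=(k(x,x_i))_{i<t}$, $\mathbf K=(k(x_i,x_j))_{i,j<t}$, $\mathbf y_{t-1}=(y_i)_{i<t}$, are the posterior mean and variance, and $x_t$ is a measurable function of $(x_i,y_i)_{i<t}$ and $\zeta_1,\dots,\zeta_t$. Let $\gamma_T=\sup I(\mathbf y_A;\mathbf f_A)$, the supremum over all families $A=(a_1,\dots,a_T)$ of points of $\mathcal X$, be the maximum information gain, where $\mathbf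 f_A\sim\mathcal N(0,(k(a_i,a_j))_{i,j})$, $\mathbf y_A=\mathbf f_A+\mathbf e$ with $\mathbf e\sim\mathcal N(0,\sigma^2\mathbf I_T)$ independent of $\mathbf f_A$, and $I$ is the Shannon mutual information (natural logarithm). Let $C_1=2/\log(1+\sigma^{-2})$. Then for every $T\ge1$ the cumulative regret $\sum_{t=1}^T\bigl(\max_{x\in\mathcal X}f(x)-f(x_t)\bigr)$ is integrable and $$\mathrm{BCR}_T=\mathbb E\Bigl[\sum_{t=1}^T\bigl(\max_{x\in\mathcal X}f(x)-f(x_t)\bigr)\Bigr]\le\frac{\pi^2}{6}+\sqrt{C_1\,T\,\gamma_T\,(2+s_T)} .$$ (Square roots of negative numbers, and $\sqrt{\log(ad)}$ when $ad<1$, are read as $0$.) -/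

import Mathlib

open MeasureTheory ProbabilityTheory InformationTheory
open scoped ENNReal

noncomputable section

namespace BayesOpt

/-- The points of `ℝ^d`. -/
abbrev Pt (d : ℕ) := EuclideanSpace ℝ (Fin d)

/-! ### Gaussian processes and their posterior -/

/-- The matrix `(k (p i) (p j))_{i,j}`. -/
def kernelMatrix {S : Type*} (k : S → S → ℝ) {n : ℕ} (p : Fin n → S) :
    Matrix (Fin n) (Fin n) ℝ :=
  Matrix.of fun i j => k (p i) (p j)

/-- `k` is a positive semidefinite kernel on `X`. -/
def IsPSDKernelOn {S : Type*} (k : S → S → ℝ) (X : Set S) : Prop :=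
  ∀ (n : ℕ) (p : Fin n → S), (∀ i, p i ∈ X) → (kernelMatrix k p).PosSemidef

/-- The process `f`, indexed by the points of `X`, is a Gaussian process with zero mean and
covariance function `k`. -/
structure IsCenteredGPOn {S Ω : Type*} [MeasurableSpace Ω] (P : Measure Ω) (X : Set S)
    (k : S → S → ℝ) (f : S → Ω → ℝ) : Prop where
  gaussian : IsGaussianProcess (fun (x : X) (ω : Ω) => f x ω) P
  mean : ∀ x ∈ X, P[f x] = 0
  covariance : ∀ x ∈ X, ∀ x' ∈ X, cov[f x, f x'; P] = k x x'

/-- The vector `(k (x, p 1), …, k (x, p n))`. -/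
def kernelVec {S : Type*} (k : S → S → ℝ) {n : ℕ} (p : Fin n → S) (x : S) : Fin n → ℝ :=
  fun i => k x (p i)

/-- The inverse of `K + σ² I`. -/
def regInv {S : Type*} (k : S → S → ℝ) (σ : ℝ) {n : ℕ} (p : Fin n → S) :
    Matrix (Fin n) (Fin n) ℝ :=
  (kernelMatrix k p + σ ^ 2 • (1 : Matrix (Fin n) (Fin n) ℝ))⁻¹

/-- Posterior mean at `x` given the data `(p i, y i)`. -/
def postMean {S : Type*} (k : S → S → ℝ) (σ : ℝ) {n : ℕ} (p : Fin n → S) (y : Fin n → ℝ)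
    (x : S) : ℝ :=
  kernelVec k p x ⬝ᵥ (regInv k σ p).mulVec y

/-- Posterior variance at `x` given observations at the points `p i`. -/
def postVar {S : Type*} (k : S → S → ℝ) (σ : ℝ) {n : ℕ} (p : Fin n → S) (x : S) : ℝ :=
  k x x - kernelVec k p x ⬝ᵥ (regInv k σ p).mulVec (kernelVec k p x)

/-- The acquisition function `μ(x) + ζ^{1/2} σ(x)`, where `μ` and `σ` are the posterior mean and
standard deviation. -/
def ucb {S : Type*} (k : S → S → ℝ) (σ : ℝ) {n : ℕ} (p : Fin n → S) (y : Fin n → ℝ)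
    (ζ : ℝ) (x : S) : ℝ :=
  postMean k σ p y x + √ζ * √(postVar k σ p x)

/-! ### Maximum information gain -/

/-- Shannon mutual information of the two coordinates of a pair with law `π`. -/
def mutualInfo {α β : Type*} [MeasurableSpace α] [MeasurableSpace β] (π : Measure (α × β)) :
    ℝ≥0∞ :=
  klDiv π (π.fst.prod π.snd)

/-- The joint law of `(y_A, f_A)`, where `f_A ∼ N(0, K_A)`, and `y_A = f_A + ε_A` with
`ε_A ∼ N(0, σ² I)` independent of `f_A`. -/
def obsLaw {S : Type*} (k : S → S → ℝ) (σ : ℝ) {n : ℕ} (p : Fin n → S) :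
    Measure (EuclideanSpace ℝ (Fin n) × EuclideanSpace ℝ (Fin n)) :=
  ((multivariateGaussian 0 (kernelMatrix k p)).prod
    (multivariateGaussian 0 (σ ^ 2 • (1 : Matrix (Fin n) (Fin n) ℝ)))).map
      fun u => (u.1 + u.2, u.1)

/-- Maximum information gain from `T` observations at points of `X`, as an extended real. -/
def eMIG {S : Type*} (k : S → S → ℝ) (σ : ℝ) (X : Set S) (T : ℕ) : ℝ≥0∞ :=
  ⨆ (p : Fin T → S) (_ : ∀ i, p i ∈ X), mutualInfo (obsLaw k σ p)

/-- Maximum information gain `γ_T`. -/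
def MIG {S : Type*} (k : S → S → ℝ) (σ : ℝ) (X : Set S) (T : ℕ) : ℝ :=
  (eMIG k σ X T).toReal

/-! ### Derivatives of sample paths -/

/-- The coordinates of `g` are the first-order partial derivatives of the continuous function
`h : X → ℝ`. If `X` has interior points, the partial derivatives are taken there. If it has none,
coordinate lines may leave `X`, and `g` is then a gradient of `h` relative to `X`. -/
structure HasPartialsOn {d : ℕ} (X : Set (Pt d)) (h : Pt d → ℝ) (g : Pt d → Pt d) : Prop where
  continuousOn : ContinuousOn h X
  partials : ∀ x ∈ interior X, ∀ j, HasLineDerivAt ℝ h (g x j) x (EuclideanSpace.single j 1)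
  degenerate : interior X = ∅ → ∀ x ∈ X, HasGradientWithinAt h (g x) X x

/-- Almost surely the sample path of `f` has partial derivatives, and
`Pr (sup_{x ∈ X} |∂f/∂x_j| > L) ≤ a exp (-(L/b)²)` for every coordinate `j` and every `L > 0`. -/
def SubGaussianPartials {d : ℕ} {Ω : Type*} [MeasurableSpace Ω] (P : Measure Ω)
    (X : Set (Pt d)) (f : Pt d → Ω → ℝ) (a b : ℝ) : Prop :=
  ∃ g : Ω → Pt d → Pt d,
    (∀ᵐ ω ∂P, HasPartialsOn X (fun x => f x ω) (g ω)) ∧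
    ∀ (j : Fin d) (L : ℝ), 0 < L →
      P {ω | ENNReal.ofReal L < ⨆ x ∈ X, ‖g ω x j‖ₑ} ≤
        ENNReal.ofReal (a * Real.exp (-(L / b) ^ 2))

/-! ### The algorithm -/

/-- Shifted exponential distribution: the law of `s + Z` with `Z ∼ Exp(lam)`. -/
def shiftedExp (s lam : ℝ) : Measure ℝ :=
  (expMeasure lam).map fun z => s + z

/-- The noisy observation in each round. -/
def obs {S Ω : Type*} (f : S → Ω → ℝ) (ε : ℕ → Ω → ℝ) (x : ℕ → Ω → S) (t : ℕ) (ω : Ω) : ℝ :=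
  f (x t ω) ω + ε t ω

/-- `x` is the sequence of query points of a run of IRGP-UCB on the objective `f`, with noise `ε`
and random confidence parameters `ζ`. Rounds are counted from `0` here, so `x t`, `ε t`, `ζ t`
belong to the round usually numbered `t + 1`, whose shift parameter is `s (t + 1)`.
The query is a measurable function of the data and confidence parameters that are known when it is
made (so ties in the `argmax` are not broken by looking at `f`). -/
structure IsIRGPUCBRun {d : ℕ} {Ω : Type*} [MeasurableSpace Ω] (P : Measure Ω)
    (X : Set (Pt d)) (k : Pt d → Pt d → ℝ) (σ : ℝ) (s : ℕ → ℝ) (lam : ℝ)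
    (f : Pt d → Ω → ℝ) (ε ζ : ℕ → Ω → ℝ) (x : ℕ → Ω → Pt d) : Prop where
  noise_law : ∀ t, HasLaw (ε t) (gaussianReal 0 (Real.toNNReal (σ ^ 2))) P
  conf_law : ∀ t, HasLaw (ζ t) (shiftedExp (s (t + 1)) lam) P
  noise_indep : iIndepFun ε P
  conf_indep : iIndepFun ζ P
  noise_conf_indep : IndepFun (fun ω t => ε t ω) (fun ω t => ζ t ω) P
  objective_indep :
    IndepFun (fun ω (z : X) => f z ω) (fun ω => ((fun t => ε t ω), (fun t => ζ t ω))) P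
  nonanticipating : ∃ sel : ∀ t : ℕ, (Fin t → Pt d × ℝ) × (Fin (t + 1) → ℝ) → Pt d,
    (∀ t, Measurable (sel t)) ∧
    ∀ t ω, x t ω = sel t (fun i => (x i ω, obs f ε x i ω), fun i => ζ i ω)
  query_mem : ∀ t ω, x t ω ∈ X
  query_argmax : ∀ᵐ ω ∂P, ∀ t, IsMaxOn
    (ucb k σ (fun i : Fin t => x i ω) (fun i : Fin t => obs f ε x i ω) (ζ t ω)) X (x t ω)

/-- Cumulative regret `∑_{t ≤ T} (max_{z ∈ X} f(z) - f(x_t))`. -/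
def cumRegret {S Ω : Type*} (X : Set S) (f : S → Ω → ℝ) (x : ℕ → Ω → S) (T : ℕ) (ω : Ω) : ℝ :=
  ∑ t ∈ Finset.range T, (sSup ((fun z => f z ω) '' X) - f (x t ω) ω)

/-- The shift `s_t = 2 d log (b d r t² (√(log (a d)) + √π / 2)) - 2 log 2`. -/
def shift (a b r : ℝ) (d t : ℕ) : ℝ :=
  2 * d * Real.log (b * d * r * (t : ℝ) ^ 2 * (√(Real.log (a * d)) + √Real.pi / 2))
    - 2 * Real.log 2

end BayesOpt

end

/-! The regret of round t is compared with the width of the confidence bound at the query point, at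
the price 1/t² for discretizing X. Three facts carry the argument.

Discretization. Off an event of small probability all partial derivatives are at most L, so sample
paths are ℓ-Lipschitz in the ℓ¹ distance with E ℓ ≤ b(√log(ad) + √π/2)
(`SubGaussianPartials.exists_lipschitz`). A net of m^d points with ℓ¹ mesh dr/(2m) (`exists_net`)
therefore costs at most E ℓ · dr/(2m) in expectation. With τ = E-bound · dr · t² and m = ⌊τ⌋ ≥ 1 the
cost is at most 1/t², because 2m ≥ m + 1 > τ; these costs sum to at most π²/6
(`le_inv_sq_add_of_grid`, `sum_inv_sq_le`).

Randomized width. Given the history, the values of f at N net points are Gaussian with means μ_j and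
variances σ_j². If ζ is s + Exp(1/2) with s ≥ 2 log(N/2), then E max_j f(z_j) ≤ E max_j (μ_j + √ζ
σ_j) (`integral_sup'_le_integral_maxBound`). The tails compare level by level: the union bound for
the left side is (N/2) exp(-m²/2), while ζ > m² has probability at least the minimum of this and 1.
With N = m^d ≤ τ^d this is where s_t comes from. Since x_t maximizes the acquisition function, the
right side is at most E[μ(x_t) + √ζ_t σ(x_t)], and E f(x_t) = E μ(x_t), so the gap to the net is at
most E[√ζ_t σ(x_t)] (`IsModelRun.integral_gap_le`).

Information. Cauchy–Schwarz bounds the sum of these widths by the square root of E ∑ ζ_t⁺ times E ∑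
σ²(x_t). The first factor is at most T(2 + s_T) when s_T ≥ 0, and the second at most C₁ γ_T for
every realization (`sum_postVar_le`): the determinant of K + σ²I factors into the numbers σ² +
σ²_{t-1}(x_t), so the mutual information is ½ ∑ log(1 + σ⁻² σ²_{t-1}(x_t)).

The delicate point is the conditional law of f given data gathered adaptively. The joint law of
observations, confidence parameters and path has a density with respect to Lebesgue measure × law of
the past parameters × (law of the next parameter × prior), and this density is the likelihood of a
fixed design, evaluated at the points which the policy selects from the history
(`IsModelRun.hasLaw_joint`, `adaptiveLik_policyQuery`). So on each fiber the posterior is that of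
ordinary Gaussian regression. As the design depends on the observations y, Bayes' formula is needed
at every y, not almost every y; continuity in y provides this (`map_withDensity_of_indepFun`).

If s_T < 0, the square root may vanish, but then the Lipschitz scale is so small that the whole
regret is at most 1 < π²/6. -/

namespace BayesOpt

/-! ### Adaptive observations and their joint density -/

/-- Integrating over `Fin (n + 1) → ℝ` by integrating out the last coordinate first. -/
lemma lintegral_pi_snoc (μ : Measure ℝ) [SigmaFinite μ] (n : ℕ)
    {f : (Fin (n + 1) → ℝ) → ℝ≥0∞} (hf : Measurable f) :
    ∫⁻ y, f y ∂(Measure.pi fun _ : Fin (n + 1) => μ) =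
      ∫⁻ y, ∫⁻ a, f (Fin.snoc (α := fun _ => ℝ) y a) ∂μ ∂(Measure.pi fun _ : Fin n => μ) := by
  have h := (measurePreserving_piFinSuccAbove (fun _ : Fin (n + 1) => μ) (Fin.last n)).symm
  rw [← h.lintegral_comp hf, lintegral_prod_symm]
  swap
  · exact (hf.comp (MeasurableEquiv.measurable _)).aemeasurable
  refine lintegral_congr fun y => lintegral_congr fun a => ?_
  congr 1
  simp [MeasurableEquiv.piFinSuccAbove, Fin.insertNthEquiv, Fin.insertNth_last']

lemma measurable_snoc {α : Type*} [MeasurableSpace α] (n : ℕ) :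
    Measurable fun u : (Fin n → α) × α => (Fin.snoc (α := fun _ => α) u.1 u.2 : Fin (n + 1) → α) := by
  rw [measurable_pi_iff]
  intro i
  refine Fin.lastCases ?_ (fun j => ?_) i
  · simpa using measurable_snd
  · simpa [Function.comp_def] using (measurable_pi_apply j).comp measurable_fst

lemma measurable_init {α : Type*} [MeasurableSpace α] (n : ℕ) :
    Measurable fun u : Fin (n + 1) → α => (Fin.init u : Fin n → α) :=
  measurable_pi_iff.2 fun i => measurable_pi_apply i.castSucc

/-- The observations `y_i = q_i (y_0, …, y_{i-1}) + e_i`. -/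
noncomputable def adaptiveObs (q : ∀ t, (Fin t → ℝ) → ℝ) : ∀ t, (Fin t → ℝ) → Fin t → ℝ
  | 0, e => e
  | t + 1, e => Fin.snoc (α := fun _ => ℝ) (adaptiveObs q t (Fin.init e))
      (q t (adaptiveObs q t (Fin.init e)) + e (Fin.last t))

/-- The joint density of the observations `y_i = q_i (y_0, …, y_{i-1}) + e_i`, where the `e_i` are
independent `N(0, v)`. -/
noncomputable def adaptiveLik (v : NNReal) (q : ∀ t, (Fin t → ℝ) → ℝ) :
    ∀ t, (Fin t → ℝ) → ℝ≥0∞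
  | 0, _ => 1
  | t + 1, y => adaptiveLik v q t (Fin.init y) * gaussianPDF (q t (Fin.init y)) v (y (Fin.last t))

lemma measurable_adaptiveObs {q : ∀ t, (Fin t → ℝ) → ℝ} (hq : ∀ t, Measurable (q t)) (t : ℕ) :
    Measurable (adaptiveObs q t) := by
  induction t with
  | zero => exact measurable_id
  | succ t ih =>
    have h := ih.comp (measurable_init t)
    exact (measurable_snoc t).comp (h.prodMk (((hq t).comp h).add (measurable_pi_apply _)))

lemma measurable_gaussianPDF_comp {α : Type*} [MeasurableSpace α] {m y : α → ℝ} (v : NNReal)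
    (hm : Measurable m) (hy : Measurable y) : Measurable fun a => gaussianPDF (m a) v (y a) :=
  measurable_uncurry_gaussianPDF.comp (hm.prodMk (measurable_const.prodMk hy))

lemma measurable_adaptiveLik (v : NNReal) {q : ∀ t, (Fin t → ℝ) → ℝ} (hq : ∀ t, Measurable (q t))
    (t : ℕ) : Measurable (adaptiveLik v q t) := by
  induction t with
  | zero => exact measurable_const
  | succ t ih =>
    exact (ih.comp (measurable_init t)).mul
      (measurable_gaussianPDF_comp v ((hq t).comp (measurable_init t)) (measurable_pi_apply _))

lemma lintegral_gaussianReal_add {v : NNReal} (hv : v ≠ 0) (m : ℝ) {h : ℝ → ℝ≥0∞}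
    (hh : Measurable h) :
    ∫⁻ e, h (m + e) ∂gaussianReal 0 v = ∫⁻ y, gaussianPDF m v y * h y := by
  rw [← lintegral_map hh (measurable_const_add m), gaussianReal_map_const_add, zero_add,
    gaussianReal_of_var_ne_zero _ hv,
    lintegral_withDensity_eq_lintegral_mul _ (measurable_gaussianPDF _ _) hh]
  rfl

/-- Given the earlier coordinates, the last observation is a translate of the last noise variable.
The map from noise to observations is thus triangular with unit diagonal, and the last coordinate
can be integrated out first. -/
lemma lintegral_adaptiveObs {v : NNReal} (hv : v ≠ 0) {q : ∀ t, (Fin t → ℝ) → ℝ}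
    (hq : ∀ t, Measurable (q t)) (t : ℕ) {φ : (Fin t → ℝ) → ℝ≥0∞} (hφ : Measurable φ) :
    ∫⁻ e, φ (adaptiveObs q t e) ∂(Measure.pi fun _ => gaussianReal 0 v) =
      ∫⁻ y, adaptiveLik v q t y * φ y := by
  induction t with
  | zero =>
    rw [volume_pi, Measure.pi_of_empty _ (0 : Fin 0 → ℝ), Measure.pi_of_empty _ (0 : Fin 0 → ℝ)]
    simp [lintegral_dirac, adaptiveObs, adaptiveLik]
  | succ t ih =>
    have hm : Measurable fun y : Fin (t + 1) → ℝ => adaptiveLik v q (t + 1) y * φ y :=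
      (measurable_adaptiveLik v hq _).mul hφ
    rw [volume_pi, lintegral_pi_snoc _ _ hm,
      lintegral_pi_snoc _ _ (f := fun e => φ (adaptiveObs q (t + 1) e))
        (hφ.comp (measurable_adaptiveObs hq _)), ← volume_pi]
    have hs : Measurable fun u : (Fin t → ℝ) × ℝ => φ (Fin.snoc (α := fun _ => ℝ) u.1 u.2) :=
      hφ.comp (measurable_snoc t)
    have hd : Measurable fun u : (Fin t → ℝ) × ℝ => gaussianPDF (q t u.1) v u.2 :=
      measurable_gaussianPDF_comp v ((hq t).comp measurable_fst) measurable_snd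
    -- The integral over the last observation is a function of the first t observations, to which
    -- the induction hypothesis applies.
    have hG := (hd.mul hs).lintegral_prod_right' (ν := (volume : Measure ℝ))
    rw [← lintegral_congr fun e => ?_, ih hG]
    · refine lintegral_congr fun y => ?_
      rw [← lintegral_const_mul]
      · simp [adaptiveLik, Fin.init_snoc, mul_assoc]
      · exact (hd.mul hs).comp measurable_prodMk_left
    · have := lintegral_gaussianReal_add hv (q t (adaptiveObs q t e))
        (hs.comp (measurable_prodMk_left (x := adaptiveObs q t e)))
      simp only [Function.comp_def] at this
      simp only [adaptiveObs, Fin.init_snoc, Fin.snoc_last, this]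
      rfl

/-- A nonadaptive special case of `lintegral_adaptiveObs`. -/
lemma lintegral_pi_gaussianReal_add {v : NNReal} (hv : v ≠ 0) {n : ℕ} (u : Fin n → ℝ)
    {φ : (Fin n → ℝ) → ℝ≥0∞} (hφ : Measurable φ) :
    ∫⁻ e, φ (u + e) ∂(Measure.pi fun _ => gaussianReal 0 v) =
      ∫⁻ y, (∏ i, gaussianPDF (u i) v (y i)) * φ y := by
  -- `adaptiveObs` wants a rule for every round; the zeros beyond round n are never read.
  set w : ℕ → ℝ := fun i => if h : i < n then u ⟨i, h⟩ else 0
  have hw : ∀ i : Fin n, w i = u i := fun i => by simp [w]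
  have h1 : ∀ (t : ℕ) (e : Fin t → ℝ), adaptiveObs (fun t _ => w t) t e = fun i : Fin t => w i + e i := by
    intro t
    induction t with
    | zero => intro e; funext i; exact i.elim0
    | succ t ih =>
      intro e
      funext i
      refine Fin.lastCases ?_ (fun j => ?_) i
      · simp [adaptiveObs]
      · simp [adaptiveObs, ih, Fin.init]
  have h2 : ∀ (t : ℕ) (y : Fin t → ℝ), adaptiveLik v (fun t _ => w t) t y =
      ∏ i : Fin t, gaussianPDF (w i) v (y i) := by
    intro t
    induction t with
    | zero => intro y; simp [adaptiveLik]
    | succ t ih => intro y; simp [adaptiveLik, Fin.prod_univ_castSucc, ih, Fin.init]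
  have h := lintegral_adaptiveObs hv (q := fun t _ => w t) (fun t => measurable_const) n hφ
  simp only [h1, h2, hw] at h
  exact h

end BayesOpt

/-! ### Bayes' formula for a fixed design -/

namespace BayesOpt

section Bayes

variable {W : Type*} [MeasurableSpace W] {ν : Measure W} [IsProbabilityMeasure ν] {n : ℕ}
  {U : Fin n → W → ℝ} {V : W → ℝ} {v τ : NNReal} {a : Fin n → ℝ}

lemma measurable_prod_gaussianPDF {α : Type*} [MeasurableSpace α] {m y : Fin n → α → ℝ}
    (hm : ∀ i, Measurable (m i)) (hy : ∀ i, Measurable (y i)) :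
    Measurable fun w => ∏ i, gaussianPDF (m i w) v (y i w) :=
  Finset.measurable_prod _ fun i _ => measurable_gaussianPDF_comp v (hm i) (hy i)

lemma gaussianPDF_le (m : ℝ) (v : NNReal) (x : ℝ) :
    gaussianPDF m v x ≤ ENNReal.ofReal (√(2 * Real.pi * v))⁻¹ := by
  refine ENNReal.ofReal_le_ofReal ?_
  unfold gaussianPDFReal
  refine mul_le_of_le_one_right (by positivity) (Real.exp_le_one_iff.2 ?_)
  rw [neg_div]
  exact neg_nonpos.2 (by positivity)

lemma continuous_prod_gaussianPDF (u : Fin n → ℝ) (v : NNReal) :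
    Continuous fun y : Fin n → ℝ => ∏ i, gaussianPDF (u i) v (y i) := by
  have h : (fun y : Fin n → ℝ => ∏ i, gaussianPDF (u i) v (y i)) =
      fun y => ENNReal.ofReal (∏ i, gaussianPDFReal (u i) v (y i)) := by
    funext y
    rw [ENNReal.ofReal_prod_of_nonneg fun i _ => gaussianPDFReal_nonneg _ _ _]
    rfl
  rw [h]
  refine ENNReal.continuous_ofReal.comp (continuous_finsetProd _ fun i _ => ?_)
  unfold gaussianPDFReal
  fun_prop

lemma prod_gaussianPDF_le (u : Fin n → ℝ) (v : NNReal) (y : Fin n → ℝ) :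
    ∏ i, gaussianPDF (u i) v (y i) ≤ ENNReal.ofReal (√(2 * Real.pi * v))⁻¹ ^ n := by
  refine (Finset.prod_le_pow_card _ _ _ fun i _ => gaussianPDF_le _ _ _).trans ?_
  simp

/-- The marginal density at `y` of observations `y_i = U_i + e_i`. -/
noncomputable def evidence (ν : Measure W) (U : Fin n → W → ℝ) (v : NNReal) (y : Fin n → ℝ) :
    ℝ≥0∞ :=
  ∫⁻ w, ∏ i, gaussianPDF (U i w) v (y i) ∂ν

lemma evidence_ne_top (y : Fin n → ℝ) : evidence ν U v y ≠ ∞ := by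
  refine ((lintegral_mono fun w => prod_gaussianPDF_le _ v y).trans_lt ?_).ne
  simp only [lintegral_const, measure_univ, mul_one]
  exact ENNReal.pow_lt_top ENNReal.ofReal_lt_top

lemma evidence_pos (hv : v ≠ 0) (hU : ∀ i, Measurable (U i)) (y : Fin n → ℝ) :
    0 < evidence ν U v y := by
  rw [evidence, lintegral_pos_iff_support
    (measurable_prod_gaussianPDF hU fun _ => measurable_const)]
  have : (Function.support fun w => ∏ i, gaussianPDF (U i w) v (y i)) = Set.univ := by
    ext w
    simp [Finset.prod_ne_zero_iff, (gaussianPDF_pos _ hv _).ne']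
  simp [this]

/-- Dominated convergence: the Gaussian densities are continuous and uniformly bounded in y. This is
what promotes almost everywhere identities in y to identities at every y. -/
lemma continuous_lintegral_lik (hU : ∀ i, Measurable (U i)) {h : W → NNReal} (hh : Measurable h)
    {B : NNReal} (hB : ∀ w, h w ≤ B) :
    Continuous fun y : Fin n → ℝ => ∫⁻ w, (∏ i, gaussianPDF (U i w) v (y i)) * h w ∂ν := by
  refine continuous_iff_continuousAt.2 fun y => ?_
  refine tendsto_lintegral_filter_of_dominated_convergence
    (fun _ => ENNReal.ofReal (√(2 * Real.pi * v))⁻¹ ^ n * B) (Filter.Eventually.of_forall fun y => ?_)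
    (Filter.Eventually.of_forall fun y => Filter.Eventually.of_forall fun w => ?_) ?_
    (Filter.Eventually.of_forall fun w => ?_)
  · exact (measurable_prod_gaussianPDF hU fun _ => measurable_const).mul hh.coe_nnreal_ennreal
  · exact mul_le_mul' (prod_gaussianPDF_le _ _ _) (by exact_mod_cast hB w)
  · simp only [lintegral_const, measure_univ, mul_one]
    exact ENNReal.mul_ne_top (ENNReal.pow_ne_top ENNReal.ofReal_ne_top) ENNReal.coe_ne_top
  · exact ENNReal.Tendsto.mul_const ((continuous_prod_gaussianPDF _ v).tendsto y)
      (Or.inr ENNReal.coe_ne_top)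

lemma continuous_evidence (hU : ∀ i, Measurable (U i)) : Continuous (evidence ν U v) := by
  have := continuous_lintegral_lik (ν := ν) (v := v) hU (h := fun _ => 1) measurable_const
    (B := 1) fun _ => le_rfl
  simp only [ENNReal.coe_one, mul_one] at this
  exact this

/-- If `V - ∑ a_i Y_i` is independent of the observations `Y_i = U_i + e_i`, then the posterior of
`V` is Gaussian with mean `∑ a_i y_i`, at every `y`. -/
lemma map_withDensity_of_indepFun (hv : v ≠ 0) (hU : ∀ i, Measurable (U i)) (hV : Measurable V)
    (hind : IndepFun (fun q : W × (Fin n → ℝ) => fun i => U i q.1 + q.2 i)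
      (fun q => V q.1 - ∑ i, a i * (U i q.1 + q.2 i))
      (ν.prod (Measure.pi fun _ => gaussianReal 0 v)))
    (hlaw : HasLaw (fun q : W × (Fin n → ℝ) => V q.1 - ∑ i, a i * (U i q.1 + q.2 i))
      (gaussianReal 0 τ) (ν.prod (Measure.pi fun _ => gaussianReal 0 v)))
    (y : Fin n → ℝ) :
    (ν.withDensity fun w => ∏ i, gaussianPDF (U i w) v (y i)).map V =
      evidence ν U v y • gaussianReal (∑ i, a i * y i) τ := by
  have hfin : ∀ y : Fin n → ℝ,
      IsFiniteMeasure (ν.withDensity fun w => ∏ i, gaussianPDF (U i w) v (y i)) :=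
    fun y => isFiniteMeasure_withDensity (evidence_ne_top y)
  have hmY : Measurable fun q : W × (Fin n → ℝ) => fun i => U i q.1 + q.2 i :=
    measurable_pi_iff.2 fun i =>
      ((hU i).comp measurable_fst).add ((measurable_pi_apply i).comp measurable_snd)
  have hma : Measurable fun y : Fin n → ℝ => ∑ i, a i * y i := by fun_prop
  have hmR : Measurable fun q : W × (Fin n → ℝ) => V q.1 - ∑ i, a i * (U i q.1 + q.2 i) :=
    (hV.comp measurable_fst).sub (hma.comp hmY)
  -- Path and observations have joint density the likelihood, with respect to ν × Lebesgue.
  have hshift : ∀ φ : W → (Fin n → ℝ) → ℝ≥0∞, Measurable (Function.uncurry φ) →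
      ∫⁻ q, φ q.1 (fun i => U i q.1 + q.2 i) ∂(ν.prod (Measure.pi fun _ => gaussianReal 0 v)) =
        ∫⁻ y, ∫⁻ w, (∏ i, gaussianPDF (U i w) v (y i)) * φ w y ∂ν := by
    intro φ hφ
    have hm : Measurable fun q : W × (Fin n → ℝ) => φ q.1 (fun i => U i q.1 + q.2 i) :=
      hφ.comp (measurable_fst.prodMk hmY)
    rw [lintegral_prod _ hm.aemeasurable,
      ← lintegral_lintegral_swap (f := fun w y => (∏ i, gaussianPDF (U i w) v (y i)) * φ w y)]
    · refine lintegral_congr fun w => ?_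
      exact lintegral_pi_gaussianReal_add hv (fun i => U i w)
        (hφ.comp (measurable_prodMk_left (x := w)))
    · exact ((measurable_prod_gaussianPDF (fun i => (hU i).comp measurable_fst)
        fun i => (measurable_pi_apply i).comp measurable_snd).mul hφ).aemeasurable
  -- The formula for almost every y, tested against indicators of sets of observations.
  have hae : ∀ h : BoundedContinuousFunction ℝ NNReal,
      (fun y : Fin n → ℝ => ∫⁻ w, (∏ i, gaussianPDF (U i w) v (y i)) * h (V w) ∂ν) =ᵐ[volume]
        fun y => evidence ν U v y * ∫⁻ r, h (∑ i, a i * y i + r) ∂gaussianReal 0 τ := by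
    intro h
    have hh : Measurable fun x => (h x : ℝ≥0∞) := h.continuous.measurable.coe_nnreal_ennreal
    have hH : Measurable fun m : ℝ => ∫⁻ r, h (m + r) ∂gaussianReal 0 τ :=
      Measurable.lintegral_prod_right' (f := fun u : ℝ × ℝ => (h (u.1 + u.2) : ℝ≥0∞))
        (hh.comp measurable_add)
    refine ae_eq_of_forall_setLIntegral_eq_of_sigmaFinite
      (continuous_lintegral_lik hU (h.continuous.measurable.comp hV)
        (fun w => h.apply_le_nndist_zero _)).measurable
      ((continuous_evidence hU).measurable.mul (hH.comp hma)) fun s hs _ => ?_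
    have hi : Measurable (s.indicator (1 : (Fin n → ℝ) → ℝ≥0∞)) := measurable_one.indicator hs
    have e1 := hshift (fun w y => s.indicator 1 y * h (V w))
      ((hi.comp measurable_snd).mul (hh.comp (hV.comp measurable_fst)))
    have e2 := hshift (fun w y => s.indicator 1 y * ∫⁻ r, h (∑ i, a i * y i + r) ∂gaussianReal 0 τ)
      ((hi.comp measurable_snd).mul (hH.comp (hma.comp measurable_snd)))
    -- V is the regression ∑ a_i Y_i plus a residual independent of Y, so the residual may be
    -- replaced by a fresh N(0, τ) variable.
    have e3 : ∫⁻ q, s.indicator 1 (fun i => U i q.1 + q.2 i) * (h (V q.1) : ℝ≥0∞)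
          ∂(ν.prod (Measure.pi fun _ => gaussianReal 0 v)) =
        ∫⁻ q, s.indicator 1 (fun i => U i q.1 + q.2 i) *
          ∫⁻ r, h (∑ i, a i * (U i q.1 + q.2 i) + r) ∂gaussianReal 0 τ
          ∂(ν.prod (Measure.pi fun _ => gaussianReal 0 v)) := by
      have hlawY : HasLaw (fun q : W × (Fin n → ℝ) => fun i => U i q.1 + q.2 i)
          ((ν.prod (Measure.pi fun _ => gaussianReal 0 v)).map
            fun q : W × (Fin n → ℝ) => fun i => U i q.1 + q.2 i)
          (ν.prod (Measure.pi fun _ => gaussianReal 0 v)) := ⟨hmY.aemeasurable, rfl⟩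
      have hprod := (indepFun_iff_hasLaw_prodMk_prod hlawY hlaw).1 hind
      have hg : Measurable fun u : (Fin n → ℝ) × ℝ =>
          s.indicator 1 u.1 * (h (∑ i, a i * u.1 i + u.2) : ℝ≥0∞) :=
        (hi.comp measurable_fst).mul (hh.comp ((hma.comp measurable_fst).add measurable_snd))
      have hc := hprod.lintegral_comp hg.aemeasurable
      have : IsProbabilityMeasure ((ν.prod (Measure.pi fun _ => gaussianReal 0 v)).map
            fun q : W × (Fin n → ℝ) => fun i => U i q.1 + q.2 i) :=
        Measure.isProbabilityMeasure_map hmY.aemeasurable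
      calc _ = _ := lintegral_congr fun q => by
                simp only [add_sub_cancel]
        _ = _ := hc
        _ = _ := lintegral_prod _ hg.aemeasurable
        _ = _ := by
          rw [lintegral_map ?_ hmY]
          · refine lintegral_congr fun q => lintegral_const_mul (s.indicator 1 fun i => U i q.1 + q.2 i) (f := fun r : ℝ =>
              (h (∑ i, a i * (U i q.1 + q.2 i) + r) : ℝ≥0∞)) (hh.comp (measurable_const_add _))
          · exact hg.lintegral_prod_right'
    rw [← lintegral_indicator hs, ← lintegral_indicator hs]
    have e4 : ∀ (g : (Fin n → ℝ) → ℝ≥0∞), s.indicator g = fun y => s.indicator (1 : (Fin n → ℝ) → ℝ≥0∞) y * g y := by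
      intro g
      funext y
      by_cases hy : y ∈ s <;> simp [hy]
    rw [e4, e4 fun y => evidence ν U v y * _]
    refine Eq.trans ?_ ((e1.symm.trans (e3.trans e2)).trans ?_)
    · refine lintegral_congr fun y => ?_
      rw [← lintegral_const_mul]
      · exact lintegral_congr fun w => mul_left_comm _ _ _
      · exact (measurable_prod_gaussianPDF hU fun _ => measurable_const).mul (hh.comp hV)
    · refine lintegral_congr fun y => ?_
      rw [lintegral_mul_const _ (measurable_prod_gaussianPDF hU fun _ => measurable_const)]
      exact mul_left_comm _ _ _
  -- Both sides are continuous in y and Lebesgue measure charges every nonempty open set, so no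
  -- exceptional y remains.
  have hall : ∀ h : BoundedContinuousFunction ℝ NNReal,
      (fun y : Fin n → ℝ => ∫⁻ w, (∏ i, gaussianPDF (U i w) v (y i)) * h (V w) ∂ν) =
        fun y => evidence ν U v y * ∫⁻ r, h (∑ i, a i * y i + r) ∂gaussianReal 0 τ := by
    intro h
    have hb : ∀ x, h x ≤ nndist 0 h := fun w => h.apply_le_nndist_zero _
    have c1 : Continuous fun y : Fin n → ℝ => ∫⁻ w, (∏ i, gaussianPDF (U i w) v (y i)) * h (V w) ∂ν :=
      continuous_lintegral_lik hU (h.continuous.measurable.comp hV) (fun w => hb _)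
    have hfin2 : ∀ y : Fin n → ℝ, ∫⁻ r, h (∑ i, a i * y i + r) ∂gaussianReal 0 τ ≠ ∞ := fun y => by
      refine ((lintegral_mono fun r => ENNReal.coe_le_coe.2 (hb _)).trans_lt ?_).ne
      rw [lintegral_const, measure_univ, mul_one]
      exact ENNReal.coe_lt_top
    have c2 : Continuous fun y : Fin n → ℝ => ∫⁻ r, h (∑ i, a i * y i + r) ∂gaussianReal 0 τ := by
      refine continuous_iff_continuousAt.2 fun y => ?_
      refine tendsto_lintegral_filter_of_dominated_convergence (fun _ => nndist 0 h)
        (Filter.Eventually.of_forall fun y => ?_)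
        (Filter.Eventually.of_forall fun y => Filter.Eventually.of_forall fun w => ?_) ?_
        (Filter.Eventually.of_forall fun w => ?_)
      · exact (h.continuous.measurable.comp (measurable_const_add _)).coe_nnreal_ennreal
      · exact_mod_cast hb _
      · simp
      · refine Continuous.tendsto (ENNReal.continuous_coe.comp (h.continuous.comp ?_)) y
        fun_prop
    refine Continuous.ae_eq_iff_eq (volume : Measure (Fin n → ℝ)) c1 ?_ |>.1 (hae h)
    refine continuous_iff_continuousAt.2 fun y => ?_
    exact ENNReal.Tendsto.mul (continuous_evidence hU).continuousAt (Or.inr (hfin2 y))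
      c2.continuousAt (Or.inr (evidence_ne_top y))
  have hs : IsFiniteMeasure (evidence ν U v y • gaussianReal (∑ i, a i * y i) τ) :=
    Measure.smul_finite _ (evidence_ne_top y)
  have := hfin y
  refine ext_of_forall_lintegral_eq_of_IsFiniteMeasure fun h => ?_
  have hh : Measurable fun x => (h x : ℝ≥0∞) := h.continuous.measurable.coe_nnreal_ennreal
  have hm : Measurable fun w => ∏ i, gaussianPDF (U i w) v (y i) :=
    measurable_prod_gaussianPDF hU fun _ => measurable_const
  rw [lintegral_map hh hV, lintegral_withDensity_eq_lintegral_mul _ hm (g := fun w => (h (V w) : ℝ≥0∞)) (hh.comp hV),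
    lintegral_smul_measure]
  have e := congrFun (hall h) y
  rw [← add_zero (∑ i, a i * y i), add_comm, ← gaussianReal_map_const_add,
    lintegral_map hh (measurable_const_add _)]
  exact e

end Bayes

end BayesOpt

/-! ### Gaussian linear regression -/

namespace BayesOpt

/-- Gaussian linear regression: the residual of `B` after regression on noisy observations
`A i + E i` is independent of the observations. -/
lemma indepFun_residual {Q : Type*} [MeasurableSpace Q] {ρ : Measure Q} {n : ℕ}
    {A E : Fin n → Q → ℝ} {B : Q → ℝ}
    (hG : HasGaussianLaw (fun q => ((fun i => A i q, B q), fun i => E i q)) ρ)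
    {K : Fin n → Fin n → ℝ} {κ : Fin n → ℝ} {v : ℝ}
    (hAA : ∀ i j, cov[A i, A j; ρ] = K i j) (hBA : ∀ i, cov[B, A i; ρ] = κ i)
    (hEE : ∀ i j, cov[E i, E j; ρ] = if i = j then v else 0) (hAE : ∀ i j, cov[A i, E j; ρ] = 0)
    (hBE : ∀ i, cov[B, E i; ρ] = 0) (hA0 : ∀ i, ρ[A i] = 0) (hB0 : ρ[B] = 0)
    (hE0 : ∀ i, ρ[E i] = 0) {a : Fin n → ℝ} (ha : ∀ i, ∑ j, a j * K i j + v * a i = κ i) :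
    IndepFun (fun q i => A i q + E i q) (fun q => B q - ∑ i, a i * (A i q + E i q)) ρ ∧
      HasLaw (fun q => B q - ∑ i, a i * (A i q + E i q))
        (gaussianReal 0 (Var[B; ρ] - ∑ i, a i * κ i).toNNReal) ρ := by
  have := hG.isProbabilityMeasure
  have mA : ∀ i, MemLp (A i) 2 ρ := fun i => (hG.fst.fst.eval i).memLp_two
  have mB : MemLp B 2 ρ := hG.fst.snd.memLp_two
  have mE : ∀ i, MemLp (E i) 2 ρ := fun i => (hG.snd.eval i).memLp_two
  have mY : ∀ i, MemLp (fun q => A i q + E i q) 2 ρ := fun i => (mA i).add (mE i)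
  have mS : MemLp (fun q => ∑ i, a i * (A i q + E i q)) 2 ρ :=
    memLp_finsetSum _ fun i _ => (mY i).const_mul _
  -- Observations and residual form a linear image of a Gaussian vector, hence are jointly Gaussian,
  -- and zero covariance means independence. The residual is a `Unit`-indexed family because the
  -- criterion concerns two families.
  let L : ((Fin n → ℝ) × ℝ) × (Fin n → ℝ) →ₗ[ℝ] (Fin n → ℝ) × (Unit → ℝ) :=
    { toFun := fun z => (fun i => z.1.1 i + z.2 i, fun _ => z.1.2 - ∑ i, a i * (z.1.1 i + z.2 i))
      map_add' := fun z z' => by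
        ext i
        · simp only [Prod.fst_add, Prod.snd_add, Pi.add_apply]; ring
        · simp only [Prod.fst_add, Prod.snd_add, Pi.add_apply, mul_add, Finset.sum_add_distrib]
          ring
      map_smul' := fun c z => by
        ext i
        · simp [mul_add]
        · simp only [Prod.smul_fst, Prod.smul_snd, Pi.smul_apply, smul_eq_mul, RingHom.id_apply,
            mul_sub, Finset.mul_sum]
          congr 1
          exact Finset.sum_congr rfl fun i _ => by ring }
  have mR : MemLp (fun q => B q - ∑ i, a i * (A i q + E i q)) 2 ρ := mB.sub mS
  have hYR : HasGaussianLaw (fun q => ((fun i => A i q + E i q),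
      fun _ : Unit => B q - ∑ i, a i * (A i q + E i q))) ρ :=
    hG.map_fun (LinearMap.toContinuousLinearMap L)
  have hAY : ∀ i j, cov[fun q => A i q + E i q, fun q => A j q + E j q; ρ] =
      K i j + if i = j then v else 0 := fun i j => by
    change cov[A i + E i, A j + E j; ρ] = _
    rw [covariance_add_left (mA i) (mE i) ((mA j).add (mE j)),
      covariance_add_right (mA i) (mA j) (mE j), covariance_add_right (mE i) (mA j) (mE j),
      hAA, hEE, hAE, covariance_comm, hAE]
    ring
  have hBY : ∀ i, cov[B, fun q => A i q + E i q; ρ] = κ i := fun i => by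
    change cov[B, A i + E i; ρ] = _
    rw [covariance_add_right mB (mA i) (mE i), hBA, hBE, add_zero]
  -- The normal equations `ha` say exactly that the regression has the same covariance with each
  -- observation as B.
  have hYS : ∀ i, cov[fun q => A i q + E i q, fun q => ∑ j, a j * (A j q + E j q); ρ] = κ i := by
    intro i
    rw [covariance_fun_sum_right (fun j => (mY j).const_mul (a j)) (mY i), ← ha i]
    simp_rw [covariance_const_mul_right, hAY, mul_add, Finset.sum_add_distrib]
    simp [mul_comm]
  have hRY : ∀ i, cov[fun q => A i q + E i q, fun q => B q - ∑ j, a j * (A j q + E j q); ρ] = 0 := by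
    intro i
    rw [covariance_fun_sub_right (mY i) mB mS, hYS, covariance_comm, hBY, sub_self]
  constructor
  · have h := hYR.indepFun_of_covariance_eval (fun i _ => hRY i)
    exact h.comp (φ := id) (ψ := fun u : Unit → ℝ => u ()) measurable_id (measurable_pi_apply _)
  · have hR : HasGaussianLaw (fun q => B q - ∑ i, a i * (A i q + E i q)) ρ := hYR.snd.eval ()
    refine ⟨hR.aemeasurable, ?_⟩
    rw [hR.map_eq_gaussianReal]
    have hBS : cov[B, fun q => ∑ j, a j * (A j q + E j q); ρ] = ∑ i, a i * κ i := by
      rw [covariance_fun_sum_right (fun j => (mY j).const_mul (a j)) mB]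
      simp only [covariance_const_mul_right, hBY]
    -- The residual R is uncorrelated with the regression, so Var R = cov(B, R) = Var B - ∑ a_i κ_i.
    have hSR : cov[fun q => ∑ j, a j * (A j q + E j q),
        fun q => B q - ∑ j, a j * (A j q + E j q); ρ] = 0 := by
      rw [covariance_fun_sum_left (fun j => (mY j).const_mul (a j)) mR]
      simp only [covariance_const_mul_left, hRY, mul_zero, Finset.sum_const_zero]
    congr 2
    · have hYint : ∀ i, Integrable (fun q => A i q + E i q) ρ := fun i =>
        (mY i).integrable one_le_two
      rw [integral_sub (mB.integrable one_le_two) (mS.integrable one_le_two), hB0,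
        integral_finsetSum _ fun i _ => (hYint i).const_mul _]
      have : ∀ i, ∫ q, A i q + E i q ∂ρ = 0 := fun i => by
        rw [integral_add ((mA i).integrable one_le_two) ((mE i).integrable one_le_two), hA0, hE0,
          add_zero]
      simp [integral_const_mul, this]
    · rw [← covariance_self hR.aemeasurable, covariance_fun_sub_left mB mS mR, hSR,
        covariance_fun_sub_right mB mB mS, hBS, covariance_self mB.aemeasurable, sub_zero]

/-- Bayes' formula for Gaussian regression with a fixed design, at every value `y` of the
observations. -/
lemma map_withDensity_gaussian {W : Type*} [MeasurableSpace W] {ν : Measure W}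
    [IsProbabilityMeasure ν] {n : ℕ} {U : Fin n → W → ℝ} {V : W → ℝ}
    (hU : ∀ i, Measurable (U i)) (hV : Measurable V)
    (hG : HasGaussianLaw (fun w => (fun i => U i w, V w)) ν)
    (hU0 : ∀ i, ν[U i] = 0) (hV0 : ν[V] = 0) {K : Fin n → Fin n → ℝ} {κ : Fin n → ℝ}
    (hK : ∀ i j, cov[U i, U j; ν] = K i j) (hκ : ∀ i, cov[V, U i; ν] = κ i)
    {v : NNReal} (hv : v ≠ 0) {a : Fin n → ℝ} (ha : ∀ i, ∑ j, a j * K i j + v * a i = κ i)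
    (y : Fin n → ℝ) :
    (ν.withDensity fun w => ∏ i, gaussianPDF (U i w) v (y i)).map V =
      evidence ν U v y •
        gaussianReal (∑ i, a i * y i) (Var[V; ν] - ∑ i, a i * κ i).toNNReal := by
  set N : Measure (Fin n → ℝ) := Measure.pi fun _ => gaussianReal 0 v with hN
  have hfst : (ν.prod N).map Prod.fst = ν := by simp
  have hsnd : (ν.prod N).map Prod.snd = N := by simp
  have hUV : Measurable fun w => (fun i => U i w, V w) := (measurable_pi_iff.2 hU).prodMk hV
  have hG1 : HasGaussianLaw (fun q : W × (Fin n → ℝ) => (fun i => U i q.1, V q.1)) (ν.prod N) := by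
    constructor
    have := Measure.map_map hUV (measurable_fst (α := W) (β := Fin n → ℝ)) (μ := ν.prod N)
    rw [hfst] at this
    rw [show (fun q : W × (Fin n → ℝ) => (fun i => U i q.1, V q.1)) =
      (fun w => (fun i => U i w, V w)) ∘ Prod.fst from rfl, ← this]
    exact hG.isGaussian_map
  have hNe : ∀ i, N.map (fun e : Fin n → ℝ => e i) = gaussianReal 0 v := fun i =>
    (measurePreserving_eval (fun _ : Fin n => gaussianReal 0 v) i).map_eq
  have hNg : HasGaussianLaw (fun e : Fin n → ℝ => e) N := by
    refine iIndepFun.hasGaussianLaw (X := fun i (e : Fin n → ℝ) => e i) (fun i => ?_)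
      (iIndepFun_pi (X := fun _ x => x) fun _ => aemeasurable_id)
    constructor
    rw [hNe]
    infer_instance
  have hG2 : HasGaussianLaw (fun q : W × (Fin n → ℝ) => q.2) (ν.prod N) := by
    constructor
    have := hNg.isGaussian_map
    change IsGaussian ((ν.prod N).map Prod.snd)
    rw [hsnd]
    simpa using this
  have hG3 := IndepFun.hasGaussianLaw hG1 hG2 (indepFun_prod hUV measurable_id)
  have mU : ∀ i, MemLp (U i) 2 ν := fun i => (hG.fst.eval i).memLp_two
  have mV : MemLp V 2 ν := hG.snd.memLp_two
  have mN : ∀ i, MemLp (fun e : Fin n → ℝ => e i) 2 N := fun i => (hNg.eval i).memLp_two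
  have c1 : ∀ {f g : W → ℝ}, Measurable f → Measurable g →
      cov[fun q : W × (Fin n → ℝ) => f q.1, fun q => g q.1; ν.prod N] = cov[f, g; ν] := by
    intro f g hf hg
    have := covariance_map_fun (μ := ν.prod N) (X := f) (Y := g) (Z := Prod.fst)
      hf.aestronglyMeasurable hg.aestronglyMeasurable measurable_fst.aemeasurable
    rw [hfst] at this
    exact this.symm
  have i1 : ∀ {f : W → ℝ}, Measurable f → ∫ q, f q.1 ∂(ν.prod N) = ∫ w, f w ∂ν := by
    intro f hf
    rw [← integral_map (φ := Prod.fst) measurable_fst.aemeasurable hf.aestronglyMeasurable, hfst]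
  have hEE : ∀ i j : Fin n, cov[fun q : W × (Fin n → ℝ) => q.2 i, fun q => q.2 j; ν.prod N] =
      if i = j then (v : ℝ) else 0 := by
    intro i j
    have := covariance_map_fun (μ := ν.prod N) (X := fun e : Fin n → ℝ => e i)
      (Y := fun e : Fin n → ℝ => e j) (Z := Prod.snd)
      (measurable_pi_apply i).aestronglyMeasurable (measurable_pi_apply j).aestronglyMeasurable
      measurable_snd.aemeasurable
    rw [hsnd] at this
    rw [← this]
    split_ifs with hij
    · subst hij
      rw [covariance_self (measurable_pi_apply i).aemeasurable]
      have := variance_map (μ := N) (X := id) (Y := fun e : Fin n → ℝ => e i) aemeasurable_id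
        (measurable_pi_apply i).aemeasurable
      rw [hNe, variance_id_gaussianReal] at this
      exact this.symm
    · exact ((iIndepFun_pi (μ := fun _ : Fin n => gaussianReal 0 v) (X := fun _ x => x)
        fun _ => aemeasurable_id).indepFun hij).covariance_eq_zero (mN i) (mN j)
  obtain ⟨h1, h2⟩ := indepFun_residual (A := fun i (q : W × (Fin n → ℝ)) => U i q.1) (E := fun i q => q.2 i)
    (B := fun q => V q.1) hG3 (K := K) (κ := κ) (v := v) (a := a)
    (fun i j => (c1 (hU i) (hU j)).trans (hK i j)) (fun i => (c1 hV (hU i)).trans (hκ i)) hEE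
    (fun i j => covariance_fst_snd_prod (mU i) (mN j)) (fun i => covariance_fst_snd_prod mV (mN i))
    (fun i => (i1 (hU i)).trans (hU0 i)) ((i1 hV).trans hV0)
    (fun i => by
      rw [← integral_map (φ := Prod.snd) (f := fun e : Fin n → ℝ => e i)
        measurable_snd.aemeasurable (measurable_pi_apply i).aestronglyMeasurable, hsnd,
        ← integral_map (φ := fun e : Fin n → ℝ => e i) (f := fun x => x)
        (measurable_pi_apply i).aemeasurable measurable_id.aestronglyMeasurable, hNe]
      exact integral_id_gaussianReal) ha
  have hvar : Var[fun q : W × (Fin n → ℝ) => V q.1; ν.prod N] = Var[V; ν] := by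
    have hm : AEMeasurable (fun q : W × (Fin n → ℝ) => V q.1) (ν.prod N) :=
      (hV.comp measurable_fst).aemeasurable
    rw [← covariance_self hm, c1 hV hV,
      covariance_self hV.aemeasurable]
  rw [hvar] at h2
  exact map_withDensity_of_indepFun hv hU hV h1 h2 y

end BayesOpt

/-! ### Densities and moments of multivariate Gaussians -/

namespace BayesOpt

section Density

open Matrix WithLp
open scoped MatrixOrder

variable {n : ℕ} {S : Matrix (Fin n) (Fin n) ℝ}

/-- The density of `N(0, S)`. -/
noncomputable def gaussDensity (S : Matrix (Fin n) (Fin n) ℝ) (y : Fin n → ℝ) : ℝ :=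
  (√((2 * Real.pi) ^ n * S.det))⁻¹ * Real.exp (-(y ⬝ᵥ S⁻¹ *ᵥ y) / 2)

lemma gaussDensity_pos (hS : S.PosDef) (y : Fin n → ℝ) : 0 < gaussDensity S y := by
  have := hS.det_pos
  unfold gaussDensity
  positivity

lemma continuous_quadForm (M : Matrix (Fin n) (Fin n) ℝ) :
    Continuous fun y : Fin n → ℝ => y ⬝ᵥ M *ᵥ y := by
  simp only [dotProduct, mulVec]
  fun_prop

lemma continuous_gaussDensity (S : Matrix (Fin n) (Fin n) ℝ) : Continuous (gaussDensity S) := by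
  unfold gaussDensity
  have := continuous_quadForm S⁻¹
  fun_prop

/-- N(0, S) is the image of the standard Gaussian under A = S^{1/2}, which is invertible since (det
A)² = det S > 0; the rest is the linear change of variables. -/
lemma multivariateGaussian_eq_withDensity (hS : S.PosDef) :
    multivariateGaussian 0 S =
      volume.withDensity fun y : EuclideanSpace ℝ (Fin n) =>
        ENNReal.ofReal (gaussDensity S (ofLp y)) := by
  set A : Matrix (Fin n) (Fin n) ℝ := CFC.sqrt S with hA
  have hAA : A * A = S := CFC.sqrt_mul_sqrt_self _ hS.posSemidef.nonneg
  have hAs : Aᵀ = A := by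
    have : IsSelfAdjoint A := (CFC.sqrt_nonneg S).isSelfAdjoint
    simpa [IsSelfAdjoint, star_eq_conjTranspose] using this
  have hdet : A.det * A.det = S.det := by rw [← det_mul, hAA]
  have hA0 : A.det ≠ 0 := fun h => by
    rw [h, zero_mul] at hdet
    exact hS.det_pos.ne hdet
  have hAu : IsUnit A.det := isUnit_iff_ne_zero.2 hA0
  have habs : |A.det| = √S.det := by
    rw [← hdet, Real.sqrt_mul_self_eq_abs]
  -- The factor |det A| is the one that the change of variables y = A x removes.
  have hdens : ∀ x : Fin n → ℝ, ∏ i, gaussianPDF 0 1 (x i) =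
      ENNReal.ofReal |A.det| * ENNReal.ofReal (gaussDensity S (A *ᵥ x)) := by
    intro x
    have hq : (A *ᵥ x) ⬝ᵥ S⁻¹ *ᵥ (A *ᵥ x) = ∑ i, x i ^ 2 := by
      have h1 : S⁻¹ *ᵥ (A *ᵥ x) = A⁻¹ *ᵥ x := by
        rw [← hAA, Matrix.mul_inv_rev, mulVec_mulVec, Matrix.mul_assoc, nonsing_inv_mul _ hAu,
          Matrix.mul_one]
      rw [h1, dotProduct_comm, dotProduct_mulVec, ← mulVec_transpose, hAs, mulVec_mulVec,
        mul_nonsing_inv _ hAu, one_mulVec]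
      simp [dotProduct, sq]
    have hr : ∏ i, gaussianPDFReal 0 1 (x i) = |A.det| * gaussDensity S (A *ᵥ x) := by
      unfold gaussDensity gaussianPDFReal
      rw [hq, Finset.prod_mul_distrib, Finset.prod_const, ← Real.exp_sum, ← mul_assoc, habs,
        Real.sqrt_mul (x := (2 * Real.pi) ^ n) (by positivity), mul_inv, mul_comm (√S.det),
        mul_assoc _ _ (√S.det),
        inv_mul_cancel₀ (Real.sqrt_pos.2 hS.det_pos).ne', mul_one]
      congr 1
      · rw [Finset.card_univ, Fintype.card_fin, inv_pow, NNReal.coe_one, mul_one,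
          show (2 * Real.pi) ^ n = (√(2 * Real.pi) ^ n) ^ 2 by
            rw [← pow_mul, mul_comm n, pow_mul, Real.sq_sqrt Real.two_pi_pos.le],
          Real.sqrt_sq (by positivity)]
      · congr 1
        simp [Finset.sum_div, neg_div]
    rw [← ENNReal.ofReal_mul (abs_nonneg _), ← hr,
      ENNReal.ofReal_prod_of_nonneg fun i _ => gaussianPDFReal_nonneg _ _ _]
    rfl
  refine Measure.ext_of_lintegral _ fun φ hφ => ?_
  have hdm : Measurable fun y : EuclideanSpace ℝ (Fin n) =>
      ENNReal.ofReal (gaussDensity S (ofLp y)) := by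
    refine ENNReal.measurable_ofReal.comp ((continuous_gaussDensity S).measurable.comp ?_)
    fun_prop
  have hgm : Measurable fun y : Fin n → ℝ => ENNReal.ofReal (gaussDensity S y) * φ (toLp 2 y) :=
    (ENNReal.measurable_ofReal.comp (continuous_gaussDensity S).measurable).mul
      (hφ.comp (by fun_prop))
  have hlin : Measurable fun x : Fin n → ℝ => A *ᵥ x :=
    (Continuous.matrix_mulVec continuous_const continuous_id).measurable
  calc ∫⁻ y, φ y ∂multivariateGaussian 0 S
      = ∫⁻ x, φ (toLp 2 (A *ᵥ x)) ∂(Measure.pi fun _ => gaussianReal 0 1) := by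
        rw [multivariateGaussian, ← map_pi_eq_stdGaussian, lintegral_map hφ (by fun_prop),
          lintegral_map (f := fun a => φ (0 + toEuclideanCLM (𝕜 := ℝ) (CFC.sqrt S) a))
            (hφ.comp (by fun_prop)) (by fun_prop)]
        simp [← hA]
    _ = ∫⁻ x, (∏ i, gaussianPDF 0 1 (x i)) * φ (toLp 2 (A *ᵥ x)) := by
        have := lintegral_pi_gaussianReal_add (v := 1) one_ne_zero (fun _ : Fin n => (0 : ℝ))
          (φ := fun x => φ (toLp 2 (A *ᵥ x))) (hφ.comp (Measurable.comp (by fun_prop) hlin))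
        rw [← this]
        refine lintegral_congr fun e => ?_
        congr 3
        exact (zero_add e).symm
    _ = ENNReal.ofReal |A.det| * ∫⁻ x, ENNReal.ofReal (gaussDensity S (A *ᵥ x)) *
          φ (toLp 2 (A *ᵥ x)) := by
        rw [← lintegral_const_mul _ (f := fun x => ENNReal.ofReal (gaussDensity S (A *ᵥ x)) *
          φ (toLp 2 (A *ᵥ x))) (hgm.comp hlin)]
        simp_rw [hdens, mul_assoc]
    _ = ENNReal.ofReal |A.det| * ∫⁻ y, ENNReal.ofReal (gaussDensity S y) * φ (toLp 2 y)
          ∂(volume.map (toLin' A)) := by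
        rw [lintegral_map hgm (show Measurable (toLin' A) from hlin)]
        rfl
    _ = ∫⁻ y, ENNReal.ofReal (gaussDensity S y) * φ (toLp 2 y) := by
        rw [Real.map_matrix_volume_pi_eq_smul_volume_pi hA0, lintegral_smul_measure, smul_eq_mul,
          ← mul_assoc, ← ENNReal.ofReal_mul (abs_nonneg _), ← abs_mul, mul_inv_cancel₀ hA0]
        simp
    _ = ∫⁻ y : EuclideanSpace ℝ (Fin n), ENNReal.ofReal (gaussDensity S (ofLp y)) * φ y :=
        (PiLp.volume_preserving_toLp (Fin n)).lintegral_comp (hdm.mul hφ)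
    _ = _ := (lintegral_withDensity_eq_lintegral_mul _ hdm hφ).symm

lemma multivariateGaussian_conv {S₁ S₂ : Matrix (Fin n) (Fin n) ℝ} (h₁ : S₁.PosSemidef)
    (h₂ : S₂.PosSemidef) :
    ((multivariateGaussian 0 S₁).prod (multivariateGaussian 0 S₂)).map (fun u => u.1 + u.2) =
      multivariateGaussian 0 (S₁ + S₂) := by
  change multivariateGaussian 0 S₁ ∗ multivariateGaussian 0 S₂ = _
  refine Measure.ext_of_charFun (funext fun t => ?_)
  rw [charFun_conv, charFun_multivariateGaussian h₁, charFun_multivariateGaussian h₂,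
    charFun_multivariateGaussian (h₁.add h₂), ← Complex.exp_add]
  congr 1
  rw [add_mulVec, dotProduct_add]
  push_cast
  simp
  ring

/-- E yᵀS⁻¹y = tr(S⁻¹S) = n, whatever S is. Hence the quadratic terms of the log-likelihood ratio
cancel in expectation. -/
lemma integral_quadForm_multivariateGaussian (hS : S.PosDef) :
    Integrable (fun y : EuclideanSpace ℝ (Fin n) => ofLp y ⬝ᵥ S⁻¹ *ᵥ ofLp y)
        (multivariateGaussian 0 S) ∧
      ∫ y : EuclideanSpace ℝ (Fin n), ofLp y ⬝ᵥ S⁻¹ *ᵥ ofLp y ∂multivariateGaussian 0 S = n := by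
  have hL : ∀ i, MemLp (fun y : EuclideanSpace ℝ (Fin n) => y i) 2 (multivariateGaussian 0 S) :=
    fun i => (IsGaussian.memLp_two_id (μ := multivariateGaussian 0 S)).continuousLinearMap_comp
      (EuclideanSpace.proj (𝕜 := ℝ) i)
  have h0 : ∀ i, ∫ y : EuclideanSpace ℝ (Fin n), y i ∂multivariateGaussian 0 S = 0 := fun i => by
    have h := (EuclideanSpace.proj (𝕜 := ℝ) i).integral_comp_id_comm
      (IsGaussian.integrable_id (μ := multivariateGaussian 0 S))
    simpa using h
  have hI : ∀ i j, Integrable (fun y : EuclideanSpace ℝ (Fin n) => y i * y j)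
      (multivariateGaussian 0 S) := fun i j => (hL i).integrable_mul (hL j)
  have hE : ∀ i j, ∫ y : EuclideanSpace ℝ (Fin n), y i * y j ∂multivariateGaussian 0 S = S i j := by
    intro i j
    have h := covariance_eval_multivariateGaussian (μ := 0) hS.posSemidef i j
    rw [covariance_eq_sub (hL i) (hL j), h0, h0] at h
    simpa using h
  have hexp : (fun y : EuclideanSpace ℝ (Fin n) => ofLp y ⬝ᵥ S⁻¹ *ᵥ ofLp y) =
      fun y => ∑ i, ∑ j, S⁻¹ i j * (y i * y j) := by
    funext y
    simp only [dotProduct, mulVec, Finset.mul_sum]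
    exact Finset.sum_congr rfl fun i _ => Finset.sum_congr rfl fun j _ => by ring
  rw [hexp]
  have hi2 : ∀ i, Integrable (fun y : EuclideanSpace ℝ (Fin n) => ∑ j, S⁻¹ i j * (y i * y j))
      (multivariateGaussian 0 S) :=
    fun i => integrable_finsetSum _ fun j _ => (hI i j).const_mul _
  refine ⟨integrable_finsetSum _ fun i _ => hi2 i, ?_⟩
  rw [integral_finsetSum _ fun i _ => hi2 i]
  simp_rw [integral_finsetSum _ fun j (_ : j ∈ Finset.univ) => (hI _ j).const_mul _,
    integral_const_mul, hE]
  have hT : ∀ i j, S i j = S j i := fun i j => by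
    have := congrFun (congrFun hS.isHermitian j) i
    simpa using this
  have : ∑ i, ∑ j, S⁻¹ i j * S i j = (S⁻¹ * S).trace := by
    simp only [trace, diag, mul_apply]
    exact Finset.sum_congr rfl fun i _ => Finset.sum_congr rfl fun j _ => by rw [hT i j]
  rw [this, nonsing_inv_mul _ (isUnit_iff_ne_zero.2 hS.det_pos.ne')]
  simp

end Density

end BayesOpt

/-! ### Mutual information of a Gaussian signal and its noisy observation -/

namespace BayesOpt

section Information

open Matrix WithLp

variable {n : ℕ} {K R : Matrix (Fin n) (Fin n) ℝ}

/-- The joint law of `(f + e, f)` for independent `f ∼ N(0, K)` and `e ∼ N(0, R)`. -/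
noncomputable def signalLaw (K R : Matrix (Fin n) (Fin n) ℝ) :
    Measure (EuclideanSpace ℝ (Fin n) × EuclideanSpace ℝ (Fin n)) :=
  ((multivariateGaussian 0 K).prod (multivariateGaussian 0 R)).map fun u => (u.1 + u.2, u.1)

lemma measurable_signal :
    Measurable fun u : EuclideanSpace ℝ (Fin n) × EuclideanSpace ℝ (Fin n) => (u.1 + u.2, u.1) := by
  fun_prop

instance : IsProbabilityMeasure (signalLaw K R) :=
  Measure.isProbabilityMeasure_map measurable_signal.aemeasurable

lemma fst_signalLaw (hK : K.PosSemidef) (hR : R.PosSemidef) :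
    (signalLaw K R).fst = multivariateGaussian 0 (K + R) := by
  rw [← multivariateGaussian_conv hK hR, signalLaw, Measure.fst,
    Measure.map_map measurable_fst measurable_signal]
  rfl

lemma snd_signalLaw : (signalLaw K R).snd = multivariateGaussian 0 K := by
  rw [signalLaw, Measure.snd, Measure.map_map measurable_snd measurable_signal]
  change Measure.map Prod.fst _ = _
  simp

lemma measurable_gaussDensity_ofLp (S : Matrix (Fin n) (Fin n) ℝ) :
    Measurable fun y : EuclideanSpace ℝ (Fin n) => gaussDensity S (ofLp y) :=
  (continuous_gaussDensity S).measurable.comp (by fun_prop)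

/-- The likelihood ratio of `signalLaw K R` with respect to the product of its marginals. -/
noncomputable def signalRatio (K R : Matrix (Fin n) (Fin n) ℝ)
    (u : EuclideanSpace ℝ (Fin n) × EuclideanSpace ℝ (Fin n)) : ℝ :=
  gaussDensity R (ofLp (u.1 - u.2)) / gaussDensity (K + R) (ofLp u.1)

lemma measurable_signalRatio : Measurable (signalRatio K R) :=
  ((measurable_gaussDensity_ofLp R).comp (measurable_fst.sub measurable_snd)).div
    ((measurable_gaussDensity_ofLp (K + R)).comp measurable_fst)

/-- Given f, the observation has density that of N(f, R), to be divided by its marginal density. The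
law of f stays in the reference measure, so K may be singular. -/
lemma signalLaw_eq_withDensity (hK : K.PosSemidef) (hR : R.PosDef) :
    signalLaw K R =
      ((multivariateGaussian 0 (K + R)).prod (multivariateGaussian 0 K)).withDensity
        fun u => ENNReal.ofReal (signalRatio K R u) := by
  have hS : (K + R).PosDef := PosDef.posSemidef_add hK hR
  refine Measure.ext_of_lintegral _ fun φ hφ => ?_
  have hr : Measurable fun u => ENNReal.ofReal (signalRatio K R u) :=
    ENNReal.measurable_ofReal.comp measurable_signalRatio
  rw [lintegral_withDensity_eq_lintegral_mul _ hr hφ,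
    lintegral_prod_symm _ (hr.mul hφ).aemeasurable, signalLaw, lintegral_map hφ measurable_signal,
    lintegral_prod (fun u => φ (u.1 + u.2, u.1)) (hφ.comp measurable_signal).aemeasurable]
  refine lintegral_congr fun f => ?_
  have h1 : Measurable fun y : EuclideanSpace ℝ (Fin n) => φ (y, f) :=
    hφ.comp measurable_prodMk_right
  have h2 : Measurable fun y : EuclideanSpace ℝ (Fin n) => φ (f + y, f) :=
    h1.comp (measurable_const_add f)
  have h3 : Measurable fun y => ((fun u => ENNReal.ofReal (signalRatio K R u)) * φ) (y, f) :=
    (hr.mul hφ).comp measurable_prodMk_right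
  rw [multivariateGaussian_eq_withDensity hR, multivariateGaussian_eq_withDensity hS,
    lintegral_withDensity_eq_lintegral_mul _ (measurable_gaussDensity_ofLp R).ennreal_ofReal h2,
    lintegral_withDensity_eq_lintegral_mul _ (measurable_gaussDensity_ofLp (K + R)).ennreal_ofReal
      h3]
  refine Eq.trans ?_ (lintegral_add_left_eq_self _ f)
  refine lintegral_congr fun y => ?_
  simp only [Pi.mul_apply, signalRatio]
  rw [← mul_assoc, ← ENNReal.ofReal_mul (gaussDensity_pos hS _).le,
    mul_div_cancel₀ _ (gaussDensity_pos hS _).ne', add_sub_cancel_left]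

lemma log_gaussDensity {S : Matrix (Fin n) (Fin n) ℝ} (hS : S.PosDef) (y : Fin n → ℝ) :
    Real.log (gaussDensity S y) =
      -(n * Real.log (2 * Real.pi) + Real.log S.det) / 2 - (y ⬝ᵥ S⁻¹ *ᵥ y) / 2 := by
  have := hS.det_pos
  have h2 := Real.two_pi_pos
  rw [gaussDensity, Real.log_mul (by positivity) (Real.exp_pos _).ne', Real.log_exp, Real.log_inv,
    Real.log_sqrt (by positivity), Real.log_mul (by positivity) this.ne', Real.log_pow]
  ring

/-- The log-likelihood ratio is the constant in the statement plus half the difference of two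
quadratic forms, and each form has expectation n. -/
lemma mutualInfo_signalLaw (hK : K.PosSemidef) (hR : R.PosDef) :
    mutualInfo (signalLaw K R) =
      ENNReal.ofReal ((Real.log (K + R).det - Real.log R.det) / 2) := by
  have hS : (K + R).PosDef := PosDef.posSemidef_add hK hR
  rw [mutualInfo, fst_signalLaw hK hR.posSemidef, snd_signalLaw]
  set ρ := (multivariateGaussian 0 (K + R)).prod (multivariateGaussian 0 K)
  have hw := signalLaw_eq_withDensity hK hR
  have hac : signalLaw K R ≪ ρ := by
    rw [hw]
    exact withDensity_absolutelyContinuous _ _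
  have hllr : llr (signalLaw K R) ρ =ᵐ[signalLaw K R] fun u =>
      (Real.log (K + R).det - Real.log R.det) / 2 +
        ((ofLp u.1 ⬝ᵥ (K + R)⁻¹ *ᵥ ofLp u.1) / 2 -
          (ofLp (u.1 - u.2) ⬝ᵥ R⁻¹ *ᵥ ofLp (u.1 - u.2)) / 2) := by
    have h := Measure.rnDeriv_withDensity ρ (measurable_signalRatio (K := K) (R := R)).ennreal_ofReal
    rw [← hw] at h
    filter_upwards [hac.ae_le h] with u hu
    rw [llr, hu, signalRatio, ENNReal.toReal_ofReal
      (div_pos (gaussDensity_pos hR _) (gaussDensity_pos hS _)).le,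
      Real.log_div (gaussDensity_pos hR _).ne' (gaussDensity_pos hS _).ne', log_gaussDensity hR,
      log_gaussDensity hS]
    ring
  have q1 := integral_quadForm_multivariateGaussian hS
  have q2 := integral_quadForm_multivariateGaussian hR
  have mq : ∀ M : Matrix (Fin n) (Fin n) ℝ,
      Measurable fun y : EuclideanSpace ℝ (Fin n) => ofLp y ⬝ᵥ M *ᵥ ofLp y :=
    fun M => (continuous_quadForm M).measurable.comp (by fun_prop)
  have p1 : Integrable (fun u : EuclideanSpace ℝ (Fin n) × EuclideanSpace ℝ (Fin n) =>
      ofLp u.1 ⬝ᵥ (K + R)⁻¹ *ᵥ ofLp u.1) (signalLaw K R) ∧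
      ∫ u, ofLp u.1 ⬝ᵥ (K + R)⁻¹ *ᵥ ofLp u.1 ∂signalLaw K R = n := by
    rw [← fst_signalLaw hK hR.posSemidef, Measure.fst] at q1
    rw [integrable_map_measure (mq _).aestronglyMeasurable measurable_fst.aemeasurable,
      integral_map measurable_fst.aemeasurable (mq _).aestronglyMeasurable] at q1
    exact q1
  have msub : Measurable fun u : EuclideanSpace ℝ (Fin n) × EuclideanSpace ℝ (Fin n) =>
      u.1 - u.2 := by fun_prop
  have p2 : Integrable (fun u : EuclideanSpace ℝ (Fin n) × EuclideanSpace ℝ (Fin n) =>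
      ofLp (u.1 - u.2) ⬝ᵥ R⁻¹ *ᵥ ofLp (u.1 - u.2)) (signalLaw K R) ∧
      ∫ u, ofLp (u.1 - u.2) ⬝ᵥ R⁻¹ *ᵥ ofLp (u.1 - u.2) ∂signalLaw K R = n := by
    -- Observation minus signal is the noise.
    have hsub : (signalLaw K R).map (fun u => u.1 - u.2) = multivariateGaussian 0 R := by
      rw [signalLaw, Measure.map_map msub measurable_signal]
      have : ((fun u : EuclideanSpace ℝ (Fin n) × EuclideanSpace ℝ (Fin n) => u.1 - u.2) ∘
        fun u => (u.1 + u.2, u.1)) = Prod.snd := by funext u; simp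
      rw [this]
      simp
    rw [← hsub, integrable_map_measure (mq _).aestronglyMeasurable
        msub.aemeasurable,
      integral_map msub.aemeasurable (mq _).aestronglyMeasurable]
      at q2
    exact q2
  have hsub : Integrable (fun u : EuclideanSpace ℝ (Fin n) × EuclideanSpace ℝ (Fin n) =>
      (ofLp u.1 ⬝ᵥ (K + R)⁻¹ *ᵥ ofLp u.1) / 2 -
        (ofLp (u.1 - u.2) ⬝ᵥ R⁻¹ *ᵥ ofLp (u.1 - u.2)) / 2) (signalLaw K R) :=
    (p1.1.div_const 2).sub (p2.1.div_const 2)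
  rw [klDiv_of_ac_of_integrable hac
    ((integrable_congr hllr).2 ((integrable_const _).add hsub)),
    integral_congr_ae hllr, integral_add (integrable_const _) hsub,
    integral_sub (p1.1.div_const 2) (p2.1.div_const 2), integral_const, integral_div, integral_div, p1.2,
    p2.2]
  simp [ρ]

end Information

/-! ### Posterior variance and the determinant of the regularized kernel matrix -/

section Kernel

open Matrix

variable {S : Type*} {k : S → S → ℝ} {σ : ℝ} {X : Set S}

lemma posDef_sq_smul_one (hσ : 0 < σ) (n : ℕ) :
    (σ ^ 2 • (1 : Matrix (Fin n) (Fin n) ℝ)).PosDef :=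
  PosDef.one.smul (by positivity)

lemma posDef_regularized (hk : IsPSDKernelOn k X) (hσ : 0 < σ) {n : ℕ} {p : Fin n → S}
    (hp : ∀ i, p i ∈ X) :
    (kernelMatrix k p + σ ^ 2 • (1 : Matrix (Fin n) (Fin n) ℝ)).PosDef :=
  PosDef.posSemidef_add (hk n p hp) (posDef_sq_smul_one hσ n)

/-- The coefficients of the posterior mean at `x`. -/
noncomputable def postCoeff (k : S → S → ℝ) (σ : ℝ) {n : ℕ} (p : Fin n → S) (x : S) : Fin n → ℝ :=
  regInv k σ p *ᵥ kernelVec k p x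

/-- These are the normal equations that `indepFun_residual` asks for, with noise variance σ². -/
lemma postCoeff_normal_eq (hk : IsPSDKernelOn k X) (hσ : 0 < σ) {n : ℕ} {p : Fin n → S}
    (hp : ∀ i, p i ∈ X) (x : S) (i : Fin n) :
    ∑ j, postCoeff k σ p x j * k (p i) (p j) + σ ^ 2 * postCoeff k σ p x i = k x (p i) := by
  have h := mul_nonsing_inv _ (isUnit_iff_ne_zero.2 (posDef_regularized hk hσ hp).det_pos.ne')
  have h2 := congrFun (congrArg (· *ᵥ kernelVec k p x) h) i
  simp only [one_mulVec, ← mulVec_mulVec] at h2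
  change _ = kernelVec k p x i
  rw [← h2, add_mulVec, Pi.add_apply, smul_mulVec, one_mulVec]
  simp only [postCoeff, regInv, Pi.smul_apply, smul_eq_mul]
  congr 1
  simp only [mulVec, dotProduct, kernelMatrix, of_apply]
  exact Finset.sum_congr rfl fun j _ => mul_comm _ _

lemma postMean_eq (hk : IsPSDKernelOn k X) (hσ : 0 < σ) {n : ℕ} {p : Fin n → S}
    (hp : ∀ i, p i ∈ X) (y : Fin n → ℝ) (x : S) :
    postMean k σ p y x = ∑ i, postCoeff k σ p x i * y i := by
  have hT : (regInv k σ p)ᵀ = regInv k σ p := by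
    have := (posDef_regularized hk hσ hp).inv.isHermitian
    rwa [IsHermitian, conjTranspose_eq_transpose_of_trivial] at this
  rw [postMean, dotProduct_mulVec, ← mulVec_transpose, hT]
  rfl

lemma postVar_eq {n : ℕ} (p : Fin n → S) (x : S) :
    postVar k σ p x = k x x - ∑ i, postCoeff k σ p x i * k x (p i) := by
  rw [postVar, dotProduct_comm]
  rfl

lemma postVar_le (hk : IsPSDKernelOn k X) (hσ : 0 < σ) {n : ℕ} {p : Fin n → S}
    (hp : ∀ i, p i ∈ X) (x : S) : postVar k σ p x ≤ k x x := by
  have := (posDef_regularized hk hσ hp).inv.posSemidef.dotProduct_mulVec_nonneg (kernelVec k p x)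
  rw [star_trivial] at this
  exact sub_le_self _ this

/-- Evaluating the kernel form of the n + 1 points at (-a, 1), with a the posterior coefficients,
gives the posterior variance minus σ² ∑ a_i², and this is nonnegative. -/
lemma postVar_nonneg (hk : IsPSDKernelOn k X) (hσ : 0 < σ) {n : ℕ} {p : Fin n → S}
    (hp : ∀ i, p i ∈ X) {x : S} (hx : x ∈ X) : 0 ≤ postVar k σ p x := by
  set a := postCoeff k σ p x with ha
  have hq : ∀ i, (Fin.snoc (α := fun _ => S) p x : Fin (n + 1) → S) i ∈ X := by
    intro i
    refine Fin.lastCases ?_ (fun j => ?_) i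
    · simpa using hx
    · simpa using hp j
  have h := (hk _ _ hq).dotProduct_mulVec_nonneg (Fin.snoc (α := fun _ => ℝ) (-a) 1)
  have hsymm : ∀ i, k (p i) x = k x (p i) := fun i => by
    have := congrFun (congrFun (hk _ _ hq).isHermitian (Fin.last n)) i.castSucc
    simpa [kernelMatrix] using this
  have hn := postCoeff_normal_eq hk hσ hp x
  rw [postVar_eq, ← ha]
  simp only [star_trivial, dotProduct, mulVec, kernelMatrix, of_apply, Fin.sum_univ_castSucc,
    Fin.snoc_castSucc, Fin.snoc_last, Pi.neg_apply, mul_one, one_mul, hsymm] at h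
  have e1 : ∀ i, ∑ j, k (p i) (p j) * -a j + k x (p i) = σ ^ 2 * a i := fun i => by
    rw [← hn i, ← ha]
    simp only [mul_neg, Finset.sum_neg_distrib]
    rw [Finset.sum_congr rfl fun j _ => mul_comm (k (p i) (p j)) (a j)]
    ring
  have e2 : ∑ j, k x (p j) * -a j = -∑ j, a j * k x (p j) := by
    rw [← Finset.sum_neg_distrib]
    exact Finset.sum_congr rfl fun j _ => by ring
  simp only [e1, e2] at h
  have e3 : ∑ i, -a i * (σ ^ 2 * a i) ≤ 0 :=
    Finset.sum_nonpos fun i _ => by nlinarith [mul_nonneg (sq_nonneg σ) (sq_nonneg (a i))]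
  linarith

/-- Adding a point multiplies the determinant by a Schur complement, which is σ² plus the posterior
variance at that point. -/
lemma det_regularized (hk : IsPSDKernelOn k X) (hσ : 0 < σ) {x : ℕ → S} (hx : ∀ i, x i ∈ X) (T : ℕ) :
    (kernelMatrix k (fun i : Fin T => x i) + σ ^ 2 • (1 : Matrix (Fin T) (Fin T) ℝ)).det =
      ∏ t ∈ Finset.range T, (σ ^ 2 + postVar k σ (fun i : Fin t => x i) (x t)) := by
  induction T with
  | zero => simp
  | succ T ih =>
    have hpd := posDef_regularized hk hσ (p := fun i : Fin T => x i) fun i => hx i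
    have hu : IsUnit
        (kernelMatrix k (fun i : Fin T => x i) + σ ^ 2 • (1 : Matrix (Fin T) (Fin T) ℝ)) := hpd.isUnit
    let := hu.invertible
    have hsymm : ∀ i : Fin T, k (x i) (x T) = k (x T) (x i) := fun i => by
      have := congrFun (congrFun (hk 2 ![x i, x T] (fun j => by
        fin_cases j <;> simp [hx])).isHermitian 1) 0
      simpa [kernelMatrix] using this
    rw [← det_submatrix_equiv_self finSumFinEquiv (kernelMatrix k (fun i : Fin (T + 1) => x i) +
      σ ^ 2 • (1 : Matrix (Fin (T + 1)) (Fin (T + 1)) ℝ)), Finset.prod_range_succ, ← ih]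
    have hblock : (kernelMatrix k (fun i : Fin (T + 1) => x i) +
        σ ^ 2 • (1 : Matrix (Fin (T + 1)) (Fin (T + 1)) ℝ)).submatrix finSumFinEquiv finSumFinEquiv =
        fromBlocks (kernelMatrix k (fun i : Fin T => x i) + σ ^ 2 • (1 : Matrix (Fin T) (Fin T) ℝ))
          (of fun i (_ : Fin 1) => k (x T) (x i)) (of fun (_ : Fin 1) j => k (x T) (x j))
          (of fun (_ : Fin 1) (_ : Fin 1) => σ ^ 2 + k (x T) (x T)) := by
      ext i j
      rcases i with i | i <;> rcases j with j | j
      · simp [kernelMatrix, one_apply, Fin.ext_iff]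
      · have : (Fin.castAdd 1 i) ≠ Fin.natAdd T j := fun h => by
          have := congrArg Fin.val h; simp at this; omega
        simp [kernelMatrix, one_apply, hsymm, this]
      · have : (Fin.natAdd T i) ≠ Fin.castAdd 1 j := fun h => by
          have := congrArg Fin.val h; simp at this; omega
        simp [kernelMatrix, one_apply, this]
      · simp [kernelMatrix, one_apply, Subsingleton.elim i j, add_comm]
    rw [hblock, det_fromBlocks₁₁, det_fin_one]
    congr 1
    rw [invOf_eq_nonsing_inv, postVar, Matrix.mul_assoc]
    simp only [Matrix.sub_apply, mul_apply, of_apply, dotProduct, mulVec, regInv, kernelVec]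
    ring

end Kernel

end BayesOpt

/-! ### Information gain and the sum of posterior variances -/

namespace BayesOpt

section InformationGain

open Matrix

variable {S : Type*} {k : S → S → ℝ} {σ : ℝ} {X : Set S}

/-- The information gain of `T` observations is `½ ∑ log (1 + σ⁻² σ_{t-1}²(x_t))`. -/
lemma mutualInfo_obsLaw (hk : IsPSDKernelOn k X) (hσ : 0 < σ) {x : ℕ → S} (hx : ∀ i, x i ∈ X)
    (T : ℕ) :
    mutualInfo (obsLaw k σ fun i : Fin T => x i) =
      ENNReal.ofReal ((∑ t ∈ Finset.range T,
        Real.log (1 + postVar k σ (fun i : Fin t => x i) (x t) * σ⁻¹ ^ 2)) / 2) := by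
  have h := mutualInfo_signalLaw (hk T (fun i : Fin T => x i) fun i => hx i)
    (posDef_sq_smul_one hσ T)
  have hv : ∀ t, 0 ≤ postVar k σ (fun i : Fin t => x i) (x t) := fun t =>
    postVar_nonneg hk hσ (fun i => hx i) (hx t)
  have hs : 0 < σ ^ 2 := by positivity
  change mutualInfo (signalLaw _ _) = _
  rw [h, det_regularized hk hσ hx, Real.log_prod fun t _ => (add_pos_of_pos_of_nonneg hs (hv t)).ne']
  congr 2
  have hd : Real.log (σ ^ 2 • (1 : Matrix (Fin T) (Fin T) ℝ)).det =
      ∑ t ∈ Finset.range T, Real.log (σ ^ 2) := by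
    rw [det_smul, det_one, mul_one, Real.log_pow]
    simp
  rw [hd, ← Finset.sum_sub_distrib]
  refine Finset.sum_congr rfl fun t _ => ?_
  rw [← Real.log_div (add_pos_of_pos_of_nonneg hs (hv t)).ne' hs.ne']
  congr 1
  field_simp

/-- Posterior variances are at most 1, which bounds every term of the information gain. Without
finiteness, `MIG` would be the default value 0 and the regret bound would be meaningless. -/
lemma eMIG_ne_top (hk : IsPSDKernelOn k X) (hk1 : ∀ x ∈ X, k x x ≤ 1) (hσ : 0 < σ)
    (hX : X.Nonempty) (T : ℕ) : eMIG k σ X T ≠ ∞ := by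
  obtain ⟨x₀, hx₀⟩ := hX
  refine ne_top_of_le_ne_top (ENNReal.ofReal_ne_top (r := T * Real.log (1 + σ⁻¹ ^ 2) / 2))
    (iSup₂_le fun p hp => ?_)
  set x : ℕ → S := fun i => if h : i < T then p ⟨i, h⟩ else x₀
  have hx : ∀ i, x i ∈ X := fun i => by
    by_cases h : i < T
    · simpa [x, h] using hp _
    · simpa [x, h] using hx₀
  have hxp : (fun i : Fin T => x i) = p := by
    funext i
    simp [x]
  rw [← hxp, mutualInfo_obsLaw hk hσ hx]
  refine ENNReal.ofReal_le_ofReal (div_le_div_of_nonneg_right ?_ zero_le_two)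
  have h1 : ∀ t ∈ Finset.range T, Real.log (1 + postVar k σ (fun i : Fin t => x i) (x t) * σ⁻¹ ^ 2) ≤
      Real.log (1 + σ⁻¹ ^ 2) := fun t _ => by
    have h0 : 0 ≤ postVar k σ (fun i : Fin t => x i) (x t) :=
      postVar_nonneg hk hσ (fun i => hx i) (hx t)
    have h1 : postVar k σ (fun i : Fin t => x i) (x t) ≤ 1 :=
      (postVar_le hk hσ (fun i => hx i) _).trans (hk1 _ (hx t))
    refine Real.log_le_log (by positivity) ?_
    have : 0 ≤ σ⁻¹ ^ 2 := by positivity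
    nlinarith
  simpa using Finset.sum_le_sum h1

/-- By concavity of the logarithm, a variance V in [0, 1] is at most log(1 + Vσ⁻²) / log(1 + σ⁻²);
the 2 in C₁ undoes the ½ of the information gain. The bound holds for every choice of points, so
also along each realization of an adaptive run. -/
lemma sum_postVar_le (hk : IsPSDKernelOn k X) (hk1 : ∀ x ∈ X, k x x ≤ 1) (hσ : 0 < σ)
    {x : ℕ → S} (hx : ∀ i, x i ∈ X) (T : ℕ) :
    ∑ t ∈ Finset.range T, postVar k σ (fun i : Fin t => x i) (x t) ≤
      2 / Real.log (1 + σ⁻¹ ^ 2) * MIG k σ X T := by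
  have hc : 0 < σ⁻¹ ^ 2 := by positivity
  have hl : 0 < Real.log (1 + σ⁻¹ ^ 2) := Real.log_pos (by linarith)
  have h0 : ∀ t, 0 ≤ postVar k σ (fun i : Fin t => x i) (x t) := fun t =>
    postVar_nonneg hk hσ (fun i => hx i) (hx t)
  have h1 : ∀ t, postVar k σ (fun i : Fin t => x i) (x t) ≤ 1 := fun t =>
    (postVar_le hk hσ (fun i => hx i) _).trans (hk1 _ (hx t))
  -- Bernoulli's inequality (1 + c)^V ≤ 1 + cV for 0 ≤ V ≤ 1, in logarithmic form.
  have hlog : ∀ t, postVar k σ (fun i : Fin t => x i) (x t) * Real.log (1 + σ⁻¹ ^ 2) ≤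
      Real.log (1 + postVar k σ (fun i : Fin t => x i) (x t) * σ⁻¹ ^ 2) := fun t => by
    rw [← Real.log_rpow (by linarith)]
    exact Real.log_le_log (by positivity)
      (rpow_one_add_le_one_add_mul_self (by linarith) (h0 t) (h1 t))
  have hI : (∑ t ∈ Finset.range T,
      Real.log (1 + postVar k σ (fun i : Fin t => x i) (x t) * σ⁻¹ ^ 2)) / 2 ≤ MIG k σ X T := by
    refine (ENNReal.ofReal_le_iff_le_toReal (eMIG_ne_top hk hk1 hσ ⟨x 0, hx 0⟩ T)).1 ?_
    rw [← mutualInfo_obsLaw hk hσ hx]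
    exact le_iSup₂_of_le (fun i : Fin T => x i) (fun i => hx i) le_rfl
  rw [div_mul_eq_mul_div, le_div_iff₀ hl, Finset.sum_mul]
  refine (Finset.sum_le_sum fun t _ => hlog t).trans ?_
  linarith

end InformationGain

end BayesOpt

/-! ### Exponential and Gaussian tails -/

namespace BayesOpt

section Tails

lemma expMeasure_Ioi {r : ℝ} (hr : 0 < r) (x : ℝ) :
    expMeasure r (Set.Ioi x) = ENNReal.ofReal (if 0 ≤ x then Real.exp (-(r * x)) else 1) := by
  have := isProbabilityMeasure_expMeasure hr
  have h := cdf_expMeasure_eq hr x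
  rw [cdf_eq_real] at h
  have h2 : (expMeasure r).real (Set.Ioi x) = 1 - (expMeasure r).real (Set.Iic x) := by
    rw [← Set.compl_Iic, probReal_compl_eq_one_sub measurableSet_Iic]
  rw [← ofReal_measureReal, h2, h]
  split_ifs <;> simp

lemma ae_expMeasure_nonneg {r : ℝ} (hr : 0 < r) : ∀ᵐ z ∂expMeasure r, 0 ≤ z := by
  have := isProbabilityMeasure_expMeasure hr
  have h := cdf_expMeasure_eq hr
  have h0 : expMeasure r (Set.Iio 0) = 0 := by
    rw [expMeasure, gammaMeasure, withDensity_apply _ measurableSet_Iio]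
    refine (setLIntegral_congr_fun measurableSet_Iio fun x hx => gammaPDF_of_neg hx).trans ?_
    simp
  rw [ae_iff]
  simpa [Set.Iio_def] using h0

lemma lintegral_expMeasure_half : ∫⁻ z, ENNReal.ofReal z ∂expMeasure (1 / 2) = 2 := by
  have hr : (0 : ℝ) < 1 / 2 := by norm_num
  rw [lintegral_eq_lintegral_meas_lt (f := fun z => z) _ (ae_expMeasure_nonneg hr) aemeasurable_id]
  have h1 : ∀ t ∈ Set.Ioi (0 : ℝ), expMeasure (1 / 2) {a | t < a} =
      ENNReal.ofReal (Real.exp (-(1 / 2) * t)) := by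
    intro t ht
    have := expMeasure_Ioi hr t
    rw [if_pos (le_of_lt ht)] at this
    simpa [Set.Ioi_def] using this
  rw [setLIntegral_congr_fun measurableSet_Ioi h1, ← ofReal_integral_eq_lintegral_ofReal
    (exp_neg_integrableOn_Ioi 0 hr) (Filter.Eventually.of_forall fun t => (Real.exp_pos _).le),
    integral_exp_mul_Ioi (by norm_num)]
  norm_num

instance (s : ℝ) : IsProbabilityMeasure (shiftedExp s (1 / 2)) := by
  have := isProbabilityMeasure_expMeasure (r := 1 / 2) (by norm_num)
  exact Measure.isProbabilityMeasure_map (measurable_const_add s).aemeasurable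

lemma integrable_id_expMeasure : Integrable (fun z => z) (expMeasure (1 / 2)) := by
  refine ⟨aestronglyMeasurable_id, ?_⟩
  rw [hasFiniteIntegral_iff_ofReal (ae_expMeasure_nonneg (by norm_num)), lintegral_expMeasure_half]
  exact ENNReal.ofNat_lt_top

lemma integrable_id_shiftedExp (s : ℝ) : Integrable (fun z => z) (shiftedExp s (1 / 2)) := by
  have := isProbabilityMeasure_expMeasure (r := 1 / 2) (by norm_num)
  rw [shiftedExp, integrable_map_measure (f := fun s' => s + s') (g := fun z => z)
    aestronglyMeasurable_id (measurable_const_add s).aemeasurable]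
  exact (integrable_const s).add integrable_id_expMeasure

/-- The positive part appears because √ζ is 0 for negative ζ; the 2 is the mean of Exp(1/2). -/
lemma integral_posPart_shiftedExp_le (s : ℝ) :
    ∫ z, max z 0 ∂shiftedExp s (1 / 2) ≤ max s 0 + 2 := by
  have := isProbabilityMeasure_expMeasure (r := 1 / 2) (by norm_num)
  have h0 := ae_expMeasure_nonneg (r := 1 / 2) (by norm_num)
  have h2 : ∫ z, z ∂expMeasure (1 / 2) = 2 := by
    rw [integral_eq_lintegral_of_nonneg_ae h0 aestronglyMeasurable_id, lintegral_expMeasure_half]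
    rfl
  have hm : Measurable fun z : ℝ => max z 0 := by fun_prop
  rw [shiftedExp, integral_map (measurable_const_add s).aemeasurable hm.aestronglyMeasurable]
  calc ∫ z, max (s + z) 0 ∂expMeasure (1 / 2) ≤ ∫ z, (max s 0 + z) ∂expMeasure (1 / 2) := by
        refine integral_mono_ae ?_ ((integrable_const _).add integrable_id_expMeasure) ?_
        · exact ((integrable_const s).add integrable_id_expMeasure).pos_part
        · filter_upwards [h0] with z hz
          exact max_le (add_le_add_left (le_max_left _ _) _) (add_nonneg (le_max_right _ _) hz)
    _ = _ := by
        rw [integral_add (integrable_const _) integrable_id_expMeasure, h2, integral_const,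
          probReal_univ, one_smul]

/-- For u ≥ 0 the density at m + u is at most exp(-m²/2) times the density at u, and the half-line
has mass at most 1/2. This 1/2 is the source of the term -2 log 2 in the shift. -/
lemma gaussianReal_Ioi_le {m : ℝ} (hm : 0 ≤ m) :
    gaussianReal 0 1 (Set.Ioi m) ≤ ENNReal.ofReal (Real.exp (-m ^ 2 / 2) / 2) := by
  have hhalf : gaussianReal 0 1 (Set.Ioi 0) ≤ ENNReal.ofReal (1 / 2) := by
    have hneg : gaussianReal 0 1 (Set.Iio 0) = gaussianReal 0 1 (Set.Ioi 0) := by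
      conv_lhs => rw [← neg_zero, ← gaussianReal_map_neg, Measure.map_apply measurable_neg measurableSet_Iio]
      simp
    have h1 : gaussianReal 0 1 (Set.Iio 0) + gaussianReal 0 1 (Set.Ioi 0) ≤ 1 := by
      rw [← measure_union (Set.disjoint_left.2 fun x (h : x ∈ Set.Iio 0) (h' : x ∈ Set.Ioi 0) => lt_asymm h h')
        measurableSet_Ioi]
      exact prob_le_one
    rw [hneg, ← two_mul] at h1
    rw [ENNReal.ofReal_div_of_pos two_pos, ENNReal.le_div_iff_mul_le (by simp) (by simp), mul_comm]
    simpa using h1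
  have hv : (1 : NNReal) ≠ 0 := one_ne_zero
  rw [gaussianReal_apply _ hv] at hhalf ⊢
  have hshift : ∫⁻ x in Set.Ioi m, gaussianPDF 0 1 x = ∫⁻ u in Set.Ioi 0, gaussianPDF 0 1 (m + u) := by
    rw [← lintegral_indicator measurableSet_Ioi, ← lintegral_indicator measurableSet_Ioi,
      ← lintegral_add_left_eq_self _ m]
    refine lintegral_congr fun u => ?_
    simp [Set.indicator_apply]
  rw [hshift]
  have hle : ∀ u ∈ Set.Ioi (0 : ℝ), gaussianPDF 0 1 (m + u) ≤
      ENNReal.ofReal (Real.exp (-m ^ 2 / 2)) * gaussianPDF 0 1 u := by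
    intro u hu
    rw [gaussianPDF, gaussianPDF, ← ENNReal.ofReal_mul (Real.exp_pos _).le]
    refine ENNReal.ofReal_le_ofReal ?_
    unfold gaussianPDFReal
    rw [mul_left_comm, ← Real.exp_add]
    refine mul_le_mul_of_nonneg_left (Real.exp_le_exp.2 ?_) (by positivity)
    have : 0 ≤ m * u := mul_nonneg hm (le_of_lt hu)
    simp only [NNReal.coe_one, mul_one, sub_zero]
    nlinarith
  refine (setLIntegral_mono' measurableSet_Ioi hle).trans ?_
  rw [lintegral_const_mul _ (measurable_gaussianPDF _ _), div_eq_mul_one_div (Real.exp _),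
    ENNReal.ofReal_mul (Real.exp_pos _).le]
  exact mul_le_mul_right hhalf _

lemma gaussianReal_Ioi_add_le (μ : ℝ) (v : NNReal) {m : ℝ} (hm : 0 ≤ m) :
    gaussianReal μ v (Set.Ioi (μ + m * √v)) ≤ ENNReal.ofReal (Real.exp (-m ^ 2 / 2) / 2) := by
  refine le_trans ?_ (gaussianReal_Ioi_le hm)
  have h : gaussianReal μ v = (gaussianReal 0 1).map fun u => μ + √v * u := by
    have h1 := gaussianReal_map_const_mul (μ := 0) (v := 1) (√(v : ℝ))
    have h2 := gaussianReal_map_const_add (μ := √(v : ℝ) * 0)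
      (v := (.mk (√(v : ℝ) ^ 2) (sq_nonneg _) : NNReal) * 1) μ
    rw [← h1, Measure.map_map (measurable_const_add μ) (measurable_const_mul _)] at h2
    refine Eq.trans ?_ h2.symm
    congr 1
    · simp
    · ext
      simp
  rw [h, Measure.map_apply (by fun_prop) measurableSet_Ioi]
  refine measure_mono fun u hu => ?_
  simp only [Set.mem_preimage, Set.mem_Ioi, add_lt_add_iff_left] at hu ⊢
  rw [mul_comm] at hu
  exact lt_of_mul_lt_mul_left hu (Real.sqrt_nonneg _)

end Tails

/-! ### Randomized confidence bounds dominate maxima of Gaussians -/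

section Dominance

variable {Ω ι : Type*} [MeasurableSpace Ω] {P : Measure Ω} [IsProbabilityMeasure P] [Fintype ι]
  [Nonempty ι] {V : ι → Ω → ℝ} {μ : ι → ℝ} {v : ι → NNReal}

/-- The largest upper confidence bound with width factor `m`. -/
noncomputable def maxBound (μ : ι → ℝ) (v : ι → NNReal) (m : ℝ) : ℝ :=
  Finset.univ.sup' Finset.univ_nonempty fun j => μ j + m * √(v j)

lemma continuous_maxBound : Continuous (maxBound μ v) :=
  Continuous.finset_sup'_apply _ fun j _ => by fun_prop

lemma monotone_maxBound : Monotone (maxBound μ v) := fun _ _ h =>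
  Finset.sup'_mono_fun fun _ _ => add_le_add_right (mul_le_mul_of_nonneg_right h (Real.sqrt_nonneg _)) _

lemma measure_maxBound_lt_le (hV : ∀ j, HasLaw (V j) (gaussianReal (μ j) (v j)) P) {m : ℝ}
    (hm : 0 ≤ m) :
    P {ω | maxBound μ v m < Finset.univ.sup' Finset.univ_nonempty fun j => V j ω} ≤
      ENNReal.ofReal (Fintype.card ι / 2 * Real.exp (-m ^ 2 / 2)) := by
  have hsub : {ω | maxBound μ v m < Finset.univ.sup' Finset.univ_nonempty fun j => V j ω} ⊆
      ⋃ j, {ω | μ j + m * √(v j) < V j ω} := by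
    intro ω hω
    obtain ⟨j, -, hj⟩ := (Finset.lt_sup'_iff _).1 (show maxBound μ v m < _ from hω)
    exact Set.mem_iUnion.2 ⟨j, (Finset.le_sup' (fun j => μ j + m * √(v j))
      (Finset.mem_univ j)).trans_lt hj⟩
  refine (measure_mono hsub).trans ((measure_iUnion_fintype_le _ _).trans ?_)
  have h1 : ∀ j, P {ω | μ j + m * √(v j) < V j ω} ≤ ENNReal.ofReal (Real.exp (-m ^ 2 / 2) / 2) :=
    fun j => by
      rw [(hV j).measure_eq (p := fun x => μ j + m * √(v j) < x) measurableSet_Ioi]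
      exact gaussianReal_Ioi_add_le _ _ hm
  refine (Finset.sum_le_sum fun j _ => h1 j).trans ?_
  rw [Finset.sum_const, Finset.card_univ, nsmul_eq_mul, ← ENNReal.ofReal_natCast,
    ← ENNReal.ofReal_mul (Nat.cast_nonneg _)]
  refine ENNReal.ofReal_le_ofReal (le_of_eq ?_)
  ring

/-- Let m be the largest width factor whose bound stays below c, and N the number of variables. The
union bound gives at most (N/2) exp(-m²/2) on the left. The right side is at least the probability
that the shifted exponential exceeds m², which is exp((s - m²)/2) or 1; the condition on s makes
this large enough. -/
lemma measure_lt_maxBound_le {s : ℝ} (hs : 2 * Real.log (Fintype.card ι / 2) ≤ s)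
    (hV : ∀ j, HasLaw (V j) (gaussianReal (μ j) (v j)) P) (c : ℝ) (hc : maxBound μ v 0 ≤ c) :
    P {ω | c < Finset.univ.sup' Finset.univ_nonempty fun j => V j ω} ≤
      shiftedExp s (1 / 2) {z | c < maxBound μ v √z} := by
  have hN : (0 : ℝ) < Fintype.card ι / 2 := by
    have : (0 : ℝ) < Fintype.card ι := by exact_mod_cast Fintype.card_pos
    positivity
  have hanti : ∀ m, maxBound μ v m ≤ c →
      P {ω | c < Finset.univ.sup' Finset.univ_nonempty fun j => V j ω} ≤
        P {ω | maxBound μ v m < Finset.univ.sup' Finset.univ_nonempty fun j => V j ω} :=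
    fun m hm => measure_mono fun ω hω => hm.trans_lt hω
  set A : Set ℝ := {m | 0 ≤ m ∧ maxBound μ v m ≤ c}
  have hA0 : (0 : ℝ) ∈ A := ⟨le_rfl, hc⟩
  by_cases hb : BddAbove A
  · have hcl : IsClosed A := isClosed_Ici.inter (isClosed_Iic.preimage continuous_maxBound)
    obtain ⟨hm0, hmc⟩ : sSup A ∈ A := hcl.csSup_mem ⟨0, hA0⟩ hb
    set m := sSup A
    -- A factor √z > m violates the maximality of m unless its bound exceeds c.
    have hsub : Set.Ioi (m ^ 2) ⊆ {z | c < maxBound μ v √z} := by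
      intro z hz
      have h1 : m < √z := (Real.lt_sqrt hm0).2 hz
      by_contra hcon
      exact absurd (le_csSup hb ⟨Real.sqrt_nonneg z, not_lt.1 hcon⟩) (not_le.2 h1)
    refine le_trans ?_ (measure_mono hsub)
    rw [shiftedExp, Measure.map_apply (measurable_const_add s) measurableSet_Ioi]
    have hpre : (fun z => s + z) ⁻¹' Set.Ioi (m ^ 2) = Set.Ioi (m ^ 2 - s) := by
      ext z
      simp [sub_lt_iff_lt_add']
    rw [hpre, expMeasure_Ioi (by norm_num)]
    split_ifs with hms
    · refine (hanti m hmc).trans ((measure_maxBound_lt_le hV hm0).trans ?_)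
      refine ENNReal.ofReal_le_ofReal ?_
      rw [← Real.exp_log hN, ← Real.exp_add]
      exact Real.exp_le_exp.2 (by linarith)
    · simpa using prob_le_one
  -- No largest factor exists only if all variances vanish. The tail estimate then holds for
  -- arbitrarily large factors, so the left side is 0.
  · have h0 : Filter.Tendsto
        (fun m : ℝ => ENNReal.ofReal (Fintype.card ι / 2 * Real.exp (-m ^ 2 / 2)))
        Filter.atTop (nhds 0) := by
      rw [← ENNReal.ofReal_zero, ← mul_zero (Fintype.card ι / 2 : ℝ)]
      refine ENNReal.tendsto_ofReal (Filter.Tendsto.const_mul _ (Real.tendsto_exp_atBot.comp ?_))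
      have := (Filter.tendsto_pow_atTop (α := ℝ) two_ne_zero).atTop_div_const two_pos
      refine (Filter.tendsto_neg_atTop_atBot.comp this).congr fun m => ?_
      simp [neg_div]
    refine le_trans (ge_of_tendsto h0 (Filter.eventually_atTop.2 ⟨0, fun m hm => ?_⟩)) zero_le
    obtain ⟨m', ⟨-, hm'⟩, hlt⟩ := not_bddAbove_iff.1 hb m
    exact (hanti m ((monotone_maxBound hlt.le).trans hm')).trans (measure_maxBound_lt_le hV hm)

lemma integrable_sup' {Q : Measure Ω} {U : ι → Ω → ℝ} (hU : ∀ j, Integrable (U j) Q) :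
    Integrable (fun ω => Finset.univ.sup' Finset.univ_nonempty fun j => U j ω) Q := by
  have h := Finset.sup'_induction (p := fun g => Integrable g Q) Finset.univ_nonempty U
    (fun _ h₁ _ h₂ => h₁.sup h₂) fun j _ => hU j
  refine h.congr (Filter.Eventually.of_forall fun ω => ?_)
  simp [Finset.sup'_apply]

lemma integrable_sqrt_shiftedExp (s : ℝ) : Integrable (fun z => √z) (shiftedExp s (1 / 2)) := by
  refine ((integrable_id_shiftedExp s).abs.add (integrable_const 1)).mono'
    Real.continuous_sqrt.measurable.aestronglyMeasurable (Filter.Eventually.of_forall fun z => ?_)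
  rw [Real.norm_eq_abs, abs_of_nonneg (Real.sqrt_nonneg _), Pi.add_apply]
  rcases le_total z 0 with hz | hz
  · rw [Real.sqrt_eq_zero_of_nonpos hz]
    positivity
  · rw [abs_of_nonneg hz]
    nlinarith [Real.sq_sqrt hz, sq_nonneg (√z - 1)]

lemma integrable_maxBound_sqrt (s : ℝ) :
    Integrable (fun z => maxBound μ v √z) (shiftedExp s (1 / 2)) :=
  integrable_sup' fun j => (integrable_const _).add ((integrable_sqrt_shiftedExp s).mul_const _)

/-- The maximum of finitely many Gaussians is dominated in expectation by the largest upper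
confidence bound with randomized width. -/
lemma integral_sup'_le_integral_maxBound {s : ℝ} (hs : 2 * Real.log (Fintype.card ι / 2) ≤ s)
    (hV : ∀ j, HasLaw (V j) (gaussianReal (μ j) (v j)) P) :
    ∫ ω, (Finset.univ.sup' Finset.univ_nonempty fun j => V j ω) ∂P ≤
      ∫ z, maxBound μ v √z ∂shiftedExp s (1 / 2) := by
  have hVi : ∀ j, Integrable (V j) P := fun j => by
    have h := (memLp_id_gaussianReal (μ := μ j) (v := v j) 1).integrable le_rfl
    rw [← (hV j).map_eq] at h
    exact (integrable_map_measure aestronglyMeasurable_id (hV j).aemeasurable).1 h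
  have hM := integrable_sup' hVi
  set M : Ω → ℝ := fun ω => Finset.univ.sup' Finset.univ_nonempty fun j => V j ω with hMdef
  have hB := integrable_maxBound_sqrt (μ := μ) (v := v) s
  -- Tails compare only at levels above the largest mean c. Below c nothing is lost: the bound never
  -- falls below c, and M - c is at most its positive part.
  set c := maxBound μ v 0
  have hBc : ∀ z : ℝ, 0 ≤ maxBound μ v √z - c := fun z =>
    sub_nonneg.2 (monotone_maxBound (Real.sqrt_nonneg z))
  have hMc : Integrable (fun ω => max (M ω - c) 0) P := (hM.sub (integrable_const c)).pos_part
  have hM0 : ∀ ω, 0 ≤ max (M ω - c) 0 := fun ω => le_max_right _ _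
  have h1 : ∫⁻ ω, ENNReal.ofReal (max (M ω - c) 0) ∂P ≤
      ∫⁻ z, ENNReal.ofReal (maxBound μ v √z - c) ∂shiftedExp s (1 / 2) := by
    rw [lintegral_eq_lintegral_meas_lt _ (Filter.Eventually.of_forall hM0)
        hMc.aemeasurable,
      lintegral_eq_lintegral_meas_lt _ (Filter.Eventually.of_forall hBc)
        (hB.sub (integrable_const c)).aemeasurable]
    refine setLIntegral_mono' measurableSet_Ioi fun t (ht : 0 < t) => ?_
    refine le_trans (measure_mono ?_) ((measure_lt_maxBound_le hs hV (c + t) (by linarith)).trans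
      (measure_mono ?_))
    · intro ω hω
      rcases lt_max_iff.1 (show t < max (M ω - c) 0 from hω) with h | h
      · exact lt_sub_iff_add_lt'.1 h
      · exact absurd h (not_lt.2 ht.le)
    · intro z hz
      exact lt_sub_iff_add_lt'.2 (show c + t < maxBound μ v √z from hz)
  have h2 : ∫ ω, max (M ω - c) 0 ∂P ≤ ∫ z, (maxBound μ v √z - c) ∂shiftedExp s (1 / 2) := by
    rw [integral_eq_lintegral_of_nonneg_ae (Filter.Eventually.of_forall hM0)
        hMc.aestronglyMeasurable,
      integral_eq_lintegral_of_nonneg_ae (Filter.Eventually.of_forall hBc)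
        (hB.sub (integrable_const c)).aestronglyMeasurable]
    refine ENNReal.toReal_mono ?_ h1
    exact ((hasFiniteIntegral_iff_ofReal (Filter.Eventually.of_forall hBc)).1
      (hB.sub (integrable_const c)).2).ne
  have h3 : ∫ ω, (M ω - c) ∂P ≤ ∫ ω, max (M ω - c) 0 ∂P :=
    integral_mono (hM.sub (integrable_const c)) (hM.sub (integrable_const c)).pos_part
      fun ω => le_max_left _ _
  rw [integral_sub hB (integrable_const c)] at h2
  rw [integral_sub hM (integrable_const c)] at h3
  simp only [integral_const, probReal_univ, one_smul] at h2 h3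
  linarith

end Dominance

end BayesOpt

/-! ### Bounded partial derivatives imply the ℓ¹ Lipschitz property -/

namespace BayesOpt

section Lipschitz

variable {d : ℕ} {X : Set (Pt d)} {h : Pt d → ℝ} {g : Pt d → Pt d} {L : ℝ}

/-- The `ℓ¹` distance. -/
noncomputable def l1Dist {d : ℕ} (x y : Pt d) : ℝ := ∑ j, |x j - y j|

lemma l1Dist_nonneg (x y : Pt d) : 0 ≤ l1Dist x y := Finset.sum_nonneg fun _ _ => abs_nonneg _

lemma continuous_l1Dist : Continuous fun u : Pt d × Pt d => l1Dist u.1 u.2 := by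
  unfold l1Dist
  fun_prop

lemma l1Dist_lineMap (x y : Pt d) (t t' : ℝ) :
    l1Dist (AffineMap.lineMap x y t') (AffineMap.lineMap x y t) = |t' - t| * l1Dist y x := by
  simp only [l1Dist, Finset.mul_sum, ← abs_mul]
  refine Finset.sum_congr rfl fun j _ => congrArg _ ?_
  simp [AffineMap.lineMap_apply]
  ring

lemma sum_single_eq (v : Pt d) : ∑ j, v j • EuclideanSpace.single j (1 : ℝ) = v := by
  ext i
  simp [Finset.sum_apply, Pi.single_apply]

/-- Partial derivatives alone do not give differentiability, so the walk from u to v changes one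
coordinate at a time and applies the mean value inequality on each leg. -/
lemma HasPartialsOn.eventually_abs_sub_le (hp : HasPartialsOn X h g)
    (hg : ∀ x ∈ X, ∀ j, |g x j| ≤ L) {u : Pt d} (hu : u ∈ interior X) :
    ∃ δ > 0, ∀ v, l1Dist v u < δ → |h v - h u| ≤ L * l1Dist v u := by
  obtain ⟨δ, hδ, hball⟩ := Metric.isOpen_iff.1 isOpen_interior u hu
  refine ⟨δ, hδ, fun v hv => ?_⟩
  set m : Finset (Fin d) → Pt d := fun s => u + ∑ j ∈ s, (v j - u j) • EuclideanSpace.single j (1 : ℝ)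
    with hm
  have key : ∀ s : Finset (Fin d), |h (m s) - h u| ≤ L * ∑ j ∈ s, |v j - u j| := by
    intro s
    induction s using Finset.induction_on with
    | empty => simp [hm]
    | insert j s hj ih =>
      set c := v j - u j with hc
      -- The walk stays in the Euclidean ball of radius δ around u, because the ℓ¹ distance
      -- dominates the Euclidean one.
      have hmem : ∀ τ ∈ Set.Icc (0 : ℝ) 1,
          m s + (τ * c) • EuclideanSpace.single j (1 : ℝ) ∈ interior X := by
        intro τ hτ
        refine hball ?_
        rw [Metric.mem_ball, dist_eq_norm]
        refine lt_of_le_of_lt ?_ hv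
        have e : m s + (τ * c) • EuclideanSpace.single j (1 : ℝ) - u =
            ∑ i ∈ s, (v i - u i) • EuclideanSpace.single i (1 : ℝ) +
              (τ * c) • EuclideanSpace.single j (1 : ℝ) := by
          simp only [hm, add_assoc, add_sub_cancel_left]
        rw [e]
        have hle : ‖∑ i ∈ s, (v i - u i) • EuclideanSpace.single i (1 : ℝ)‖ ≤
            ∑ i ∈ s, |v i - u i| := by
          refine (norm_sum_le _ _).trans (le_of_eq (Finset.sum_congr rfl fun i _ => ?_))
          simp [norm_smul]
        have hle2 : ‖(τ * c) • EuclideanSpace.single j (1 : ℝ)‖ ≤ |c| := by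
          simp only [norm_smul, Real.norm_eq_abs, abs_mul, PiLp.norm_single, abs_one,
            mul_one, abs_of_nonneg hτ.1]
          exact mul_le_of_le_one_left (abs_nonneg _) hτ.2
        refine (norm_add_le _ _).trans ((add_le_add hle hle2).trans ?_)
        rw [add_comm, ← Finset.sum_insert (f := fun i => |v i - u i|) hj]
        exact Finset.sum_le_sum_of_subset_of_nonneg (Finset.subset_univ _) fun _ _ _ => abs_nonneg _
      have hder : ∀ τ ∈ Set.Icc (0 : ℝ) 1,
          HasDerivWithinAt (fun τ => h (m s + (τ * c) • EuclideanSpace.single j (1 : ℝ)))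
            (g (m s + (τ * c) • EuclideanSpace.single j (1 : ℝ)) j * c) (Set.Icc 0 1) τ := by
        intro τ hτ
        have h1 := hp.partials _ (hmem τ hτ) j
        have h2 : HasDerivAt (fun τ' : ℝ => (τ' - τ) * c) c τ := by
          simpa using ((hasDerivAt_id τ).sub_const τ).mul_const c
        have h3 := HasDerivAt.comp_of_eq τ h1 h2 (by simp)
        refine (h3.congr_of_eventuallyEq (Filter.Eventually.of_forall fun τ' => ?_)).hasDerivWithinAt
        simp only [Function.comp_apply]
        refine congrArg h ?_
        module
      have hb := norm_image_sub_le_of_norm_deriv_le_segment_01' hder (C := L * |c|) fun τ hτ => by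
        rw [norm_mul]
        exact mul_le_mul_of_nonneg_right
          (hg _ (interior_subset (hmem τ (Set.Ico_subset_Icc_self hτ))) j) (abs_nonneg _)
      have hins : m (insert j s) = m s + (1 * c) • EuclideanSpace.single j (1 : ℝ) := by
        simp only [hm, Finset.sum_insert hj, one_mul]
        abel
      rw [hins, Finset.sum_insert hj, mul_add]
      simp only [zero_mul, zero_smul, add_zero, Real.norm_eq_abs] at hb
      have := abs_sub_le (h (m s + (1 * c) • EuclideanSpace.single j (1 : ℝ))) (h (m s)) (h u)
      linarith
  have huniv : m Finset.univ = v := by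
    have := sum_single_eq (v - u)
    simp only [PiLp.sub_apply] at this
    simp [hm, this]
  have := key Finset.univ
  rwa [huniv] at this

/-- The segment from an interior point lies in the interior except perhaps for its end y. The local
estimate bounds the right slopes along it, and continuity takes care of y. The sign ε treats upper
and lower bounds at once. -/
lemma HasPartialsOn.sub_le_of_interior (hp : HasPartialsOn X h g) (hX : Convex ℝ X)
    (hg : ∀ x ∈ X, ∀ j, |g x j| ≤ L) {x y : Pt d} (hx : x ∈ interior X) (hy : y ∈ X) (ε : ℝ)
    (hε : |ε| = 1) : ε * h y - ε * h x ≤ L * l1Dist y x := by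
  have hseg : ∀ t ∈ Set.Icc (0 : ℝ) 1, AffineMap.lineMap x y t ∈ X := fun t ht =>
    hX.lineMap_mem (interior_subset hx) hy ht
  have hint : ∀ t ∈ Set.Ico (0 : ℝ) 1, AffineMap.lineMap x y t ∈ interior X := fun t ht => by
    rw [AffineMap.lineMap_apply_module]
    exact hX.combo_interior_self_mem_interior hx hy (by linarith [ht.2]) ht.1 (by ring)
  have hc : ContinuousOn (fun t : ℝ => ε * h (AffineMap.lineMap x y t)) (Set.Icc 0 1) :=
    continuousOn_const.mul (hp.continuousOn.comp AffineMap.lineMap_continuous.continuousOn hseg)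
  have hB : ∀ t : ℝ, HasDerivAt (fun t => ε * h x + t * (L * l1Dist y x)) (L * l1Dist y x) t :=
    fun t => by simpa using ((hasDerivAt_id t).mul_const (L * l1Dist y x)).const_add (ε * h x)
  have := image_le_of_liminf_slope_right_le_deriv_boundary hc
    (B := fun t => ε * h x + t * (L * l1Dist y x)) (B' := fun _ => L * l1Dist y x) (by simp)
    (fun t _ => (hB t).continuousAt.continuousWithinAt) (fun t _ => (hB t).hasDerivWithinAt)
    (fun t ht r hr => ?_) (Set.right_mem_Icc.2 zero_le_one)
  · simp only [AffineMap.lineMap_apply_one, one_mul] at this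
    linarith
  · obtain ⟨δ, hδ, hloc⟩ := hp.eventually_abs_sub_le hg (hint t ht)
    refine Filter.Eventually.frequently ?_
    have hnear : ∀ᶠ z in nhdsWithin t (Set.Ioi t),
        l1Dist (AffineMap.lineMap x y z) (AffineMap.lineMap x y t) < δ := by
      have hcont : Continuous fun z : ℝ =>
          l1Dist (AffineMap.lineMap x y z : Pt d) (AffineMap.lineMap x y t) :=
        continuous_l1Dist.comp (AffineMap.lineMap_continuous.prodMk continuous_const)
      have h0 : l1Dist (AffineMap.lineMap x y t) (AffineMap.lineMap x y t : Pt d) < δ := by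
        simpa [l1Dist] using hδ
      exact nhdsWithin_le_nhds (hcont.continuousAt.eventually (gt_mem_nhds h0))
    filter_upwards [hnear, self_mem_nhdsWithin] with z hz htz
    have hzt : 0 < z - t := sub_pos.2 htz
    refine lt_of_le_of_lt ?_ hr
    rw [slope_def_field, div_le_iff₀ hzt, ← mul_sub]
    have h1 := hloc _ hz
    rw [l1Dist_lineMap, abs_of_pos hzt] at h1
    calc _ ≤ |ε * (h (AffineMap.lineMap x y z) - h (AffineMap.lineMap x y t))| := le_abs_self _
      _ ≤ L * ((z - t) * l1Dist y x) := by rw [abs_mul, hε, one_mul]; exact h1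
      _ = _ := by ring

/-- A function with partial derivatives bounded by `L` is `L`-Lipschitz in the `ℓ¹` distance. -/
lemma HasPartialsOn.abs_sub_le (hp : HasPartialsOn X h g) (hX : Convex ℝ X)
    (hg : ∀ x ∈ X, ∀ j, |g x j| ≤ L) {x y : Pt d} (hx : x ∈ X) (hy : y ∈ X) :
    |h y - h x| ≤ L * l1Dist y x := by
  rcases Set.eq_empty_or_nonempty (interior X) with he | ⟨z, hz⟩
  -- Coordinate lines may leave X here; the relative gradient is differentiated along the segment
  -- instead.
  · have hseg : ∀ t ∈ Set.Icc (0 : ℝ) 1, AffineMap.lineMap x y t ∈ X := fun t ht =>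
      hX.lineMap_mem hx hy ht
    have hder : ∀ t ∈ Set.Icc (0 : ℝ) 1,
        HasDerivWithinAt (fun t : ℝ => h (AffineMap.lineMap x y t))
          (inner ℝ (g (AffineMap.lineMap x y t)) (y - x)) (Set.Icc 0 1) t := by
      intro t ht
      have h1 := (hp.degenerate he _ (hseg t ht)).hasFDerivWithinAt
      have h2 : HasDerivWithinAt (fun t : ℝ => AffineMap.lineMap x y t) (y - x) (Set.Icc 0 1) t :=
        AffineMap.hasDerivWithinAt_lineMap
      have := h1.comp_hasDerivWithinAt t h2 hseg
      simpa [Function.comp_def] using this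
    have hb := norm_image_sub_le_of_norm_deriv_le_segment_01' hder (C := L * l1Dist y x)
      fun t ht => by
        rw [PiLp.inner_apply, l1Dist, Finset.mul_sum]
        refine (norm_sum_le _ _).trans (Finset.sum_le_sum fun j _ => ?_)
        have := hg _ (hseg t (Set.Ico_subset_Icc_self ht)) j
        simp only [RCLike.inner_apply, conj_trivial, norm_mul, Real.norm_eq_abs, PiLp.sub_apply]
        rw [mul_comm]
        exact mul_le_mul_of_nonneg_right this (abs_nonneg _)
    simpa using hb
  -- Neither x nor y need be interior: x is approached along the segment from an interior point z,
  -- and the estimate passes to the limit.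
  · have hxs : ∀ t ∈ Set.Ioc (0 : ℝ) 1, AffineMap.lineMap x z t ∈ interior X := fun t ht => by
      rw [AffineMap.lineMap_apply_module]
      exact hX.combo_self_interior_mem_interior hx hz (by linarith [ht.2]) ht.1 (by ring)
    have hineq : ∀ t ∈ Set.Ioc (0 : ℝ) 1,
        |h y - h (AffineMap.lineMap x z t)| ≤ L * l1Dist y (AffineMap.lineMap x z t) := fun t ht => by
      have h1 := hp.sub_le_of_interior hX hg (hxs t ht) hy 1 (by simp)
      have h2 := hp.sub_le_of_interior hX hg (hxs t ht) hy (-1) (by simp)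
      rw [abs_le]
      constructor <;> linarith
    have hmap : Filter.Tendsto (fun t : ℝ => (AffineMap.lineMap x z t : Pt d))
        (nhdsWithin 0 (Set.Ioc 0 1)) (nhdsWithin x X) := by
      refine tendsto_nhdsWithin_iff.2 ⟨?_, ?_⟩
      · have : Continuous fun t : ℝ => (AffineMap.lineMap x z t : Pt d) :=
          AffineMap.lineMap_continuous
        have := this.tendsto 0
        rw [AffineMap.lineMap_apply_zero] at this
        exact this.mono_left nhdsWithin_le_nhds
      · filter_upwards [self_mem_nhdsWithin] with t ht using interior_subset (hxs t ht)
    have hne : (nhdsWithin (0 : ℝ) (Set.Ioc 0 1)).NeBot := by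
      rw [nhdsWithin_Ioc_eq_nhdsGT zero_lt_one]
      infer_instance
    have t1 : Filter.Tendsto (fun t : ℝ => |h y - h (AffineMap.lineMap x z t)|)
        (nhdsWithin 0 (Set.Ioc 0 1)) (nhds |h y - h x|) :=
      ((tendsto_const_nhds.sub ((hp.continuousOn x hx).tendsto.comp hmap))).abs
    have t2 : Filter.Tendsto (fun t : ℝ => L * l1Dist y (AffineMap.lineMap x z t))
        (nhdsWithin 0 (Set.Ioc 0 1)) (nhds (L * l1Dist y x)) := by
      have hc : Continuous fun w : Pt d => l1Dist y w :=
        continuous_l1Dist.comp (continuous_const.prodMk continuous_id)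
      exact ((hc.tendsto x).comp (hmap.mono_right nhdsWithin_le_nhds)).const_mul L
    refine le_of_tendsto_of_tendsto t1 t2 ?_
    filter_upwards [self_mem_nhdsWithin] with t ht using hineq t ht

end Lipschitz

/-! ### A finite net of the domain -/

section Net

variable {d : ℕ} {X : Set (Pt d)} {r : ℝ}

/-- The metric projection onto a compact convex set is a contraction towards its points. -/
lemma exists_proj (hXc : IsCompact X) (hX : Convex ℝ X) (hne : X.Nonempty) (c : Pt d) :
    ∃ v ∈ X, ∀ x ∈ X, ‖x - v‖ ≤ ‖x - c‖ := by
  obtain ⟨v, hv, hmin⟩ := exists_norm_eq_iInf_of_complete_convex hne hXc.isComplete hX c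
  refine ⟨v, hv, fun x hx => ?_⟩
  have h1 := (norm_eq_iInf_iff_real_inner_le_zero hX hv).1 hmin x hx
  have h2 : ‖x - c‖ ^ 2 = ‖x - v‖ ^ 2 - 2 * inner ℝ (x - v) (c - v) + ‖c - v‖ ^ 2 := by
    rw [← norm_sub_sq_real]
    congr 2
    abel
  rw [real_inner_comm] at h1
  exact le_of_sq_le_sq (by nlinarith [sq_nonneg ‖c - v‖]) (norm_nonneg _)

/-- The projection onto X contracts only Euclidean distances. A cell center within η in each
coordinate is within √d η in norm, and Cauchy–Schwarz returns dη, the same ℓ¹ bound as before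
projecting. -/
lemma l1Dist_le_of_norm_le {x y : Pt d} {η : ℝ} (hη : 0 ≤ η) (h : ‖x - y‖ ≤ √d * η) :
    l1Dist x y ≤ d * η := by
  have h1 : (l1Dist x y) ^ 2 ≤ d * ‖x - y‖ ^ 2 := by
    have := sq_sum_le_card_mul_sum_sq (s := (Finset.univ : Finset (Fin d)))
      (f := fun j => |x j - y j|)
    simpa [l1Dist, EuclideanSpace.real_norm_sq_eq] using this
  have h2 : ‖x - y‖ ^ 2 ≤ (√d * η) ^ 2 := pow_le_pow_left₀ (norm_nonneg _) h 2
  rw [mul_pow, Real.sq_sqrt (Nat.cast_nonneg d)] at h2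
  refine le_of_sq_le_sq ?_ (by positivity)
  calc _ ≤ (d : ℝ) * ‖x - y‖ ^ 2 := h1
    _ ≤ d * (d * η ^ 2) := mul_le_mul_of_nonneg_left h2 (Nat.cast_nonneg d)
    _ = _ := by ring

/-- A net of at most `m ^ d` points with mesh `d r / (2 m)` in the `ℓ¹` distance. -/
lemma exists_net (hXc : IsCompact X) (hX : Convex ℝ X) (hne : X.Nonempty) (hr : 0 < r)
    (hXr : ∀ x ∈ X, ∀ j, x j ∈ Set.Icc 0 r) {m : ℕ} (hm : 0 < m) :
    ∃ z : (Fin d → Fin m) → Pt d, (∀ i, z i ∈ X) ∧ ∀ x ∈ X, ∃ i, l1Dist x (z i) ≤ d * (r / (2 * m)) := by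
  choose π hπ hπ' using exists_proj hXc hX hne
  have hm' : (0 : ℝ) < m := by exact_mod_cast hm
  -- Centers of the m^d subcubes of [0, r]^d. They may lie outside X and are projected onto it.
  let c : (Fin d → Fin m) → Pt d := fun i =>
    WithLp.toLp 2 fun j => (((i j : ℕ) : ℝ) + 1 / 2) * (r / m)
  refine ⟨fun i => π (c i), fun i => hπ _, fun x hx => ?_⟩
  have hcell : ∀ j, ∃ i : Fin m, |x j - ((((i : ℕ) : ℝ) + 1 / 2) * (r / m))| ≤ r / (2 * m) := by
    intro j
    obtain ⟨h0, h1⟩ := hXr x hx j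
    set q := x j * m / r with hq
    have hq0 : 0 ≤ q := by positivity
    have hqm : q ≤ m := by
      rw [hq, div_le_iff₀ hr, mul_comm]
      exact mul_le_mul_of_nonneg_left h1 hm'.le
    have hxq : x j = q * (r / m) := by
      rw [hq]
      field_simp
    have hfin : ∀ i : ℕ, |q - (i + 1 / 2)| ≤ 1 / 2 →
        |x j - (((i : ℝ) + 1 / 2) * (r / m))| ≤ r / (2 * m) := by
      intro i hi
      rw [hxq, ← sub_mul, abs_mul, abs_of_pos (div_pos hr hm')]
      calc _ ≤ 1 / 2 * (r / m) := mul_le_mul_of_nonneg_right hi (div_pos hr hm').le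
        _ = _ := by field_simp
    by_cases hlt : ⌊q⌋₊ < m
    · refine ⟨⟨⌊q⌋₊, hlt⟩, hfin _ ?_⟩
      have := Nat.floor_le hq0
      have := Nat.lt_floor_add_one q
      rw [abs_le]
      constructor <;> linarith
    -- The face x_j = r, where the floor is m, belongs to the last cell.
    · have hqm2 : (m : ℝ) ≤ q := (Nat.le_floor_iff hq0).1 (not_lt.1 hlt)
      have hqe : q = m := le_antisymm hqm hqm2
      refine ⟨⟨m - 1, by omega⟩, hfin _ ?_⟩
      rw [Nat.cast_sub hm, hqe, abs_le]
      constructor <;> push_cast <;> linarith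
  choose i hi using hcell
  refine ⟨i, l1Dist_le_of_norm_le (by positivity) ((hπ' (c i) x hx).trans ?_)⟩
  rw [EuclideanSpace.norm_eq, ← Real.sqrt_sq (show 0 ≤ r / (2 * m) by positivity),
    ← Real.sqrt_mul (Nat.cast_nonneg d)]
  refine Real.sqrt_le_sqrt ?_
  calc ∑ j, ‖(x - c i) j‖ ^ 2 ≤ ∑ _j : Fin d, (r / (2 * m)) ^ 2 :=
        Finset.sum_le_sum fun j _ => pow_le_pow_left₀ (norm_nonneg _) (hi j) 2
    _ = _ := by simp

end Net

end BayesOpt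

/-! ### The random Lipschitz constant -/

namespace BayesOpt

section Lipschitz

variable {d : ℕ} {Ω : Type*} [MeasurableSpace Ω] {P : Measure Ω} {X : Set (Pt d)}
  {f : Pt d → Ω → ℝ} {a b : ℝ}

lemma l1Dist_eq_zero {x y : Pt d} (h : l1Dist x y = 0) : x = y := by
  ext j
  have := (Finset.sum_eq_zero_iff_of_nonneg fun _ _ => abs_nonneg _).1 h j (Finset.mem_univ j)
  exact sub_eq_zero.1 (abs_eq_zero.1 this)

/-- A random variable with Gaussian tails beyond `m` has expectation at most `m + b √π / 2`. -/
lemma lintegral_le_of_subGaussian_tail [IsProbabilityMeasure P] {φ : Ω → ℝ} (hφ : Measurable φ)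
    {m : ℝ} (hm : 0 ≤ m) (hb : 0 < b)
    (ht : ∀ u : ℝ, 0 < u → P {ω | m + u < φ ω} ≤ ENNReal.ofReal (Real.exp (-(u / b) ^ 2))) :
    ∫⁻ ω, ENNReal.ofReal (φ ω) ∂P ≤ ENNReal.ofReal (m + b * (√Real.pi / 2)) := by
  have h1 : ∀ ω, ENNReal.ofReal (φ ω) ≤ ENNReal.ofReal m + ENNReal.ofReal (max (φ ω - m) 0) :=
    fun ω => by
      rw [← ENNReal.ofReal_add hm (le_max_right _ _)]
      exact ENNReal.ofReal_le_ofReal (by linarith [le_max_left (φ ω - m) 0])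
  have h2 : ∫⁻ ω, ENNReal.ofReal (max (φ ω - m) 0) ∂P ≤
      ENNReal.ofReal (b * (√Real.pi / 2)) := by
    rw [lintegral_eq_lintegral_meas_lt P (f := fun ω => max (φ ω - m) 0)
      (Filter.Eventually.of_forall fun ω => le_max_right _ _)
      ((hφ.sub_const m).max measurable_const).aemeasurable]
    calc _ ≤ ∫⁻ u in Set.Ioi (0 : ℝ), ENNReal.ofReal (Real.exp (-(b⁻¹ ^ 2) * u ^ 2)) := by
          refine setLIntegral_mono' measurableSet_Ioi fun u hu => ?_
          have hu : 0 < u := hu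
          refine le_trans (measure_mono fun ω hω => ?_) ((ht u hu).trans (le_of_eq ?_))
          · have hω : u < max (φ ω - m) 0 := hω
            rcases lt_max_iff.1 hω with h | h
            · show m + u < φ ω
              linarith
            · linarith
          · congr 2
            rw [div_eq_mul_inv]
            ring
      _ = ENNReal.ofReal (b * (√Real.pi / 2)) := by
          rw [← ofReal_integral_eq_lintegral_ofReal
            (integrable_exp_neg_mul_sq (by positivity)).integrableOn
            (Filter.Eventually.of_forall fun _ => (Real.exp_pos _).le), integral_gaussian_Ioi]
          congr 1
          rw [Real.sqrt_div' _ (by positivity), Real.sqrt_sq (by positivity)]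
          field_simp
  calc _ ≤ ∫⁻ ω, (ENNReal.ofReal m + ENNReal.ofReal (max (φ ω - m) 0)) ∂P := lintegral_mono h1
    _ = ENNReal.ofReal m + ∫⁻ ω, ENNReal.ofReal (max (φ ω - m) 0) ∂P := by
        rw [lintegral_add_left measurable_const]
        simp
    _ ≤ _ := by
        rw [ENNReal.ofReal_add hm (by positivity)]
        gcongr

/-- Sample paths are almost surely Lipschitz, with an integrable random constant. -/
lemma SubGaussianPartials.exists_lipschitz [IsProbabilityMeasure P] (hd : 0 < d)
    (hX : Convex ℝ X) (hf : ∀ x ∈ X, AEMeasurable (f x) P) (ha : 0 < a) (hb : 0 < b)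
    (h : SubGaussianPartials P X f a b) :
    ∃ ℓ : Ω → ℝ, Integrable ℓ P ∧ (∀ ω, 0 ≤ ℓ ω) ∧
      (∀ᵐ ω ∂P, ∀ x ∈ X, ∀ y ∈ X, f y ω - f x ω ≤ ℓ ω * l1Dist y x) ∧
      ∫ ω, ℓ ω ∂P ≤ b * (√(Real.log (a * d)) + √Real.pi / 2) := by
  obtain ⟨g, hg, hgt⟩ := h
  rcases X.eq_empty_or_nonempty with rfl | hne
  · exact ⟨fun _ => 0, integrable_zero _ _ _, fun _ => le_rfl, by simp, by simp; positivity⟩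
  have : Nonempty X := hne.to_subtype
  obtain ⟨q, hq⟩ := TopologicalSpace.exists_dense_seq X
  let f' : ℕ → Ω → ℝ := fun n => (hf (q n) (q n).2).mk
  have hf'm : ∀ n, Measurable (f' n) := fun n => (hf (q n) (q n).2).measurable_mk
  have hf' : ∀ᵐ ω ∂P, ∀ n, f (q n) ω = f' n ω :=
    ae_all_iff.2 fun n => (hf (q n) (q n).2).ae_eq_mk
  -- The supremum of difference quotients over a countable dense set is measurable, while nothing is
  -- known about the measurability of the gradient g. Coinciding points contribute 0.
  let lip : Ω → ℝ≥0∞ := fun ω => ⨆ (n : ℕ) (m : ℕ),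
    ENNReal.ofReal (|f' n ω - f' m ω| / l1Dist (q n : Pt d) (q m))
  have hlipm : Measurable lip := Measurable.iSup fun n => Measurable.iSup fun m =>
    ((((hf'm n).sub (hf'm m)).abs).div_const _).ennreal_ofReal
  -- the tail of the Lipschitz constant
  have htail : ∀ L : ℝ, 0 < L → P {ω | ENNReal.ofReal L < lip ω} ≤
      ENNReal.ofReal (a * d * Real.exp (-(L / b) ^ 2)) := by
    intro L hL
    -- If all partial derivatives are at most L, so are the difference quotients. The union bound
    -- over coordinates produces the factor d.
    have hsub : {ω | ENNReal.ofReal L < lip ω} ≤ᵐ[P]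
        ⋃ j : Fin d, {ω | ENNReal.ofReal L < ⨆ x ∈ X, ‖g ω x j‖ₑ} := by
      filter_upwards [hg, hf'] with ω hω hω'
      intro hlt
      have hlt : ENNReal.ofReal L < lip ω := hlt
      refine Set.mem_iUnion.2 ?_
      by_contra hcon
      have hcon : ∀ j, ¬ ENNReal.ofReal L < ⨆ x ∈ X, ‖g ω x j‖ₑ := fun j hj => hcon ⟨j, hj⟩
      refine absurd hlt (not_lt.2 (iSup₂_le fun n m => ENNReal.ofReal_le_ofReal ?_))
      have hbd : ∀ x ∈ X, ∀ j, |g ω x j| ≤ L := by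
        intro x hx j
        have := (le_iSup₂ (f := fun x (_ : x ∈ X) => ‖g ω x j‖ₑ) x hx).trans (not_lt.1 (hcon j))
        rw [← ofReal_norm] at this
        exact (ENNReal.ofReal_le_ofReal_iff hL.le).1 this
      rw [← hω' n, ← hω' m]
      exact div_le_of_le_mul₀ (l1Dist_nonneg _ _) hL.le
        (hω.abs_sub_le hX hbd (q m).2 (q n).2)
    calc _ ≤ P (⋃ j : Fin d, {ω | ENNReal.ofReal L < ⨆ x ∈ X, ‖g ω x j‖ₑ}) :=
          measure_mono_ae hsub
      _ ≤ ∑ j : Fin d, P {ω | ENNReal.ofReal L < ⨆ x ∈ X, ‖g ω x j‖ₑ} :=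
          measure_iUnion_fintype_le _ _
      _ ≤ ∑ _j : Fin d, ENNReal.ofReal (a * Real.exp (-(L / b) ^ 2)) :=
          Finset.sum_le_sum fun j _ => hgt j L hL
      _ = _ := by
          rw [Finset.sum_const, Finset.card_univ, Fintype.card_fin, nsmul_eq_mul,
            ← ENNReal.ofReal_natCast, ← ENNReal.ofReal_mul (Nat.cast_nonneg d)]
          congr 1
          ring
  have hfin : ∀ᵐ ω ∂P, lip ω < ∞ := by
    have h0 : P {ω | ¬ lip ω < ∞} ≤ 0 := by
      have hlim : Filter.Tendsto (fun n : ℕ =>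
          ENNReal.ofReal (a * d * Real.exp (-(((n : ℝ) + 1) / b) ^ 2))) Filter.atTop (nhds 0) := by
        rw [← ENNReal.ofReal_zero]
        refine ENNReal.tendsto_ofReal ?_
        rw [← mul_zero (a * d)]
        refine Filter.Tendsto.const_mul _ (Real.tendsto_exp_atBot.comp ?_)
        refine Filter.tendsto_neg_atTop_atBot.comp
          ((Filter.tendsto_pow_atTop two_ne_zero).comp ?_)
        exact (Filter.tendsto_atTop_add_const_right _ _ tendsto_natCast_atTop_atTop).atTop_div_const
          hb
      refine ge_of_tendsto' hlim fun n => (measure_mono fun ω hω => ?_).trans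
        (htail ((n : ℝ) + 1) (by positivity))
      have hω : ¬ lip ω < ∞ := hω
      show ENNReal.ofReal _ < lip ω
      rw [not_lt_top_iff.1 hω]
      exact ENNReal.ofReal_lt_top
    exact le_antisymm h0 zero_le
  -- the expectation
  have hd' : (0 : ℝ) < d := by exact_mod_cast hd
  have hint : ∫⁻ ω, ENNReal.ofReal (lip ω).toReal ∂P ≤
      ENNReal.ofReal (b * √(Real.log (a * d)) + b * (√Real.pi / 2)) := by
    refine lintegral_le_of_subGaussian_tail hlipm.ennreal_toReal (by positivity) hb fun u hu => ?_
    -- Beyond this m the prefactor a d is absorbed: a d exp(-(m/b)²) ≤ 1.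
    set m := b * √(Real.log (a * d)) with hm
    have hm0 : 0 ≤ m := by positivity
    refine (measure_mono fun ω hω => ?_).trans ((htail (m + u) (by positivity)).trans
      (ENNReal.ofReal_le_ofReal ?_))
    · have hω : m + u < (lip ω).toReal := hω
      exact (ENNReal.ofReal_lt_iff_lt_toReal (by positivity)
        fun htop => by rw [htop, ENNReal.toReal_top] at hω; linarith).2 hω
    · have had : 0 < a * d := by positivity
      have h1 : Real.log (a * d) ≤ (m / b) ^ 2 := by
        rw [hm, mul_div_cancel_left₀ _ hb.ne']
        rcases le_total 0 (Real.log (a * d)) with h | h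
        · rw [Real.sq_sqrt h]
        · exact h.trans (sq_nonneg _)
      calc a * d * Real.exp (-((m + u) / b) ^ 2)
          = Real.exp (Real.log (a * d) + -((m + u) / b) ^ 2) := by
            rw [Real.exp_add, Real.exp_log had]
        _ ≤ _ := by
            refine Real.exp_le_exp.2 ?_
            have h2 : 0 ≤ m / b * (u / b) := by positivity
            rw [add_div]
            nlinarith
  have hℓm : Measurable fun ω => (lip ω).toReal := hlipm.ennreal_toReal
  have hℓi : Integrable (fun ω => (lip ω).toReal) P :=
    (lintegral_ofReal_ne_top_iff_integrable hℓm.aestronglyMeasurable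
      (Filter.Eventually.of_forall fun _ => ENNReal.toReal_nonneg)).1
      (ne_top_of_le_ne_top ENNReal.ofReal_ne_top hint)
  refine ⟨fun ω => (lip ω).toReal, hℓi, fun _ => ENNReal.toReal_nonneg, ?_, ?_⟩
  · filter_upwards [hg, hf', hfin] with ω hω hω' hω''
    have hcont : Continuous fun x : X => f x ω := hω.continuousOn.domRestrict
    have hdense : Dense (Set.range fun nm : ℕ × ℕ => (q nm.1, q nm.2)) := by
      have := hq.prodMap hq
      exact this
    -- The estimate is a closed condition on pairs of points, so it extends from the dense set to X.
    have hclosed : IsClosed {u : X × X |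
        f u.2 ω - f u.1 ω ≤ (lip ω).toReal * l1Dist (u.2 : Pt d) u.1} := by
      refine isClosed_le ?_ ?_
      · exact (hcont.comp continuous_snd).sub (hcont.comp continuous_fst)
      · exact continuous_const.mul (continuous_l1Dist.comp
          ((continuous_subtype_val.comp continuous_snd).prodMk
            (continuous_subtype_val.comp continuous_fst)))
    have hall : closure (Set.range fun nm : ℕ × ℕ => (q nm.1, q nm.2)) ⊆ _ :=
      hclosed.closure_subset_iff.2 ?_
    · intro x hx y hy
      have : ((⟨x, hx⟩, ⟨y, hy⟩) : X × X) ∈ closure _ := hdense _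
      exact hall this
    · rintro _ ⟨⟨m, n⟩, rfl⟩
      show f (q n) ω - f (q m) ω ≤ _
      rcases (l1Dist_nonneg (q n : Pt d) (q m)).eq_or_lt with h0 | h0
      · have := l1Dist_eq_zero h0.symm
        rw [← h0, this]
        simp
      · rw [← div_le_iff₀ h0]
        have h1 : ENNReal.ofReal (|f' n ω - f' m ω| / l1Dist (q n : Pt d) (q m)) ≤ lip ω :=
          le_iSup₂ (f := fun n m =>
            ENNReal.ofReal (|f' n ω - f' m ω| / l1Dist (q n : Pt d) (q m))) n m
        have h2 := (ENNReal.ofReal_le_iff_le_toReal hω''.ne).1 h1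
        rw [hω' n, hω' m]
        exact (div_le_div_of_nonneg_right (le_abs_self _) h0.le).trans h2
  · rw [integral_eq_lintegral_of_nonneg_ae
      (Filter.Eventually.of_forall fun _ => ENNReal.toReal_nonneg) hℓm.aestronglyMeasurable]
    rw [mul_add]
    exact ENNReal.toReal_le_of_le_ofReal (by positivity) hint

end Lipschitz

end BayesOpt

/-! ### Posterior distributions of the path and their measurability -/

namespace BayesOpt

section MatrixMeasurability

variable {α : Type*} [MeasurableSpace α] {n : ℕ}

lemma measurable_det {A : α → Matrix (Fin n) (Fin n) ℝ} (hA : ∀ i j, Measurable fun u => A u i j) :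
    Measurable fun u => (A u).det := by
  simp only [Matrix.det_apply']
  exact Finset.measurable_sum _ fun τ _ =>
    (Finset.measurable_prod _ fun i _ => hA (τ i) i).const_mul _

lemma measurable_inv_apply {A : α → Matrix (Fin n) (Fin n) ℝ}
    (hA : ∀ i j, Measurable fun u => A u i j) (i j : Fin n) : Measurable fun u => (A u)⁻¹ i j := by
  simp only [Matrix.inv_def, Matrix.smul_apply, smul_eq_mul, Ring.inverse_eq_inv',
    Matrix.adjugate_apply]
  refine (measurable_det hA).inv.mul (measurable_det fun i' j' => ?_)
  simp only [Matrix.updateRow_apply]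
  split_ifs
  · exact measurable_const
  · exact hA i' j'

end MatrixMeasurability

section Posterior

variable {S W : Type*} [MeasurableSpace S] [MeasurableSpace W]

/-- Under `ν`, the jointly measurable process `ev` is a centered Gaussian process with covariance
function `k`. -/
structure IsGaussianModel (ν : Measure W) (k : S → S → ℝ) (ev : W → S → ℝ) : Prop where
  measurable_eval : Measurable fun u : W × S => ev u.1 u.2
  gaussian : IsGaussianProcess (fun s w => ev w s) ν
  mean : ∀ s, ∫ w, ev w s ∂ν = 0
  covariance : ∀ s s', cov[fun w => ev w s, fun w => ev w s'; ν] = k s s'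
  psd : IsPSDKernelOn k Set.univ

variable {ν : Measure W} [IsProbabilityMeasure ν] {k : S → S → ℝ} {ev : W → S → ℝ} {σ : ℝ}
  {n : ℕ}

namespace IsGaussianModel

lemma measurable_eval_comp (h : IsGaussianModel ν k ev) {α : Type*} [MeasurableSpace α] {w : α → W}
    {s : α → S} (hw : Measurable w) (hs : Measurable s) : Measurable fun u => ev (w u) (s u) :=
  h.measurable_eval.comp (hw.prodMk hs)

/-- k(s, s') is the expectation of the product of two values of a jointly measurable process, so the
kernel inherits measurability. -/
lemma measurable_kernel (h : IsGaussianModel ν k ev) :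
    Measurable fun u : S × S => k u.1 u.2 := by
  have h1 : (fun u : S × S => k u.1 u.2) = fun u => ∫ w, ev w u.1 * ev w u.2 ∂ν := by
    funext u
    rw [← h.covariance]
    simp [ProbabilityTheory.covariance, h.mean]
  rw [h1]
  refine (StronglyMeasurable.integral_prod_right' (f := fun q : (S × S) × W =>
    ev q.2 q.1.1 * ev q.2 q.1.2) (Measurable.stronglyMeasurable ?_)).measurable
  exact (h.measurable_eval_comp measurable_snd (measurable_fst.comp measurable_fst)).mul
    (h.measurable_eval_comp measurable_snd (measurable_snd.comp measurable_fst))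

variable {α : Type*} [MeasurableSpace α] {p : α → Fin n → S} {y : α → Fin n → ℝ} {x : α → S}

lemma measurable_kernel_comp (h : IsGaussianModel ν k ev) {s s' : α → S} (hs : Measurable s)
    (hs' : Measurable s') : Measurable fun u => k (s u) (s' u) :=
  h.measurable_kernel.comp (hs.prodMk hs')

lemma measurable_regInv (h : IsGaussianModel ν k ev) (hp : Measurable p) (i j : Fin n) :
    Measurable fun u => regInv k σ (p u) i j := by
  refine measurable_inv_apply (fun i j => ?_) i j
  simp only [kernelMatrix, Matrix.add_apply, Matrix.of_apply]
  exact (h.measurable_kernel_comp ((measurable_pi_apply i).comp hp)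
    ((measurable_pi_apply j).comp hp)).add_const _

lemma measurable_postMean (h : IsGaussianModel ν k ev) (hp : Measurable p) (hy : Measurable y)
    (hx : Measurable x) : Measurable fun u => postMean k σ (p u) (y u) (x u) := by
  simp only [postMean, dotProduct, Matrix.mulVec, kernelVec]
  refine Finset.measurable_sum _ fun i _ => Measurable.mul
    (h.measurable_kernel_comp hx ((measurable_pi_apply i).comp hp))
    (Finset.measurable_sum _ fun j _ => (h.measurable_regInv hp i j).mul
      ((measurable_pi_apply j).comp hy))

lemma measurable_postVar (h : IsGaussianModel ν k ev) (hp : Measurable p) (hx : Measurable x) :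
    Measurable fun u => postVar k σ (p u) (x u) := by
  simp only [postVar, dotProduct, Matrix.mulVec, kernelVec]
  refine (h.measurable_kernel_comp hx hx).sub (Finset.measurable_sum _ fun i _ => Measurable.mul
    (h.measurable_kernel_comp hx ((measurable_pi_apply i).comp hp))
    (Finset.measurable_sum _ fun j _ => (h.measurable_regInv hp i j).mul
      (h.measurable_kernel_comp hx ((measurable_pi_apply j).comp hp))))

end IsGaussianModel

/-- The likelihood of observations `y` at the points `p` of the path `w`. -/
noncomputable def lik (ev : W → S → ℝ) (v : NNReal) (p : Fin n → S) (y : Fin n → ℝ) (w : W) : ℝ≥0∞ :=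
  ∏ i, gaussianPDF (ev w (p i)) v (y i)

/-- The unnormalized posterior distribution of the path. -/
noncomputable def posterior (ν : Measure W) (ev : W → S → ℝ) (v : NNReal) (p : Fin n → S)
    (y : Fin n → ℝ) : Measure W :=
  ν.withDensity (lik ev v p y)

lemma posterior_univ (v : NNReal) (p : Fin n → S) (y : Fin n → ℝ) :
    posterior ν ev v p y Set.univ = evidence ν (fun i w => ev w (p i)) v y := by
  rw [posterior, withDensity_apply _ MeasurableSet.univ, Measure.restrict_univ]
  rfl

instance (v : NNReal) (p : Fin n → S) (y : Fin n → ℝ) : IsFiniteMeasure (posterior ν ev v p y) :=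
  ⟨by rw [posterior_univ]; exact (evidence_ne_top y).lt_top⟩

variable (p : Fin n → S) (y : Fin n → ℝ) {v : NNReal}

/-- Gaussian regression with design p, for every p and y. The posterior is left unnormalized, since
in this form it is a fiber of the joint law. -/
lemma IsGaussianModel.map_posterior (h : IsGaussianModel ν k ev) (hσ : 0 < σ)
    (hv : (v : ℝ) = σ ^ 2) (x : S) :
    (posterior ν ev v p y).map (fun w => ev w x) =
      posterior ν ev v p y Set.univ •
        gaussianReal (postMean k σ p y x) (postVar k σ p x).toNNReal := by
  have hm : ∀ s, Measurable fun w => ev w s := fun s =>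
    h.measurable_eval_comp measurable_id measurable_const
  have hv0 : v ≠ 0 := by
    rintro rfl
    simp only [NNReal.coe_zero] at hv
    exact (pow_pos hσ 2).ne hv
  have hG : HasGaussianLaw (fun w => (fun i => ev w (p i), ev w x)) ν := by
    -- Indexing by `Option (Fin n)` allows repeated design points and x among them.
    have h1 := h.gaussian.comp_right (fun o : Option (Fin n) => o.elim x p)
    have h2 := h1.hasGaussianLaw Finset.univ
    let L : (↥(Finset.univ : Finset (Option (Fin n))) → ℝ) →L[ℝ] (Fin n → ℝ) × ℝ :=
      { toFun z := (fun i => z ⟨some i, Finset.mem_univ _⟩, z ⟨none, Finset.mem_univ _⟩)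
        map_add' _ _ := rfl
        map_smul' _ _ := rfl }
    exact h2.map L
  have := map_withDensity_gaussian (fun i => hm (p i)) (hm x) hG (fun i => h.mean _) (h.mean _)
    (K := fun i j => k (p i) (p j)) (κ := fun i => k x (p i)) (fun i j => h.covariance _ _)
    (fun i => h.covariance _ _) hv0 (a := postCoeff k σ p x) (fun i => by
      rw [hv]
      exact postCoeff_normal_eq h.psd hσ (fun _ => trivial) x i) y
  rw [posterior_univ, postMean_eq h.psd hσ fun _ => trivial, postVar_eq, ← h.covariance x x,
    covariance_self (hm x).aemeasurable]
  exact this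

lemma IsGaussianModel.integral_eval_posterior (h : IsGaussianModel ν k ev) (hσ : 0 < σ)
    (hv : (v : ℝ) = σ ^ 2) (x : S) :
    ∫ w, ev w x ∂posterior ν ev v p y = (posterior ν ev v p y).real Set.univ *
      postMean k σ p y x := by
  have hm : Measurable fun w => ev w x := h.measurable_eval_comp measurable_id measurable_const
  have h1 := integral_map (μ := posterior ν ev v p y) (f := fun u : ℝ => u) hm.aemeasurable
    aestronglyMeasurable_id
  rw [← h1, h.map_posterior p y hσ hv, integral_smul_measure, integral_id_gaussianReal]
  rfl

variable {Q : Measure ℝ} [IsProbabilityMeasure Q] {q : ℝ → S}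

/-- The confidence parameter is independent of the path on a fiber, so the point it selects can be
frozen. -/
lemma IsGaussianModel.integral_eval_prod (h : IsGaussianModel ν k ev) (hσ : 0 < σ)
    (hv : (v : ℝ) = σ ^ 2)
    (hi : Integrable (fun u : ℝ × W => ev u.2 (q u.1)) (Q.prod (posterior ν ev v p y))) :
    ∫ u, ev u.2 (q u.1) ∂Q.prod (posterior ν ev v p y) =
      ∫ u, postMean k σ p y (q u.1) ∂Q.prod (posterior ν ev v p y) := by
  rw [integral_prod _ hi, integral_fun_fst fun z => postMean k σ p y (q z), smul_eq_mul,
    ← integral_const_mul]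
  exact integral_congr_ae (Filter.Eventually.of_forall fun z => h.integral_eval_posterior p y hσ hv (q z))

/-- The posterior mean is a conditional expectation, so its absolute value integrates to no more;
integrability of the objective at the query passes to it. -/
lemma IsGaussianModel.lintegral_postMean_le (h : IsGaussianModel ν k ev) (hσ : 0 < σ)
    (hv : (v : ℝ) = σ ^ 2) (hq : Measurable q) :
    ∫⁻ u, ‖postMean k σ p y (q u.1)‖ₑ ∂Q.prod (posterior ν ev v p y) ≤
      ∫⁻ u, ‖ev u.2 (q u.1)‖ₑ ∂Q.prod (posterior ν ev v p y) := by
  have hm1 : Measurable fun u : ℝ × W => postMean k σ p y (q u.1) :=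
    h.measurable_postMean measurable_const measurable_const (hq.comp measurable_fst)
  have hm2 : Measurable fun u : ℝ × W => ev u.2 (q u.1) :=
    h.measurable_eval_comp measurable_snd (hq.comp measurable_fst)
  rw [lintegral_prod _ hm1.enorm.aemeasurable, lintegral_prod _ hm2.enorm.aemeasurable]
  refine lintegral_mono fun z => ?_
  change ∫⁻ _, ‖postMean k σ p y (q z)‖ₑ ∂posterior ν ev v p y ≤ _
  rw [lintegral_const]
  calc _ = ‖∫ w, ev w (q z) ∂posterior ν ev v p y‖ₑ := by
        rw [h.integral_eval_posterior p y hσ hv, enorm_mul, mul_comm, measureReal_def,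
          Real.enorm_eq_ofReal ENNReal.toReal_nonneg, ENNReal.ofReal_toReal (measure_ne_top _ _)]
    _ ≤ _ := enorm_integral_le_lintegral_enorm _

/-- Normalizing the posterior turns `integral_sup'_le_integral_maxBound` into a statement about one
fiber. -/
lemma IsGaussianModel.integral_sup'_prod_le (h : IsGaussianModel ν k ev) (hσ : 0 < σ)
    (hv : (v : ℝ) = σ ^ 2) {ι : Type*} [Fintype ι] [Nonempty ι] (z : ι → S) {s : ℝ}
    (hs : 2 * Real.log (Fintype.card ι / 2) ≤ s) :
    ∫ u, (Finset.univ.sup' Finset.univ_nonempty fun j => ev u.2 (z j))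
        ∂(shiftedExp s (1 / 2)).prod (posterior ν ev v p y) ≤
      ∫ u, maxBound (fun j => postMean k σ p y (z j)) (fun j => (postVar k σ p (z j)).toNNReal) √u.1
        ∂(shiftedExp s (1 / 2)).prod (posterior ν ev v p y) := by
  have hm : ∀ s, Measurable fun w => ev w s := fun s =>
    h.measurable_eval_comp measurable_id measurable_const
  have hv0 : v ≠ 0 := by
    rintro rfl
    simp only [NNReal.coe_zero] at hv
    exact (pow_pos hσ 2).ne hv
  set κ := posterior ν ev v p y with hκ
  have hc0 : κ Set.univ ≠ 0 := by
    rw [hκ, posterior_univ]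
    exact (evidence_pos hv0 (fun i => hm (p i)) y).ne'
  have hct : κ Set.univ ≠ ∞ := measure_ne_top _ _
  have hprob : IsProbabilityMeasure ((κ Set.univ)⁻¹ • κ) :=
    ⟨by rw [Measure.smul_apply, smul_eq_mul, ENNReal.inv_mul_cancel hc0 hct]⟩
  have hlaw : ∀ j, HasLaw (fun w => ev w (z j))
      (gaussianReal (postMean k σ p y (z j)) (postVar k σ p (z j)).toNNReal)
      ((κ Set.univ)⁻¹ • κ) := fun j =>
    ⟨(hm _).aemeasurable, by
      rw [Measure.map_smul, h.map_posterior p y hσ hv, smul_smul,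
        ENNReal.inv_mul_cancel hc0 hct, one_smul]⟩
  have hdom := integral_sup'_le_integral_maxBound hs hlaw
  rw [integral_smul_measure, smul_eq_mul, ENNReal.toReal_inv, inv_mul_le_iff₀
    (ENNReal.toReal_pos hc0 hct)] at hdom
  rw [integral_fun_snd fun w => Finset.univ.sup' Finset.univ_nonempty fun j => ev w (z j),
    integral_fun_fst fun m => maxBound (fun j => postMean k σ p y (z j))
      (fun j => (postVar k σ p (z j)).toNNReal) √m, probReal_univ, one_smul, smul_eq_mul]
  exact hdom

end Posterior

/-! ### Comparison of integrals fiber by fiber -/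

section Disintegration

variable {H Z W : Type*} [MeasurableSpace H] [MeasurableSpace Z] [MeasurableSpace W]
  {Λ : Measure H} [SFinite Λ] {Q : Measure Z} [IsProbabilityMeasure Q] {ν : Measure W}
  [IsProbabilityMeasure ν] {ℓ : H → W → ℝ≥0∞} {g ψ : H × Z × W → ℝ}

/-- Fubini over the history h, whose fibers carry the unnormalized posteriors. Fiberwise
integrability may be assumed in `hle` because Fubini supplies it for almost every h. -/
lemma integral_le_of_fiberwise (hℓ : Measurable fun u : H × W => ℓ u.1 u.2)
    (hℓt : ∀ h w, ℓ h w ≠ ∞)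
    (hg : Integrable g ((Λ.prod (Q.prod ν)).withDensity fun u => ℓ u.1 u.2.2))
    (hψ : Integrable ψ ((Λ.prod (Q.prod ν)).withDensity fun u => ℓ u.1 u.2.2))
    (hle : ∀ h, Integrable (fun u => g (h, u)) (Q.prod (ν.withDensity (ℓ h))) →
      Integrable (fun u => ψ (h, u)) (Q.prod (ν.withDensity (ℓ h))) →
      ∫ u, g (h, u) ∂Q.prod (ν.withDensity (ℓ h)) ≤ ∫ u, ψ (h, u) ∂Q.prod (ν.withDensity (ℓ h))) :
    ∫ u, g u ∂(Λ.prod (Q.prod ν)).withDensity (fun u => ℓ u.1 u.2.2) ≤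
      ∫ u, ψ u ∂(Λ.prod (Q.prod ν)).withDensity (fun u => ℓ u.1 u.2.2) := by
  have hℓ1 : ∀ h, Measurable (ℓ h) := fun h => hℓ.comp measurable_prodMk_left
  set m : H → W → NNReal := fun h w => (ℓ h w).toNNReal with hm
  have hmℓ : ∀ h w, ℓ h w = m h w := fun h w => (ENNReal.coe_toNNReal (hℓt h w)).symm
  have hmm : Measurable fun u : H × W => m u.1 u.2 := hℓ.ennreal_toNNReal
  have hm3 : Measurable fun u : H × Z × W => m u.1 u.2.2 :=
    hmm.comp (measurable_fst.prodMk (measurable_snd.comp measurable_snd))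
  have hm2 : ∀ h, Measurable fun u : Z × W => m h u.2 := fun h =>
    hmm.comp (measurable_const.prodMk measurable_snd)
  have hfib : ∀ h, Q.prod (ν.withDensity (ℓ h)) =
      (Q.prod ν).withDensity fun u => (m h u.2 : ℝ≥0∞) := fun h => by
    rw [prod_withDensity_right (hℓ1 h)]
    simp only [hmℓ]
  simp only [hmℓ] at hg hψ ⊢
  rw [integrable_withDensity_iff_integrable_smul hm3] at hg hψ
  rw [integral_withDensity_eq_integral_smul hm3, integral_withDensity_eq_integral_smul hm3,
    integral_prod _ hg, integral_prod _ hψ]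
  refine integral_mono_ae hg.integral_prod_left hψ.integral_prod_left ?_
  filter_upwards [hg.prod_right_ae, hψ.prod_right_ae] with h h1 h2
  have := hle h
  rw [hfib h, integral_withDensity_eq_integral_smul (hm2 h),
    integral_withDensity_eq_integral_smul (hm2 h),
    integrable_withDensity_iff_integrable_smul (hm2 h),
    integrable_withDensity_iff_integrable_smul (hm2 h)] at this
  exact this h1 h2

lemma integrable_of_fiberwise (hℓ : Measurable fun u : H × W => ℓ u.1 u.2)
    (hg : Integrable g ((Λ.prod (Q.prod ν)).withDensity fun u => ℓ u.1 u.2.2))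
    (hgm : Measurable g) (hψ : Measurable ψ)
    (hle : ∀ h, ∫⁻ u, ‖ψ (h, u)‖ₑ ∂Q.prod (ν.withDensity (ℓ h)) ≤
      ∫⁻ u, ‖g (h, u)‖ₑ ∂Q.prod (ν.withDensity (ℓ h))) :
    Integrable ψ ((Λ.prod (Q.prod ν)).withDensity fun u => ℓ u.1 u.2.2) := by
  refine ⟨hψ.aestronglyMeasurable, lt_of_le_of_lt ?_ hg.2⟩
  have hℓ3 : Measurable fun u : H × Z × W => ℓ u.1 u.2.2 :=
    hℓ.comp (measurable_fst.prodMk (measurable_snd.comp measurable_snd))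
  have hℓ1 : ∀ h, Measurable (ℓ h) := fun h => hℓ.comp measurable_prodMk_left
  have key : ∀ φ : H × Z × W → ℝ, Measurable φ →
      ∫⁻ u, ‖φ u‖ₑ ∂(Λ.prod (Q.prod ν)).withDensity (fun u => ℓ u.1 u.2.2) =
        ∫⁻ h, ∫⁻ u, ‖φ (h, u)‖ₑ ∂Q.prod (ν.withDensity (ℓ h)) ∂Λ := by
    intro φ hφ
    rw [lintegral_withDensity_eq_lintegral_mul _ hℓ3 hφ.enorm,
      lintegral_prod _ (hℓ3.mul hφ.enorm).aemeasurable]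
    refine lintegral_congr fun h => ?_
    rw [prod_withDensity_right (hℓ1 h),
      lintegral_withDensity_eq_lintegral_mul (f := fun u : Z × W => ℓ h u.2) _
        ((hℓ1 h).comp measurable_snd) (g := fun u => ‖φ (h, u)‖ₑ)
        (hφ.comp measurable_prodMk_left).enorm]
    rfl
  rw [key _ hψ, key _ hgm]
  exact lintegral_mono hle

end Disintegration

end BayesOpt

/-! ### Policies as functions of observations and confidence parameters -/

namespace BayesOpt

section Policy

variable {S : Type*}

/-- The first `t` query points, as a function of the confidence parameters and the observations,
under the policy `sel`. -/
noncomputable def policyPoints (sel : ∀ t : ℕ, (Fin t → S × ℝ) × (Fin (t + 1) → ℝ) → S) (z : ℕ → ℝ) :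
    ∀ t, (Fin t → ℝ) → Fin t → S
  | 0, _ => Fin.elim0
  | t + 1, y => Fin.snoc (α := fun _ => S) (policyPoints sel z t (Fin.init y))
      (sel t (fun i => (policyPoints sel z t (Fin.init y) i, Fin.init (α := fun _ => ℝ) y i),
        fun i => z i))

/-- The query point of round `t` under the policy `sel`. -/
noncomputable def policyQuery (sel : ∀ t : ℕ, (Fin t → S × ℝ) × (Fin (t + 1) → ℝ) → S) (z : ℕ → ℝ)
    (t : ℕ) (y : Fin t → ℝ) : S :=
  sel t (fun i => (policyPoints sel z t y i, y i), fun i => z i)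

variable {sel : ∀ t : ℕ, (Fin t → S × ℝ) × (Fin (t + 1) → ℝ) → S} {z z' : ℕ → ℝ}

lemma policyPoints_succ (t : ℕ) (y : Fin (t + 1) → ℝ) :
    policyPoints sel z (t + 1) y = Fin.snoc (α := fun _ => S) (policyPoints sel z t (Fin.init y))
      (policyQuery sel z t (Fin.init y)) := rfl

lemma policyPoints_congr {t : ℕ} (h : ∀ i < t, z i = z' i) (y : Fin t → ℝ) :
    policyPoints sel z t y = policyPoints sel z' t y := by
  induction t with
  | zero => rfl
  | succ t ih =>
    have h1 := ih (fun i hi => h i (by omega)) (Fin.init y)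
    have h2 : (fun i : Fin (t + 1) => z i) = fun i : Fin (t + 1) => z' i :=
      funext fun i => h i i.isLt
    rw [policyPoints_succ, policyPoints_succ, policyQuery, policyQuery, h1, h2]

lemma policyPoints_eq {x : ℕ → S} {o : ℕ → ℝ}
    (hx : ∀ t, x t = sel t (fun i => (x i, o i), fun i => z i)) (t : ℕ) :
    policyPoints sel z t (fun i => o i) = fun i : Fin t => x i := by
  induction t with
  | zero => exact funext fun i => Fin.elim0 i
  | succ t ih =>
    have h1 : (Fin.init (fun i : Fin (t + 1) => o i) : Fin t → ℝ) = fun i : Fin t => o i := rfl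
    rw [policyPoints_succ, policyQuery, h1, ih, ← hx t]
    funext i
    refine Fin.lastCases ?_ (fun j => ?_) i <;> simp

/-- A run observes the path u at the queries of the policy, so its observations arise from the noise
by the recursion of `adaptiveObs`. -/
lemma adaptiveObs_policyQuery {x : ℕ → S} {o e : ℕ → ℝ} {u : S → ℝ}
    (hx : ∀ t, x t = sel t (fun i => (x i, o i), fun i => z i)) (ho : ∀ t, o t = u (x t) + e t)
    (t : ℕ) :
    adaptiveObs (fun t y => u (policyQuery sel z t y)) t (fun i => e i) = fun i : Fin t => o i := by
  induction t with
  | zero => exact funext fun i => Fin.elim0 i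
  | succ t ih =>
    have h1 : (Fin.init (fun i : Fin (t + 1) => e i) : Fin t → ℝ) = fun i : Fin t => e i := rfl
    have h2 : policyQuery sel z t (fun i => o i) = x t := by
      rw [policyQuery, policyPoints_eq hx, ← hx t]
    simp only [adaptiveObs]
    rw [h1, ih, h2]
    funext i
    refine Fin.lastCases ?_ (fun j => ?_) i
    · simp [ho t]
    · simp

lemma adaptiveObs_congr {q q' : ∀ t, (Fin t → ℝ) → ℝ} {t : ℕ} (h : ∀ n < t, q n = q' n)
    (e : Fin t → ℝ) : adaptiveObs q t e = adaptiveObs q' t e := by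
  induction t with
  | zero => rfl
  | succ t ih =>
    have h1 := ih (fun n hn => h n (by omega)) (Fin.init e)
    simp only [adaptiveObs, h1, h t (by omega)]

/-- Adaptivity leaves no trace in the likelihood: once y is fixed, the selected points are fixed
too, and the factors are those of a nonadaptive design. Hence fixed-design posteriors suffice. -/
lemma adaptiveLik_policyQuery (u : S → ℝ) (v : NNReal) (t : ℕ) (y : Fin t → ℝ) :
    adaptiveLik v (fun t y => u (policyQuery sel z t y)) t y =
      ∏ i, gaussianPDF (u (policyPoints sel z t y i)) v (y i) := by
  induction t with
  | zero => simp [adaptiveLik]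
  | succ t ih =>
    rw [adaptiveLik, ih, Fin.prod_univ_castSucc, policyPoints_succ]
    simp [Fin.init]

variable [MeasurableSpace S]

lemma measurable_policyPoints (hsel : ∀ t, Measurable (sel t)) (t : ℕ) :
    Measurable fun u : (ℕ → ℝ) × (Fin t → ℝ) => policyPoints sel u.1 t u.2 := by
  induction t with
  | zero => exact measurable_pi_iff.2 fun i => i.elim0
  | succ t ih =>
    have h1 : Measurable fun u : (ℕ → ℝ) × (Fin (t + 1) → ℝ) => (Fin.init u.2 : Fin t → ℝ) :=
      (measurable_init t).comp measurable_snd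
    have h2 : Measurable fun u : (ℕ → ℝ) × (Fin (t + 1) → ℝ) =>
        policyPoints sel u.1 t (Fin.init u.2) := ih.comp (measurable_fst.prodMk h1)
    refine (measurable_snoc t).comp (h2.prodMk ((hsel t).comp (Measurable.prodMk ?_ ?_)))
    · exact measurable_pi_iff.2 fun i => ((measurable_pi_apply i).comp h2).prodMk
        ((measurable_pi_apply i).comp h1)
    · exact measurable_pi_iff.2 fun i => (measurable_pi_apply _).comp measurable_fst

lemma measurable_policyQuery (hsel : ∀ t, Measurable (sel t)) (t : ℕ) :
    Measurable fun u : (ℕ → ℝ) × (Fin t → ℝ) => policyQuery sel u.1 t u.2 := by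
  have h2 := measurable_policyPoints hsel t
  refine (hsel t).comp (Measurable.prodMk ?_ ?_)
  · exact measurable_pi_iff.2 fun i => ((measurable_pi_apply i).comp h2).prodMk
      ((measurable_pi_apply i).comp measurable_snd)
  · exact measurable_pi_iff.2 fun i => (measurable_pi_apply _).comp measurable_fst

lemma measurable_adaptiveObs_param {α : Type*} [MeasurableSpace α]
    {q : α → ∀ t, (Fin t → ℝ) → ℝ}
    (hq : ∀ t, Measurable fun u : α × (Fin t → ℝ) => q u.1 t u.2) (t : ℕ) :
    Measurable fun u : α × (Fin t → ℝ) => adaptiveObs (q u.1) t u.2 := by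
  induction t with
  | zero => exact measurable_snd
  | succ t ih =>
    have h : Measurable fun u : α × (Fin (t + 1) → ℝ) => adaptiveObs (q u.1) t (Fin.init u.2) :=
      ih.comp (measurable_fst.prodMk ((measurable_init t).comp measurable_snd))
    exact (measurable_snoc t).comp (h.prodMk (((hq t).comp (measurable_fst.prodMk h)).add
      ((measurable_pi_apply _).comp measurable_snd)))

lemma measurable_adaptiveLik_param {α : Type*} [MeasurableSpace α] (v : NNReal)
    {q : α → ∀ t, (Fin t → ℝ) → ℝ}
    (hq : ∀ t, Measurable fun u : α × (Fin t → ℝ) => q u.1 t u.2) (t : ℕ) :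
    Measurable fun u : α × (Fin t → ℝ) => adaptiveLik v (q u.1) t u.2 := by
  induction t with
  | zero => exact measurable_const
  | succ t ih =>
    have h : Measurable fun u : α × (Fin (t + 1) → ℝ) => (u.1, (Fin.init u.2 : Fin t → ℝ)) :=
      measurable_fst.prodMk ((measurable_init t).comp measurable_snd)
    exact (ih.comp h).mul (measurable_gaussianPDF_comp v ((hq t).comp h)
      ((measurable_pi_apply _).comp measurable_snd))

end Policy

section Laws

/-- The parameter, here standing for confidence variables and path, is independent of the noise and
merely carried along. -/
lemma hasLaw_adaptiveObs {A : Type*} [MeasurableSpace A] {v : NNReal} (hv : v ≠ 0)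
    {q : A → ∀ t, (Fin t → ℝ) → ℝ}
    (hq : ∀ n, Measurable fun u : A × (Fin n → ℝ) => q u.1 n u.2) (t : ℕ) (ρ : Measure A) [SFinite ρ] :
    HasLaw (fun u : (Fin t → ℝ) × A => (adaptiveObs (q u.2) t u.1, u.2))
      (((volume : Measure (Fin t → ℝ)).prod ρ).withDensity fun u => adaptiveLik v (q u.2) t u.1)
      ((Measure.pi fun _ => gaussianReal 0 v).prod ρ) := by
  have hT : Measurable fun u : (Fin t → ℝ) × A => (adaptiveObs (q u.2) t u.1, u.2) :=
    ((measurable_adaptiveObs_param hq t).comp measurable_swap).prodMk measurable_snd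
  have hl : Measurable fun u : (Fin t → ℝ) × A => adaptiveLik v (q u.2) t u.1 :=
    (measurable_adaptiveLik_param v hq t).comp measurable_swap
  refine ⟨hT.aemeasurable, Measure.ext_of_lintegral _ fun φ hφ => ?_⟩
  have hφT : Measurable fun u : (Fin t → ℝ) × A => φ (adaptiveObs (q u.2) t u.1, u.2) := hφ.comp hT
  rw [lintegral_withDensity_eq_lintegral_mul _ hl hφ, lintegral_map hφ hT,
    lintegral_prod_symm _ hφT.aemeasurable, lintegral_prod_symm _ (hl.mul hφ).aemeasurable]
  exact lintegral_congr fun a => lintegral_adaptiveObs hv (q := q a)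
    (fun n => (hq n).comp measurable_prodMk_left) t (φ := fun y => φ (y, a))
    (hφ.comp measurable_prodMk_right)

lemma hasLaw_withDensity_prodAssoc_symm {α β γ : Type*} [MeasurableSpace α] [MeasurableSpace β]
    [MeasurableSpace γ] {μ : Measure α} {μ' : Measure β} {μ'' : Measure γ} [SFinite μ] [SFinite μ']
    [SFinite μ''] {ℓ : (α × β) × γ → ℝ≥0∞} (hℓ : Measurable ℓ) :
    HasLaw (fun u : α × β × γ => ((u.1, u.2.1), u.2.2)) (((μ.prod μ').prod μ'').withDensity ℓ)
      ((μ.prod (μ'.prod μ'')).withDensity fun u => ℓ ((u.1, u.2.1), u.2.2)) := by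
  have hT : Measurable fun u : α × β × γ => ((u.1, u.2.1), u.2.2) := by fun_prop
  refine ⟨hT.aemeasurable, Measure.ext_of_lintegral _ fun φ hφ => ?_⟩
  rw [lintegral_map hφ hT, lintegral_withDensity_eq_lintegral_mul _ hℓ hφ,
    lintegral_withDensity_eq_lintegral_mul (f := fun u : α × β × γ => ℓ ((u.1, u.2.1), u.2.2)) _
      (hℓ.comp hT) (g := fun u : α × β × γ => φ ((u.1, u.2.1), u.2.2)) (hφ.comp hT),
    ← (measurePreserving_prodAssoc μ μ' μ'').symm.lintegral_comp (hℓ.mul hφ)]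
  rfl

end Laws

/-! ### The joint law of history, next confidence parameter and path -/

section Run

/-- The extension by zero of a finite sequence. -/
noncomputable def extendZero {t : ℕ} (z : Fin t → ℝ) (i : ℕ) : ℝ := if h : i < t then z ⟨i, h⟩ else 0

lemma measurable_extendZero (t : ℕ) : Measurable fun z : Fin t → ℝ => extendZero z := by
  refine measurable_pi_iff.2 fun i => ?_
  by_cases h : i < t
  · simp only [extendZero, h, dite_true]
    exact measurable_pi_apply _
  · simp only [extendZero, h, dite_false]
    exact measurable_const

/-- What is known before round `t`: observations and confidence parameters. -/
abbrev Hist (t : ℕ) := (Fin t → ℝ) × (Fin t → ℝ)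

variable {S W Ω : Type*} [MeasurableSpace S] [MeasurableSpace W] [MeasurableSpace Ω]

/-- The first `t` query points as a function of the history. -/
noncomputable def histPoints (sel : ∀ t : ℕ, (Fin t → S × ℝ) × (Fin (t + 1) → ℝ) → S) {t : ℕ} (h : Hist t) :
    Fin t → S :=
  policyPoints sel (extendZero h.2) t h.1

/-- The policy `sel` run on a random path with independent Gaussian noise and independent
confidence parameters. -/
structure IsModelRun (P : Measure Ω) (ν : Measure W) (ev : W → S → ℝ) (v : NNReal)
    (Q : ℕ → Measure ℝ) (sel : ∀ t : ℕ, (Fin t → S × ℝ) × (Fin (t + 1) → ℝ) → S) (F : Ω → W)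
    (ε ζ : ℕ → Ω → ℝ) (x : ℕ → Ω → S) : Prop where
  path_law : HasLaw F ν P
  noise_law : ∀ t, HasLaw (ε t) (gaussianReal 0 v) P
  conf_law : ∀ t, HasLaw (ζ t) (Q t) P
  noise_indep : iIndepFun ε P
  conf_indep : iIndepFun ζ P
  noise_conf_indep : IndepFun (fun ω t => ε t ω) (fun ω t => ζ t ω) P
  path_indep : IndepFun F (fun ω => ((fun t => ε t ω), (fun t => ζ t ω))) P
  measurable_sel : ∀ t, Measurable (sel t)
  query : ∀ᵐ ω ∂P, ∀ t, x t ω = sel t (fun i => (x i ω, ev (F ω) (x i ω) + ε i ω), fun i => ζ i ω)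

variable {P : Measure Ω} [IsProbabilityMeasure P] {ν : Measure W} [IsProbabilityMeasure ν]
  {ev : W → S → ℝ} {v : NNReal} {Q : ℕ → Measure ℝ} [∀ t, IsProbabilityMeasure (Q t)]
  {sel : ∀ t : ℕ, (Fin t → S × ℝ) × (Fin (t + 1) → ℝ) → S} {F : Ω → W} {ε ζ : ℕ → Ω → ℝ}
  {x : ℕ → Ω → S}

namespace IsModelRun

/-- The joint law of history, next confidence parameter, and path. -/
noncomputable def jointLaw (P : Measure Ω) (ν : Measure W) (ev : W → S → ℝ) (v : NNReal)
    (Q : ℕ → Measure ℝ) (sel : ∀ t : ℕ, (Fin t → S × ℝ) × (Fin (t + 1) → ℝ) → S)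
    (ζ : ℕ → Ω → ℝ) (t : ℕ) : Measure (Hist t × ℝ × W) :=
  (((volume : Measure (Fin t → ℝ)).prod (P.map fun ω (i : Fin t) => ζ i ω)).prod ((Q t).prod ν)).withDensity
    fun u => lik ev v (histPoints sel u.1) u.1.1 u.2.2

/-- The independence assumptions are assembled into one product law. The past confidence parameters
keep their image law, as only the law of the next one matters. -/
lemma hasLaw_inputs (h : IsModelRun P ν ev v Q sel F ε ζ x) (t : ℕ) :
    HasLaw (fun ω => ((fun i : Fin t => ε i ω), (fun i : Fin t => ζ i ω), ζ t ω, F ω))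
      ((Measure.pi fun _ => gaussianReal 0 v).prod
        ((P.map fun ω (i : Fin t) => ζ i ω).prod ((Q t).prod ν))) P := by
  have hζm : ∀ i, AEMeasurable (ζ i) P := fun i => (h.conf_law i).aemeasurable
  have hζh : HasLaw (fun ω (i : Fin t) => ζ i ω) (P.map fun ω (i : Fin t) => ζ i ω) P :=
    ⟨aemeasurable_pi_iff.2 fun i => hζm i, rfl⟩
  have := Measure.isProbabilityMeasure_map hζh.aemeasurable
  have hε : HasLaw (fun ω (i : Fin t) => ε i ω) (Measure.pi fun _ => gaussianReal 0 v) P :=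
    iIndepFun.hasLaw_pi (fun i : Fin t => h.noise_law i)
      (h.noise_indep.precomp Fin.val_injective)
  have h1 : IndepFun (fun ω (i : Fin t) => ζ i ω) (ζ t) P := by
    have := h.conf_indep.indepFun_finset₀ (Finset.range t) {t} (by simp) hζm
    exact this.comp (φ := fun u (i : Fin t) => u ⟨i, Finset.mem_range.2 i.isLt⟩)
      (ψ := fun u => u ⟨t, Finset.mem_singleton_self t⟩)
      (measurable_pi_iff.2 fun i => measurable_pi_apply _)
      (measurable_pi_apply (X := fun _ : ({t} : Finset ℕ) => ℝ) ⟨t, Finset.mem_singleton_self t⟩)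
  have l1 := (indepFun_iff_hasLaw_prodMk_prod hζh (h.conf_law t)).1 h1
  have hmz : Measurable fun z : ℕ → ℝ => ((fun i : Fin t => z i), z t) :=
    (measurable_pi_iff.2 fun i => measurable_pi_apply _).prodMk (measurable_pi_apply t)
  have hme : Measurable fun e : ℕ → ℝ => (fun i : Fin t => e i) :=
    measurable_pi_iff.2 fun i => measurable_pi_apply _
  have h2 : IndepFun (fun ω (i : Fin t) => ε i ω) (fun ω => ((fun i : Fin t => ζ i ω), ζ t ω)) P :=
    h.noise_conf_indep.comp hme hmz
  have l2 := (indepFun_iff_hasLaw_prodMk_prod hε l1).1 h2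
  have h3 : IndepFun (fun ω => ((fun i : Fin t => ε i ω), ((fun i : Fin t => ζ i ω), ζ t ω))) F P :=
    h.path_indep.symm.comp ((hme.comp measurable_fst).prodMk (hmz.comp measurable_snd)) measurable_id
  have l3 := (indepFun_iff_hasLaw_prodMk_prod l2 h.path_law).1 h3
  have l4 := (measurePreserving_prodAssoc (Measure.pi fun _ : Fin t => gaussianReal 0 v)
    ((P.map fun ω (i : Fin t) => ζ i ω).prod (Q t)) ν).fun_comp_hasLaw l3
  have l5 := ((MeasurePreserving.id (Measure.pi fun _ : Fin t => gaussianReal 0 v)).prod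
    (measurePreserving_prodAssoc (P.map fun ω (i : Fin t) => ζ i ω) (Q t) ν)).fun_comp_hasLaw l4
  exact l5

lemma measurable_histPoints (h : IsModelRun P ν ev v Q sel F ε ζ x) (t : ℕ) :
    Measurable fun u : Hist t => histPoints sel u :=
  (measurable_policyPoints h.measurable_sel t).comp
    (((measurable_extendZero t).comp measurable_snd).prodMk measurable_fst)

lemma measurable_lik (h : IsModelRun P ν ev v Q sel F ε ζ x)
    (hev : Measurable fun u : W × S => ev u.1 u.2) {t : ℕ} {α : Type*} [MeasurableSpace α]
    {a : α → Hist t} {w : α → W} (ha : Measurable a) (hw : Measurable w) :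
    Measurable fun u => lik ev v (histPoints sel (a u)) (a u).1 (w u) := by
  refine measurable_prod_gaussianPDF (fun i => ?_) fun i =>
    (measurable_pi_apply i).comp (measurable_fst.comp ha)
  exact hev.comp (hw.prodMk ((measurable_pi_apply i).comp ((h.measurable_histPoints t).comp ha)))

lemma histPoints_ae (h : IsModelRun P ν ev v Q sel F ε ζ x) (t : ℕ) :
    ∀ᵐ ω ∂P, histPoints sel ((fun i : Fin t => ev (F ω) (x i ω) + ε i ω), fun i : Fin t => ζ i ω) =
      fun i : Fin t => x i ω := by
  filter_upwards [h.query] with ω hω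
  have h1 := policyPoints_eq (z := fun i => ζ i ω) (x := fun i => x i ω)
    (o := fun i => ev (F ω) (x i ω) + ε i ω) hω t
  rw [← h1]
  exact policyPoints_congr (fun i hi => by simp [extendZero, hi]) _

/-- The independent inputs are pushed through the map from noise to observations, whose density is
the adaptive likelihood, here equal to that of a fixed design. -/
lemma hasLaw_joint (h : IsModelRun P ν ev v Q sel F ε ζ x) (hv : v ≠ 0)
    (hev : Measurable fun u : W × S => ev u.1 u.2) (t : ℕ) :
    HasLaw (fun ω => ((((fun i : Fin t => ev (F ω) (x i ω) + ε i ω), fun i : Fin t => ζ i ω), ζ t ω,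
      F ω) : Hist t × ℝ × W)) (jointLaw P ν ev v Q sel ζ t) P := by
  have hin := h.hasLaw_inputs t
  have hζh : AEMeasurable (fun ω (i : Fin t) => ζ i ω) P :=
    aemeasurable_pi_iff.2 fun i => (h.conf_law i).aemeasurable
  have := Measure.isProbabilityMeasure_map hζh
  have hq : ∀ n, Measurable fun u : ((Fin t → ℝ) × ℝ × W) × (Fin n → ℝ) =>
      ev u.1.2.2 (policyQuery sel (extendZero u.1.1) n u.2) := fun n =>
    hev.comp ((measurable_snd.comp (measurable_snd.comp measurable_fst)).prodMk
      ((measurable_policyQuery h.measurable_sel n).comp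
        (((measurable_extendZero t).comp (measurable_fst.comp measurable_fst)).prodMk measurable_snd)))
  have l1 := hasLaw_adaptiveObs hv (q := fun a n y =>
    ev a.2.2 (policyQuery sel (extendZero a.1) n y)) hq t
    ((P.map fun ω (i : Fin t) => ζ i ω).prod ((Q t).prod ν))
  have l2 := l1.comp hin
  have hl3 : Measurable fun u : Hist t × ℝ × W => lik ev v (histPoints sel u.1) u.1.1 u.2.2 :=
    h.measurable_lik hev (a := fun u : Hist t × ℝ × W => u.1) (w := fun u => u.2.2) measurable_fst
      (measurable_snd.comp measurable_snd)
  have hd : (fun u : (Fin t → ℝ) × (Fin t → ℝ) × ℝ × W => adaptiveLik v (fun n y =>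
      ev u.2.2.2 (policyQuery sel (extendZero u.2.1) n y)) t u.1) =
      fun u => lik ev v (histPoints sel ((u.1, u.2.1) : Hist t)) u.1 u.2.2.2 :=
    funext fun u => adaptiveLik_policyQuery (z := extendZero u.2.1) (ev u.2.2.2) v t u.1
  rw [hd] at l2
  have l3 := hasLaw_withDensity_prodAssoc_symm (μ := volume)
    (μ' := P.map fun ω (i : Fin t) => ζ i ω) (μ'' := (Q t).prod ν) hl3
  have l4 := l3.comp l2
  refine HasLaw.congr l4 ?_
  filter_upwards [h.query] with ω hω
  have h1 := adaptiveObs_policyQuery (z := fun i => ζ i ω) (x := fun i => x i ω)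
    (o := fun i => ev (F ω) (x i ω) + ε i ω) (e := fun i => ε i ω) (u := ev (F ω)) hω
    (fun _ => rfl) t
  -- The queries before round t read only the confidence parameters before round t, so these may be
  -- extended by zero.
  have h2 : adaptiveObs (fun n y => ev (F ω) (policyQuery sel (extendZero fun i : Fin t => ζ i ω) n y))
      t (fun i => ε i ω) = adaptiveObs (fun n y => ev (F ω) (policyQuery sel (fun i => ζ i ω) n y)) t
        (fun i => ε i ω) := by
    refine adaptiveObs_congr (fun n hn => funext fun y => ?_) _
    have h3 : ∀ i < t, extendZero (fun i : Fin t => ζ i ω) i = ζ i ω := fun i hi => by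
      simp [extendZero, hi]
    have h4 : policyPoints sel (extendZero fun i : Fin t => ζ i ω) n y =
        policyPoints sel (fun i => ζ i ω) n y := policyPoints_congr (fun i hi => h3 i (hi.trans hn)) y
    have h5 : (fun i : Fin (n + 1) => extendZero (fun i : Fin t => ζ i ω) i) =
        fun i : Fin (n + 1) => ζ i ω := funext fun i => h3 i (by omega)
    simp only [policyQuery, h4, h5]
  rw [h1] at h2
  exact congrArg (fun y => (((y, fun i : Fin t => ζ i ω), ζ t ω, F ω) : Hist t × ℝ × W)) h2.symm

end IsModelRun

end Run

end BayesOpt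

/-! ### The gap of one round -/

namespace BayesOpt

section Round

variable {S W Ω : Type*} [MeasurableSpace S] [MeasurableSpace W] [MeasurableSpace Ω]

/-- The history before round `t`. -/
def runHist (ev : W → S → ℝ) (F : Ω → W) (ε ζ : ℕ → Ω → ℝ) (x : ℕ → Ω → S) (t : ℕ) (ω : Ω) : Hist t :=
  ((fun i => ev (F ω) (x i ω) + ε i ω), fun i => ζ i ω)

/-- The query point of round `t` as a function of history and confidence parameter. -/
noncomputable def histQuery (sel : ∀ t : ℕ, (Fin t → S × ℝ) × (Fin (t + 1) → ℝ) → S) {t : ℕ}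
    (u : Hist t × ℝ) : S :=
  sel t (fun i => (histPoints sel u.1 i, u.1.1 i), Fin.snoc (α := fun _ => ℝ) u.1.2 u.2)

variable {P : Measure Ω} [IsProbabilityMeasure P] {ν : Measure W} [IsProbabilityMeasure ν]
  {ev : W → S → ℝ} {v : NNReal} {Q : ℕ → Measure ℝ} [∀ t, IsProbabilityMeasure (Q t)]
  {sel : ∀ t : ℕ, (Fin t → S × ℝ) × (Fin (t + 1) → ℝ) → S} {F : Ω → W} {ε ζ : ℕ → Ω → ℝ}
  {x : ℕ → Ω → S} {k : S → S → ℝ} {σ : ℝ}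

lemma measurable_sup'_univ {ι α : Type*} [Fintype ι] [Nonempty ι] [MeasurableSpace α] {f : ι → α → ℝ}
    (hf : ∀ j, Measurable (f j)) :
    Measurable fun u => Finset.univ.sup' Finset.univ_nonempty fun j => f j u := by
  have := Finset.measurable_sup' (s := Finset.univ) Finset.univ_nonempty fun j _ => hf j
  convert this using 1
  funext u
  simp [Finset.sup'_apply]

lemma lik_ne_top (v : NNReal) {n : ℕ} (p : Fin n → S) (y : Fin n → ℝ) (w : W) :
    lik ev v p y w ≠ ∞ :=
  ENNReal.prod_ne_top fun _ _ => gaussianPDF_ne_top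

attribute [local irreducible] lik histPoints

namespace IsModelRun

lemma measurable_histQuery (h : IsModelRun P ν ev v Q sel F ε ζ x) (t : ℕ) :
    Measurable fun u : Hist t × ℝ => histQuery sel u := by
  refine (h.measurable_sel t).comp (Measurable.prodMk ?_ ?_)
  · exact measurable_pi_iff.2 fun i =>
      ((measurable_pi_apply i).comp ((h.measurable_histPoints t).comp measurable_fst)).prodMk
        ((measurable_pi_apply i).comp (measurable_fst.comp measurable_fst))
  · exact (measurable_snoc t).comp ((measurable_snd.comp measurable_fst).prodMk measurable_snd)

lemma histPoints_runHist_ae (h : IsModelRun P ν ev v Q sel F ε ζ x) (t : ℕ) :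
    ∀ᵐ ω ∂P, histPoints sel (runHist ev F ε ζ x t ω) = fun i : Fin t => x i ω :=
  h.histPoints_ae t

lemma histQuery_runHist_ae (h : IsModelRun P ν ev v Q sel F ε ζ x) (t : ℕ) :
    ∀ᵐ ω ∂P, histQuery sel (runHist ev F ε ζ x t ω, ζ t ω) = x t ω := by
  filter_upwards [h.query, h.histPoints_runHist_ae t] with ω h1 h2
  rw [h1 t, histQuery, h2]
  congr 2
  funext i
  refine Fin.lastCases ?_ (fun j => ?_) i <;> simp [runHist]

variable {t : ℕ}

lemma hasLaw_runHist (h : IsModelRun P ν ev v Q sel F ε ζ x) (hM : IsGaussianModel ν k ev)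
    (hv : v ≠ 0) (t : ℕ) : HasLaw (fun ω => (runHist ev F ε ζ x t ω, ζ t ω, F ω))
      (jointLaw P ν ev v Q sel ζ t) P :=
  h.hasLaw_joint hv hM.measurable_eval t

lemma isProbabilityMeasure_map_conf (h : IsModelRun P ν ev v Q sel F ε ζ x) (t : ℕ) :
    IsProbabilityMeasure (P.map fun ω (i : Fin t) => ζ i ω) :=
  Measure.isProbabilityMeasure_map (aemeasurable_pi_iff.2 fun i => (h.conf_law i).aemeasurable)

/-- The expected value of the objective at a point chosen from the history is the expected
posterior mean. -/
lemma integral_eval_eq (h : IsModelRun P ν ev v Q sel F ε ζ x) (hM : IsGaussianModel ν k ev)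
    (hσ : 0 < σ) (hv : (v : ℝ) = σ ^ 2) {q : Hist t × ℝ → S} (hq : Measurable q)
    (hi : Integrable (fun ω => ev (F ω) (q (runHist ev F ε ζ x t ω, ζ t ω))) P) :
    Integrable (fun ω => postMean k σ (histPoints sel (runHist ev F ε ζ x t ω))
        (runHist ev F ε ζ x t ω).1 (q (runHist ev F ε ζ x t ω, ζ t ω))) P ∧
      ∫ ω, ev (F ω) (q (runHist ev F ε ζ x t ω, ζ t ω)) ∂P =
        ∫ ω, postMean k σ (histPoints sel (runHist ev F ε ζ x t ω))
          (runHist ev F ε ζ x t ω).1 (q (runHist ev F ε ζ x t ω, ζ t ω)) ∂P := by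
  have hv0 : v ≠ 0 := by
    rintro rfl
    simp only [NNReal.coe_zero] at hv
    exact (pow_pos hσ 2).ne hv
  have := h.isProbabilityMeasure_map_conf t
  have law := h.hasLaw_runHist hM hv0 t
  let g : Hist t × ℝ × W → ℝ := fun u => ev u.2.2 (q (u.1, u.2.1))
  let ψ : Hist t × ℝ × W → ℝ := fun u =>
    postMean k σ (histPoints sel u.1) u.1.1 (q (u.1, u.2.1))
  have hq3 : Measurable fun u : Hist t × ℝ × W => q (u.1, u.2.1) :=
    hq.comp (measurable_fst.prodMk (measurable_fst.comp measurable_snd))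
  have hg : Measurable g := hM.measurable_eval_comp (measurable_snd.comp measurable_snd) hq3
  have hψ : Measurable ψ := hM.measurable_postMean ((h.measurable_histPoints t).comp measurable_fst)
    (measurable_fst.comp measurable_fst) hq3
  have hℓ : Measurable fun u : Hist t × W => lik ev v (histPoints sel u.1) u.1.1 u.2 :=
    h.measurable_lik hM.measurable_eval (a := fun u : Hist t × W => u.1) (w := fun u => u.2)
      measurable_fst measurable_snd
  have hℓt : ∀ (u : Hist t) (w : W), lik ev v (histPoints sel u) u.1 w ≠ ∞ := fun u w =>
    lik_ne_top _ _ _ _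
  have hgi : Integrable g (jointLaw P ν ev v Q sel ζ t) := by
    rw [← law.map_eq, integrable_map_measure hg.aestronglyMeasurable law.aemeasurable]
    exact hi
  have hψi : Integrable ψ (jointLaw P ν ev v Q sel ζ t) :=
    integrable_of_fiberwise (ℓ := fun (u : Hist t) w => lik ev v (histPoints sel u) u.1 w) hℓ hgi hg hψ fun u => hM.lintegral_postMean_le (Q := Q t)
      (histPoints sel u) u.1 hσ hv (q := fun z => q (u, z)) (hq.comp measurable_prodMk_left)
  have heq : ∫ u, g u ∂jointLaw P ν ev v Q sel ζ t = ∫ u, ψ u ∂jointLaw P ν ev v Q sel ζ t :=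
    -- The fiberwise integrals agree, so the comparison applies in both directions.
    le_antisymm
      (integral_le_of_fiberwise (ℓ := fun (u : Hist t) w => lik ev v (histPoints sel u) u.1 w) hℓ hℓt hgi hψi fun u h1 _ =>
        (hM.integral_eval_prod (Q := Q t) (histPoints sel u) u.1 hσ hv (q := fun z => q (u, z)) h1).le)
      (integral_le_of_fiberwise (ℓ := fun (u : Hist t) w => lik ev v (histPoints sel u) u.1 w) hℓ hℓt hψi hgi fun u _ h1 =>
        (hM.integral_eval_prod (Q := Q t) (histPoints sel u) u.1 hσ hv (q := fun z => q (u, z)) h1).ge)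
  refine ⟨?_, ?_⟩
  · rw [← law.map_eq, integrable_map_measure hψ.aestronglyMeasurable law.aemeasurable] at hψi
    exact hψi
  · rw [← law.integral_comp hg.aestronglyMeasurable, ← law.integral_comp hψ.aestronglyMeasurable]
      at heq
    exact heq

lemma integrable_eval (h : IsModelRun P ν ev v Q sel F ε ζ x) (hM : IsGaussianModel ν k ev) (s : S) :
    Integrable (fun ω => ev (F ω) s) P := by
  have h1 := (hM.gaussian.hasGaussianLaw_eval s).integrable
  rw [← h.path_law.map_eq] at h1
  exact (integrable_map_measure (hM.measurable_eval_comp measurable_id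
    measurable_const).aestronglyMeasurable h.path_law.aemeasurable).1 h1

/-- The expected maximum of the objective over a finite set is at most the expected maximum of the
randomized upper confidence bounds. -/
lemma integral_sup'_le (h : IsModelRun P ν ev v Q sel F ε ζ x) (hM : IsGaussianModel ν k ev)
    (hσ : 0 < σ) (hv : (v : ℝ) = σ ^ 2) {ι : Type*} [Fintype ι] [Nonempty ι] (z : ι → S) {s : ℝ}
    (hQ : Q t = shiftedExp s (1 / 2)) (hs : 2 * Real.log (Fintype.card ι / 2) ≤ s)
    (hi : Integrable (fun ω => maxBound
      (fun j => postMean k σ (histPoints sel (runHist ev F ε ζ x t ω)) (runHist ev F ε ζ x t ω).1 (z j))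
      (fun j => (postVar k σ (histPoints sel (runHist ev F ε ζ x t ω)) (z j)).toNNReal)
      √(ζ t ω)) P) :
    ∫ ω, (Finset.univ.sup' Finset.univ_nonempty fun j => ev (F ω) (z j)) ∂P ≤
      ∫ ω, maxBound
        (fun j => postMean k σ (histPoints sel (runHist ev F ε ζ x t ω)) (runHist ev F ε ζ x t ω).1 (z j))
        (fun j => (postVar k σ (histPoints sel (runHist ev F ε ζ x t ω)) (z j)).toNNReal)
        √(ζ t ω) ∂P := by
  have hv0 : v ≠ 0 := by
    rintro rfl
    simp only [NNReal.coe_zero] at hv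
    exact (pow_pos hσ 2).ne hv
  have := h.isProbabilityMeasure_map_conf t
  have law := h.hasLaw_runHist hM hv0 t
  let g : Hist t × ℝ × W → ℝ := fun u =>
    Finset.univ.sup' Finset.univ_nonempty fun j => ev u.2.2 (z j)
  let ψ : Hist t × ℝ × W → ℝ := fun u => maxBound
    (fun j => postMean k σ (histPoints sel u.1) u.1.1 (z j))
    (fun j => (postVar k σ (histPoints sel u.1) (z j)).toNNReal) √u.2.1
  have hg : Measurable g := measurable_sup'_univ fun j =>
    hM.measurable_eval_comp (measurable_snd.comp measurable_snd) measurable_const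
  have hp := (h.measurable_histPoints t).comp (measurable_fst : Measurable fun u : Hist t × ℝ × W => u.1)
  have hψ : Measurable ψ := measurable_sup'_univ fun j =>
    (hM.measurable_postMean hp (measurable_fst.comp measurable_fst) measurable_const).add
      ((Real.continuous_sqrt.measurable.comp (measurable_fst.comp measurable_snd)).mul
        (Real.continuous_sqrt.measurable.comp
          (hM.measurable_postVar hp measurable_const).real_toNNReal.coe_nnreal_real))
  have hℓ : Measurable fun u : Hist t × W => lik ev v (histPoints sel u.1) u.1.1 u.2 :=
    h.measurable_lik hM.measurable_eval (a := fun u : Hist t × W => u.1) (w := fun u => u.2)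
      measurable_fst measurable_snd
  have hℓt : ∀ (u : Hist t) (w : W), lik ev v (histPoints sel u) u.1 w ≠ ∞ := fun u w =>
    lik_ne_top _ _ _ _
  have hgi : Integrable g (jointLaw P ν ev v Q sel ζ t) := by
    rw [← law.map_eq, integrable_map_measure hg.aestronglyMeasurable law.aemeasurable]
    exact integrable_sup' fun j => h.integrable_eval hM (z j)
  have hψi : Integrable ψ (jointLaw P ν ev v Q sel ζ t) := by
    rw [← law.map_eq, integrable_map_measure hψ.aestronglyMeasurable law.aemeasurable]
    exact hi
  have heq : ∫ u, g u ∂jointLaw P ν ev v Q sel ζ t ≤ ∫ u, ψ u ∂jointLaw P ν ev v Q sel ζ t :=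
    integral_le_of_fiberwise (ℓ := fun (u : Hist t) w => lik ev v (histPoints sel u) u.1 w) hℓ hℓt hgi hψi fun u _ _ => by
      rw [hQ]
      exact hM.integral_sup'_prod_le (histPoints sel u) u.1 hσ hv z hs
  rw [← law.integral_comp hg.aestronglyMeasurable, ← law.integral_comp hψ.aestronglyMeasurable]
    at heq
  exact heq

/-- Posterior deviations are at most 1, so √ζ_t dominates. -/
lemma integrable_width (h : IsModelRun P ν ev v Q sel F ε ζ x) (hM : IsGaussianModel ν k ev)
    (hσ : 0 < σ) (hv : v ≠ 0) (hk1 : ∀ s, k s s ≤ 1) {s : ℝ} (hQ : Q t = shiftedExp s (1 / 2)) :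
    Integrable (fun ω => √(ζ t ω) * √(postVar k σ (fun i : Fin t => x i ω) (x t ω))) P := by
  have law := h.hasLaw_runHist hM hv t
  have hm : Measurable fun u : Hist t × ℝ × W =>
      √u.2.1 * √(postVar k σ (histPoints sel u.1) (histQuery sel (u.1, u.2.1))) :=
    (Real.continuous_sqrt.measurable.comp (measurable_fst.comp measurable_snd)).mul
      (Real.continuous_sqrt.measurable.comp
        (hM.measurable_postVar ((h.measurable_histPoints t).comp measurable_fst)
          ((h.measurable_histQuery t).comp
            (measurable_fst.prodMk (measurable_fst.comp measurable_snd)))))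
  have hae : AEStronglyMeasurable
      (fun ω => √(ζ t ω) * √(postVar k σ (fun i : Fin t => x i ω) (x t ω))) P := by
    refine (hm.comp_aemeasurable law.aemeasurable).aestronglyMeasurable.congr ?_
    filter_upwards [h.histPoints_runHist_ae t, h.histQuery_runHist_ae t] with ω h1 h2
    simp only [Function.comp_apply, h1, h2]
  have hζ : Integrable (fun ω => √(ζ t ω)) P := by
    have h1 := integrable_sqrt_shiftedExp s
    rw [← hQ, ← (h.conf_law t).map_eq] at h1
    exact (integrable_map_measure Real.continuous_sqrt.measurable.aestronglyMeasurable
      (h.conf_law t).aemeasurable).1 h1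
  refine hζ.mono' hae (Filter.Eventually.of_forall fun ω => ?_)
  rw [Real.norm_eq_abs, abs_of_nonneg (by positivity)]
  refine mul_le_of_le_one_right (Real.sqrt_nonneg _) (Real.sqrt_le_one.2 ?_)
  exact (postVar_le hM.psd hσ (fun _ => trivial) _).trans (hk1 _)

/-- In one round, the expected gap between the maximum of the objective over a finite set and its
value at the query point is at most the expected width of the confidence bound. -/
lemma integral_gap_le (h : IsModelRun P ν ev v Q sel F ε ζ x) (hM : IsGaussianModel ν k ev)
    (hσ : 0 < σ) (hv : (v : ℝ) = σ ^ 2) (hk1 : ∀ s, k s s ≤ 1) {ι : Type*} [Fintype ι] [Nonempty ι]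
    (z : ι → S) {s : ℝ} (hQ : Q t = shiftedExp s (1 / 2))
    (hs : 2 * Real.log (Fintype.card ι / 2) ≤ s)
    (hi : Integrable (fun ω => ev (F ω) (x t ω)) P)
    (hmax : ∀ᵐ ω ∂P, ∀ j, ucb k σ (fun i : Fin t => x i ω)
        (fun i : Fin t => ev (F ω) (x i ω) + ε i ω) (ζ t ω) (z j) ≤
      ucb k σ (fun i : Fin t => x i ω) (fun i : Fin t => ev (F ω) (x i ω) + ε i ω) (ζ t ω)
        (x t ω)) :
    ∫ ω, (Finset.univ.sup' Finset.univ_nonempty fun j => ev (F ω) (z j)) ∂P -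
        ∫ ω, ev (F ω) (x t ω) ∂P ≤
      ∫ ω, √(ζ t ω) * √(postVar k σ (fun i : Fin t => x i ω) (x t ω)) ∂P := by
  have hv0 : v ≠ 0 := by
    rintro rfl
    simp only [NNReal.coe_zero] at hv
    exact (pow_pos hσ 2).ne hv
  have hpts := h.histPoints_runHist_ae t
  have hqry := h.histQuery_runHist_ae t
  have hwi := h.integrable_width hM hσ hv0 hk1 hQ
  have law := h.hasLaw_runHist hM hv0 t
  obtain ⟨hm1, hm2⟩ := h.integral_eval_eq hM hσ hv (h.measurable_histQuery t) (hi.congr (by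
    filter_upwards [hqry] with ω h1
    rw [h1]))
  have hmz : ∀ j, Integrable (fun ω => postMean k σ (histPoints sel (runHist ev F ε ζ x t ω))
      (runHist ev F ε ζ x t ω).1 (z j)) P := fun j =>
    (h.integral_eval_eq hM hσ hv (q := fun _ => z j) measurable_const (h.integrable_eval hM _)).1
  set A : Ω → ℝ := fun ω => maxBound
      (fun j => postMean k σ (histPoints sel (runHist ev F ε ζ x t ω)) (runHist ev F ε ζ x t ω).1 (z j))
      (fun j => (postVar k σ (histPoints sel (runHist ev F ε ζ x t ω)) (z j)).toNNReal)
      √(ζ t ω) with hA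
  -- The query maximizes the acquisition function, so its value there dominates the bounds at the
  -- finitely many points.
  have hup : ∀ᵐ ω ∂P, A ω ≤ postMean k σ (histPoints sel (runHist ev F ε ζ x t ω))
      (runHist ev F ε ζ x t ω).1 (histQuery sel (runHist ev F ε ζ x t ω, ζ t ω)) +
      √(ζ t ω) * √(postVar k σ (fun i : Fin t => x i ω) (x t ω)) := by
    filter_upwards [hpts, hqry, hmax] with ω h1 h2 h3
    rw [h1, h2]
    refine Finset.sup'_le _ _ fun j _ => ?_
    rw [h1, Real.coe_toNNReal _ (postVar_nonneg hM.psd hσ (fun _ => trivial) trivial)]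
    exact h3 j
  have hlow : ∀ ω, ∀ j, postMean k σ (histPoints sel (runHist ev F ε ζ x t ω))
      (runHist ev F ε ζ x t ω).1 (z j) ≤ A ω := fun ω j =>
    (le_add_of_nonneg_right (by positivity)).trans (Finset.le_sup' (fun j =>
      postMean k σ (histPoints sel (runHist ev F ε ζ x t ω)) (runHist ev F ε ζ x t ω).1 (z j) +
        √(ζ t ω) * √((postVar k σ (histPoints sel (runHist ev F ε ζ x t ω)) (z j)).toNNReal : ℝ))
      (Finset.mem_univ j))
  have hAm : AEStronglyMeasurable A P := by
    have hp := (h.measurable_histPoints t).comp (measurable_fst : Measurable fun u : Hist t × ℝ × W => u.1)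
    have hψ : Measurable fun u : Hist t × ℝ × W => maxBound
        (fun j => postMean k σ (histPoints sel u.1) u.1.1 (z j))
        (fun j => (postVar k σ (histPoints sel u.1) (z j)).toNNReal) √u.2.1 :=
      measurable_sup'_univ fun j =>
        (hM.measurable_postMean hp (measurable_fst.comp measurable_fst) measurable_const).add
          ((Real.continuous_sqrt.measurable.comp (measurable_fst.comp measurable_snd)).mul
            (Real.continuous_sqrt.measurable.comp
              (hM.measurable_postVar hp measurable_const).real_toNNReal.coe_nnreal_real))
    exact (hψ.comp_aemeasurable law.aemeasurable).aestronglyMeasurable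
  -- A lies between the posterior mean at one of the points and the acquisition value at the query,
  -- both integrable.
  have hAi : Integrable A P := by
    obtain ⟨j⟩ := ‹Nonempty ι›
    refine ((hmz j).abs.add (hm1.abs.add hwi)).mono' hAm ?_
    filter_upwards [hup] with ω h1
    have h2 := hlow ω j
    have h3 : 0 ≤ √(ζ t ω) * √(postVar k σ (fun i : Fin t => x i ω) (x t ω)) := by positivity
    simp only [Pi.add_apply, Real.norm_eq_abs]
    refine abs_le.2 ⟨?_, ?_⟩
    · linarith [neg_abs_le (postMean k σ (histPoints sel (runHist ev F ε ζ x t ω))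
        (runHist ev F ε ζ x t ω).1 (z j)), abs_nonneg (postMean k σ (histPoints sel
        (runHist ev F ε ζ x t ω)) (runHist ev F ε ζ x t ω).1
        (histQuery sel (runHist ev F ε ζ x t ω, ζ t ω)))]
    · linarith [abs_nonneg (postMean k σ (histPoints sel (runHist ev F ε ζ x t ω))
        (runHist ev F ε ζ x t ω).1 (z j)), le_abs_self (postMean k σ (histPoints sel
        (runHist ev F ε ζ x t ω)) (runHist ev F ε ζ x t ω).1
        (histQuery sel (runHist ev F ε ζ x t ω, ζ t ω)))]
  have h1 := h.integral_sup'_le hM hσ hv z hQ hs hAi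
  have h2 := (integral_mono_ae hAi (hm1.add hwi) hup).trans_eq (integral_add hm1 hwi)
  rw [← hm2] at h2
  have h3 : ∫ ω, ev (F ω) (histQuery sel (runHist ev F ε ζ x t ω, ζ t ω)) ∂P =
      ∫ ω, ev (F ω) (x t ω) ∂P := integral_congr_ae (by
    filter_upwards [hqry] with ω h1
    rw [h1])
  rw [h3] at h2
  linarith

/-- The first query is made without information, so the objective has mean zero there. -/
lemma integral_eval_zero (h : IsModelRun P ν ev v Q sel F ε ζ x) (hM : IsGaussianModel ν k ev)
    (hσ : 0 < σ) (hv : (v : ℝ) = σ ^ 2) (hi : Integrable (fun ω => ev (F ω) (x 0 ω)) P) :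
    ∫ ω, ev (F ω) (x 0 ω) ∂P = 0 := by
  have hqry := h.histQuery_runHist_ae 0
  have h1 : (fun ω => ev (F ω) (x 0 ω)) =ᵐ[P]
      fun ω => ev (F ω) (histQuery sel (runHist ev F ε ζ x 0 ω, ζ 0 ω)) := by
    filter_upwards [hqry] with ω h1
    rw [h1]
  rw [integral_congr_ae h1,
    (h.integral_eval_eq hM hσ hv (h.measurable_histQuery 0) (hi.congr h1)).2]
  -- Without data the posterior mean is an empty sum.
  simp [postMean, dotProduct]

end IsModelRun

end Round

end BayesOpt

/-! ### From the given process to a random element of path space -/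

namespace BayesOpt

section Paths

variable {d : ℕ} {Ω : Type*} [MeasurableSpace Ω] {P : Measure Ω} {X : Set (Pt d)}
  {f : Pt d → Ω → ℝ}

/-- Continuous functions on `X`, with the σ-algebra generated by the evaluations. -/
abbrev PathSpace {d : ℕ} (X : Set (Pt d)) := {w : X → ℝ // Continuous w}

/-- A function continuous in the point and measurable in the path is jointly measurable on the
separable space X. -/
lemma measurable_eval_pathSpace :
    Measurable fun u : PathSpace X × X => u.1.1 u.2 := by
  have h := measurable_uncurry_of_continuous_of_measurable (u := fun (s : X) (w : PathSpace X) => w.1 s)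
    (fun w => w.2) fun s => (measurable_pi_apply s).comp measurable_subtype_coe
  exact h.comp measurable_swap

/-- Paths are continuous only almost surely and values measurable only up to null sets. Setting the
path to 0 on a measurable null set repairs both, and limits along a dense sequence give
measurability at every point. -/
lemma exists_measurable_path (hf : ∀ s : X, AEMeasurable (f s) P)
    (hc : ∀ᵐ ω ∂P, ContinuousOn (fun s => f s ω) X) :
    ∃ F : Ω → PathSpace X, Measurable F ∧ ∀ᵐ ω ∂P, ∀ s : X, (F ω).1 s = f s ω := by
  classical
  rcases isEmpty_or_nonempty X with he | hne
  · exact ⟨fun _ => ⟨fun s => he.elim s, continuous_of_const fun s => he.elim s⟩, measurable_const,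
      Filter.Eventually.of_forall fun ω s => he.elim s⟩
  obtain ⟨q, hq⟩ := TopologicalSpace.exists_dense_seq X
  have hgood : ∀ᵐ ω ∂P, Continuous (fun s : X => f s ω) ∧ ∀ n, f (q n) ω = (hf (q n)).mk _ ω := by
    filter_upwards [hc, ae_all_iff.2 fun n => (hf (q n)).ae_eq_mk] with ω h1 h2
    exact ⟨h1.domRestrict, h2⟩
  obtain ⟨N, hN, hNm, hN0⟩ := exists_measurable_superset_of_null hgood
  have hmem : ∀ ω, ω ∉ N → Continuous (fun s : X => f s ω) ∧ ∀ n, f (q n) ω = (hf (q n)).mk _ ω :=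
    fun ω hω => by
      by_contra hcon
      exact hω (hN hcon)
  let F : Ω → PathSpace X := fun ω =>
    if hω : ω ∈ N then ⟨fun _ => 0, continuous_const⟩ else ⟨fun s => f s ω, (hmem ω hω).1⟩
  have hFq : ∀ n, Measurable fun ω => (F ω).1 (q n) := by
    intro n
    have : (fun ω => (F ω).1 (q n)) = Nᶜ.indicator ((hf (q n)).mk _) := by
      funext ω
      by_cases hω : ω ∈ N
      · simp [F, hω]
      · simp [F, hω, (hmem ω hω).2 n]
    rw [this]
    exact (hf (q n)).measurable_mk.indicator hNm.compl
  have hFs : ∀ s, Measurable fun ω => (F ω).1 s := by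
    intro s
    obtain ⟨u, hu, hlim⟩ := mem_closure_iff_seq_limit.1 (hq s)
    choose n hn using hu
    refine measurable_of_tendsto_metrizable (fun i => hFq (n i)) (tendsto_pi_nhds.2 fun ω => ?_)
    have := ((F ω).2.tendsto s).comp hlim
    simpa only [Function.comp_def, ← hn] using this
  refine ⟨F, Measurable.subtype_mk (f := fun ω => (F ω).1) (measurable_pi_iff.2 hFs)
    (h := fun ω => (F ω).2), ?_⟩
  have : ∀ᵐ ω ∂P, ω ∉ N := by
    rw [ae_iff]
    simpa using hN0
  filter_upwards [this] with ω hω s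
  simp [F, hω]

variable {k : Pt d → Pt d → ℝ} [IsProbabilityMeasure P]

lemma IsCenteredGPOn.isGaussianModel (hf : IsCenteredGPOn P X k f) (hk : IsPSDKernelOn k X)
    {F : Ω → PathSpace X} (hF : Measurable F) (hFf : ∀ᵐ ω ∂P, ∀ s : X, (F ω).1 s = f s ω) :
    IsGaussianModel (P.map F) (fun s s' : X => k s s') fun w s => w.1 s := by
  have hm : ∀ s : X, Measurable fun w : PathSpace X => w.1 s := fun s =>
    (measurable_pi_apply s).comp measurable_subtype_coe
  have hae : ∀ s : X, (fun ω => f s ω) =ᵐ[P] fun ω => (F ω).1 s := fun s => by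
    filter_upwards [hFf] with ω h
    exact (h s).symm
  refine ⟨measurable_eval_pathSpace, ⟨fun I => ⟨?_⟩⟩, fun s => ?_, fun s s' => ?_, fun n p _ => ?_⟩
  · have h1 := ((hf.gaussian.congr hae).hasGaussianLaw I).isGaussian_map
    rw [Measure.map_map _ hF]
    · exact h1
    · exact measurable_pi_iff.2 fun i => hm i
  · rw [integral_map hF.aemeasurable (hm s).aestronglyMeasurable, ← hf.mean s s.2]
    exact integral_congr_ae (hae s).symm
  · rw [covariance_map (hm s).aestronglyMeasurable (hm s').aestronglyMeasurable hF.aemeasurable,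
      ← hf.covariance s s.2 s' s'.2]
    simp only [ProbabilityTheory.covariance, Function.comp_def]
    rw [← integral_congr_ae (hae s), ← integral_congr_ae (hae s')]
    refine integral_congr_ae ?_
    filter_upwards [hae s, hae s'] with ω h1 h2
    rw [h1, h2]
  · exact hk n (fun i => p i) fun i => (p i).2

/-- The σ-algebra of path space is generated by evaluations, so independence of the family of values
is independence of the path. -/
lemma indepFun_path {β : Type*} [MeasurableSpace β] {F : Ω → PathSpace X} {g : Ω → β}
    (hFf : ∀ᵐ ω ∂P, ∀ s : X, (F ω).1 s = f s ω)
    (h : IndepFun (fun ω (s : X) => f s ω) g P) : IndepFun F g P := by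
  have h1 : IndepFun (fun ω => (F ω).1) g P := h.congr (by
    filter_upwards [hFf] with ω hω
    exact funext fun s => (hω s).symm) (Filter.EventuallyEq.refl _ _)
  rw [IndepFun_iff_Indep] at h1 ⊢
  have h2 : MeasurableSpace.comap F Subtype.instMeasurableSpace =
      MeasurableSpace.comap (fun ω => (F ω).1) MeasurableSpace.pi := by
    rw [Subtype.instMeasurableSpace, MeasurableSpace.comap_comp]
    rfl
  rwa [h2]

variable {σ a b r : ℝ} {s : ℕ → ℝ} {ε ζ : ℕ → Ω → ℝ} {x : ℕ → Ω → Pt d}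

/-- The run restricted to `X`, on path space. -/
lemma IsIRGPUCBRun.exists_isModelRun (hXc : IsCompact X)
    (hrun : IsIRGPUCBRun P X k σ s (1 / 2) f ε ζ x) {F : Ω → PathSpace X} (hF : Measurable F)
    (hFf : ∀ᵐ ω ∂P, ∀ s : X, (F ω).1 s = f s ω) :
    ∃ sel, IsModelRun P (P.map F) (fun (w : PathSpace X) (s : X) => w.1 s) (Real.toNNReal (σ ^ 2))
      (fun t => shiftedExp (s (t + 1)) (1 / 2)) sel F ε ζ fun t ω => ⟨x t ω, hrun.query_mem t ω⟩ := by
  classical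
  obtain ⟨sel, hsel, hx⟩ := hrun.nonanticipating
  have hne : Nonempty Ω := P.nonempty_of_neZero
  obtain ⟨ω₀⟩ := hne
  have hx₀ := hrun.query_mem 0 ω₀
  have hXm := hXc.measurableSet
  let y : ∀ t : ℕ, (Fin t → X × ℝ) × (Fin (t + 1) → ℝ) → Pt d := fun t u =>
    sel t (fun i => ((u.1 i).1, (u.1 i).2), u.2)
  have hy : ∀ t, Measurable (y t) := fun t => (hsel t).comp
    ((measurable_pi_iff.2 fun i =>
      (measurable_subtype_coe.comp (measurable_fst.comp
        ((measurable_pi_apply i).comp measurable_fst))).prodMk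
      (measurable_snd.comp ((measurable_pi_apply i).comp measurable_fst))).prodMk measurable_snd)
  have hmem : ∀ t u, (if y t u ∈ X then y t u else x 0 ω₀) ∈ X := fun t u => by
    split_ifs with h
    · exact h
    · exact hx₀
  -- For histories that never occur the policy may leave X; it is redirected to a fixed point of X.
  refine ⟨fun t u => ⟨if y t u ∈ X then y t u else x 0 ω₀, hmem t u⟩, ⟨⟨hF.aemeasurable, rfl⟩,
    hrun.noise_law, hrun.conf_law, hrun.noise_indep, hrun.conf_indep, hrun.noise_conf_indep,
    indepFun_path hFf hrun.objective_indep, fun t => ?_, ?_⟩⟩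
  · exact Measurable.subtype_mk (Measurable.ite (hy t hXm) (hy t) measurable_const)
  · filter_upwards [hFf] with ω hω t
    have h1 : y t (fun i => (⟨x i ω, hrun.query_mem i ω⟩,
        (F ω).1 ⟨x i ω, hrun.query_mem i ω⟩ + ε i ω), fun i => ζ i ω) = x t ω := by
      rw [hx t ω]
      simp only [y, hω, obs]
    refine Subtype.ext ?_
    simp only [h1]
    rw [if_pos (hrun.query_mem t ω)]

/-- What one round of the algorithm contributes: measurability and integrability, the bound on the
gap to a finite set of points, and the mean of the first value. -/
lemma IsIRGPUCBRun.round (hXc : IsCompact X) (hσ : 0 < σ) (hk : IsPSDKernelOn k X)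
    (hk1 : ∀ x ∈ X, k x x ≤ 1) (hf : IsCenteredGPOn P X k f)
    (hc : ∀ᵐ ω ∂P, ContinuousOn (fun s => f s ω) X)
    (hrun : IsIRGPUCBRun P X k σ s (1 / 2) f ε ζ x) (t : ℕ) :
    AEStronglyMeasurable (fun ω => f (x t ω) ω) P ∧
    AEStronglyMeasurable (fun ω => sSup ((fun z => f z ω) '' X)) P ∧
    Integrable (fun ω => √(ζ t ω) * √(postVar k σ (fun i : Fin t => x i ω) (x t ω))) P ∧
    (Integrable (fun ω => f (x t ω) ω) P →
      ∀ {ι : Type} [Fintype ι] [Nonempty ι] (z : ι → X),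
        2 * Real.log (Fintype.card ι / 2) ≤ s (t + 1) →
        ∫ ω, (Finset.univ.sup' Finset.univ_nonempty fun j => f (z j) ω) ∂P -
            ∫ ω, f (x t ω) ω ∂P ≤
          ∫ ω, √(ζ t ω) * √(postVar k σ (fun i : Fin t => x i ω) (x t ω)) ∂P) ∧
    (Integrable (fun ω => f (x 0 ω) ω) P → ∫ ω, f (x 0 ω) ω ∂P = 0) := by
  obtain ⟨F, hF, hFf⟩ := exists_measurable_path (fun s => hf.gaussian.aemeasurable s) hc
  have hν : IsProbabilityMeasure (P.map F) := Measure.isProbabilityMeasure_map hF.aemeasurable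
  have hM := hf.isGaussianModel hk hF hFf
  obtain ⟨sel, hR⟩ := hrun.exists_isModelRun hXc hF hFf
  have hσ2 : 0 < σ ^ 2 := by positivity
  have hv : ((Real.toNNReal (σ ^ 2) : NNReal) : ℝ) = σ ^ 2 := Real.coe_toNNReal _ hσ2.le
  have hv0 : Real.toNNReal (σ ^ 2) ≠ 0 := (Real.toNNReal_pos.2 hσ2).ne'
  have hk1' : ∀ s : X, k s s ≤ 1 := fun s => hk1 s s.2
  have hev : ∀ t, (fun ω => (F ω).1 ⟨x t ω, hrun.query_mem t ω⟩) =ᵐ[P] fun ω => f (x t ω) ω :=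
    fun t => by
      filter_upwards [hFf] with ω hω
      exact hω _
  have : Nonempty X := by
    obtain ⟨ω⟩ : Nonempty Ω := P.nonempty_of_neZero
    exact ⟨⟨x 0 ω, hrun.query_mem 0 ω⟩⟩
  obtain ⟨q, hq⟩ := TopologicalSpace.exists_dense_seq X
  refine ⟨?_, ?_, hR.integrable_width hM hσ hv0 hk1' rfl, fun hi ι _ _ z hs => ?_, fun hi => ?_⟩
  · have law := hR.hasLaw_runHist hM hv0 t
    have hm : Measurable fun u : Hist t × ℝ × PathSpace X => u.2.2.1 (histQuery sel (u.1, u.2.1)) :=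
      hM.measurable_eval_comp (measurable_snd.comp measurable_snd) ((hR.measurable_histQuery t).comp
        (measurable_fst.prodMk (measurable_fst.comp measurable_snd)))
    refine (hm.comp_aemeasurable law.aemeasurable).aestronglyMeasurable.congr ?_
    filter_upwards [hR.histQuery_runHist_ae t, hFf] with ω h1 h2
    simp only [Function.comp_apply, h1, h2]
  -- By continuity the supremum over X is that over a dense sequence.
  · have hm : Measurable fun ω => ⨆ n, (F ω).1 (q n) := Measurable.iSup fun n =>
      hM.measurable_eval_comp hF measurable_const
    refine hm.aestronglyMeasurable.congr ?_
    filter_upwards [hFf] with ω hω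
    have himg : (fun z => f z ω) '' X = Set.range (F ω).1 := by
      ext y
      constructor
      · rintro ⟨z, hz, rfl⟩
        exact ⟨⟨z, hz⟩, hω _⟩
      · rintro ⟨z, rfl⟩
        exact ⟨z, z.2, (hω z).symm⟩
    have hXcs : CompactSpace X := isCompact_iff_compactSpace.1 hXc
    have hbdd : BddAbove (Set.range (F ω).1) := (isCompact_range (F ω).2).bddAbove
    have hbdd2 : BddAbove (Set.range fun n => (F ω).1 (q n)) :=
      hbdd.mono (Set.range_comp_subset_range q (F ω).1)
    rw [himg]
    refine le_antisymm (ciSup_le fun n => le_csSup hbdd ⟨q n, rfl⟩)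
      (csSup_le (Set.range_nonempty _) ?_)
    rintro _ ⟨z, rfl⟩
    have hcl : IsClosed {z | (F ω).1 z ≤ ⨆ n, (F ω).1 (q n)} :=
      isClosed_le (F ω).2 continuous_const
    have hsub : closure (Set.range q) ⊆ {z | (F ω).1 z ≤ ⨆ n, (F ω).1 (q n)} :=
      hcl.closure_subset_iff.2 (by
        rintro _ ⟨n, rfl⟩
        exact le_ciSup hbdd2 n)
    exact hsub (hq z)
  · have h1 := hR.integral_gap_le (t := t) hM hσ hv hk1' z rfl hs (hi.congr (hev t).symm) (by
      filter_upwards [hFf, hrun.query_argmax] with ω h1 h2 j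
      have h3 : (fun i : Fin t => (F ω).1 ⟨x i ω, hrun.query_mem i ω⟩ + ε i ω) =
          fun i : Fin t => obs f ε x i ω := funext fun i => by rw [h1]; rfl
      rw [h3]
      exact h2 t (z j).2)
    rw [integral_congr_ae (hev t)] at h1
    have h2 : ∫ ω, (Finset.univ.sup' Finset.univ_nonempty fun j => f (z j) ω) ∂P =
        ∫ ω, (Finset.univ.sup' Finset.univ_nonempty fun j => (F ω).1 (z j)) ∂P :=
      integral_congr_ae (by
        filter_upwards [hFf] with ω h1
        simp only [h1])
    rw [h2]
    exact h1
  · rw [← integral_congr_ae (hev 0)]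
    exact hR.integral_eval_zero hM hσ hv (hi.congr (hev 0).symm)

end Paths

end BayesOpt

/-! ### Expected regret of one round and the sum of the widths -/

namespace BayesOpt

section Regret

variable {d : ℕ} {Ω : Type*} [MeasurableSpace Ω] {P : Measure Ω} [IsProbabilityMeasure P]
  {X : Set (Pt d)} {f : Pt d → Ω → ℝ} {k : Pt d → Pt d → ℝ} {σ r ρ : ℝ} {s : ℕ → ℝ}
  {ε ζ : ℕ → Ω → ℝ} {x : ℕ → Ω → Pt d} {ℓ : Ω → ℝ}

lemma l1Dist_le_of_mem_cube {y z : Pt d} (hy : ∀ j, y j ∈ Set.Icc 0 r) (hz : ∀ j, z j ∈ Set.Icc 0 r) :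
    l1Dist y z ≤ d * r := by
  calc l1Dist y z ≤ ∑ _j : Fin d, r := Finset.sum_le_sum fun j _ =>
        abs_le.2 ⟨by linarith [(hy j).1, (hz j).2], by linarith [(hy j).2, (hz j).1]⟩
    _ = d * r := by simp

/-- Bounds on the expected regret of one round. -/
lemma IsIRGPUCBRun.integral_regret_le (hXc : IsCompact X) (hX : Convex ℝ X) (hr : 0 < r)
    (hXr : ∀ x ∈ X, ∀ j, x j ∈ Set.Icc 0 r) (hσ : 0 < σ) (hk : IsPSDKernelOn k X)
    (hk1 : ∀ x ∈ X, k x x ≤ 1) (hf : IsCenteredGPOn P X k f)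
    (hc : ∀ᵐ ω ∂P, ContinuousOn (fun s => f s ω) X) (hℓi : Integrable ℓ P) (hℓ0 : ∀ ω, 0 ≤ ℓ ω)
    (hℓ : ∀ᵐ ω ∂P, ∀ x ∈ X, ∀ y ∈ X, f y ω - f x ω ≤ ℓ ω * l1Dist y x) (hρ : ∫ ω, ℓ ω ∂P ≤ ρ)
    (hrun : IsIRGPUCBRun P X k σ s (1 / 2) f ε ζ x) (t : ℕ) :
    Integrable (fun ω => sSup ((fun z => f z ω) '' X) - f (x t ω) ω) P ∧
    Integrable (fun ω => √(ζ t ω) * √(postVar k σ (fun i : Fin t => x i ω) (x t ω))) P ∧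
    ∫ ω, (sSup ((fun z => f z ω) '' X) - f (x t ω) ω) ∂P ≤ ρ * (d * r) ∧
    (∀ m : ℕ, 0 < m → 2 * Real.log ((m : ℝ) ^ d / 2) ≤ s (t + 1) →
      ∫ ω, (sSup ((fun z => f z ω) '' X) - f (x t ω) ω) ∂P ≤ ρ * (d * (r / (2 * m))) +
        ∫ ω, √(ζ t ω) * √(postVar k σ (fun i : Fin t => x i ω) (x t ω)) ∂P) ∧
    ∫ ω, (sSup ((fun z => f z ω) '' X) - f (x 0 ω) ω) ∂P ≤ ρ * (d * (r / 2)) := by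
  obtain ⟨hm, hms, hw, hgap, -⟩ := hrun.round hXc hσ hk hk1 hf hc t
  obtain ⟨hm0, -, -, -, hzero⟩ := hrun.round hXc hσ hk hk1 hf hc 0
  have hne : X.Nonempty := by
    obtain ⟨ω⟩ : Nonempty Ω := P.nonempty_of_neZero
    exact ⟨x 0 ω, hrun.query_mem 0 ω⟩
  have hfi : ∀ z ∈ X, Integrable (f z) P := fun z hz =>
    (hf.gaussian.hasGaussianLaw_eval ⟨z, hz⟩).integrable
  obtain ⟨z₀, hz₀⟩ := hne
  have hdr : 0 ≤ d * r := by positivity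
  -- A common dominating function for all values of the path: one value plus the oscillation over
  -- the cube, of ℓ¹ diameter d r.
  have hbound : Integrable (fun ω => |f z₀ ω| + ℓ ω * (d * r)) P :=
    (hfi z₀ hz₀).abs.add (hℓi.mul_const _)
  have hcube : ∀ᵐ ω ∂P, ∀ y ∈ X, ∀ z ∈ X, f y ω ≤ f z ω + ℓ ω * (d * r) := by
    filter_upwards [hℓ] with ω h1 y hy z hz
    have := mul_le_mul_of_nonneg_left (l1Dist_le_of_mem_cube (hXr y hy) (hXr z hz)) (hℓ0 ω)
    linarith [h1 z hz y hy]
  have hqi : ∀ t, AEStronglyMeasurable (fun ω => f (x t ω) ω) P →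
      Integrable (fun ω => f (x t ω) ω) P := fun t hmt => by
    refine hbound.mono' hmt ?_
    filter_upwards [hcube] with ω h1
    have h2 := h1 _ (hrun.query_mem t ω) z₀ hz₀
    have h3 := h1 z₀ hz₀ _ (hrun.query_mem t ω)
    rw [Real.norm_eq_abs, abs_le]
    constructor <;> linarith [neg_abs_le (f z₀ ω), le_abs_self (f z₀ ω)]
  have hle : ∀ {ω : Ω} {c : ℝ}, (∀ y ∈ X, f y ω ≤ c) → sSup ((fun z => f z ω) '' X) ≤ c :=
    fun h => csSup_le (Set.Nonempty.image _ ⟨z₀, hz₀⟩) (by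
      rintro _ ⟨y, hy, rfl⟩
      exact h y hy)
  have hsi : Integrable (fun ω => sSup ((fun z => f z ω) '' X)) P := by
    refine hbound.mono' hms ?_
    filter_upwards [hcube] with ω h1
    have h2 : sSup ((fun z => f z ω) '' X) ≤ f z₀ ω + ℓ ω * (d * r) := hle fun y hy => h1 y hy z₀ hz₀
    have h3 : f z₀ ω ≤ sSup ((fun z => f z ω) '' X) := le_csSup ⟨f z₀ ω + ℓ ω * (d * r), by
      rintro _ ⟨y, hy, rfl⟩
      exact h1 y hy z₀ hz₀⟩ ⟨z₀, hz₀, rfl⟩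
    have h4 := mul_nonneg (hℓ0 ω) hdr
    rw [Real.norm_eq_abs, abs_le]
    constructor <;> linarith [neg_abs_le (f z₀ ω), le_abs_self (f z₀ ω)]
  have hqt := hqi t hm
  refine ⟨hsi.sub hqt, hw, ?_, fun m hm0 hms => ?_, ?_⟩
  · calc _ ≤ ∫ ω, ℓ ω * (d * r) ∂P := integral_mono_ae (hsi.sub hqt) (hℓi.mul_const _) (by
          filter_upwards [hcube] with ω h1
          exact sub_le_iff_le_add'.2 (hle fun y hy => h1 y hy _ (hrun.query_mem t ω)))
      _ ≤ ρ * (d * r) := by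
          rw [integral_mul_const]
          exact mul_le_mul_of_nonneg_right hρ hdr
  · obtain ⟨z, hz, hnet⟩ := exists_net hXc hX ⟨z₀, hz₀⟩ hr hXr hm0
    have : Nonempty (Fin m) := Fin.pos_iff_nonempty.1 hm0
    have h1 := hgap hqt (fun i => (⟨z i, hz i⟩ : X)) (by
      simpa using hms)
    have hη : (0 : ℝ) ≤ d * (r / (2 * m)) := by positivity
    have hsup : Integrable
        (fun ω => Finset.univ.sup' Finset.univ_nonempty fun j => f (z j) ω) P :=
      integrable_sup' fun j => hfi _ (hz j)
    have h2 : ∫ ω, sSup ((fun z => f z ω) '' X) ∂P ≤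
        ∫ ω, ((Finset.univ.sup' Finset.univ_nonempty fun j => f (z j) ω) +
          ℓ ω * (d * (r / (2 * m)))) ∂P := by
      refine integral_mono_ae hsi (hsup.add (hℓi.mul_const _)) ?_
      filter_upwards [hℓ] with ω h1
      refine hle fun y hy => ?_
      obtain ⟨i, hi⟩ := hnet y hy
      have h3 := h1 _ (hz i) y hy
      have h4 := mul_le_mul_of_nonneg_left hi (hℓ0 ω)
      have h5 := Finset.le_sup' (fun j => f (z j) ω) (Finset.mem_univ i)
      linarith
    rw [integral_add hsup (hℓi.mul_const _), integral_mul_const] at h2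
    rw [integral_sub hsi hqt]
    have h3 := mul_le_mul_of_nonneg_right hρ hη
    linarith
  -- Round 0 has mean value zero at its query and at the single point of the net m = 1, so only half
  -- the diameter is paid.
  · have hq0 := hqi 0 hm0
    obtain ⟨z, hz, hnet⟩ := exists_net hXc hX ⟨z₀, hz₀⟩ hr hXr one_pos
    have hη : (0 : ℝ) ≤ d * (r / 2) := by positivity
    rw [integral_sub hsi hq0, hzero hq0, sub_zero]
    calc _ ≤ ∫ ω, (f (z 0) ω + ℓ ω * (d * (r / 2))) ∂P := by
          refine integral_mono_ae hsi ((hfi _ (hz 0)).add (hℓi.mul_const _)) ?_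
          filter_upwards [hℓ] with ω h1
          refine hle fun y hy => ?_
          obtain ⟨i, hi⟩ := hnet y hy
          rw [Subsingleton.elim i 0] at hi
          simp only [Nat.cast_one, mul_one] at hi
          have h3 := h1 _ (hz 0) y hy
          have h4 := mul_le_mul_of_nonneg_left hi (hℓ0 ω)
          linarith
      _ = (∫ ω, ℓ ω ∂P) * (d * (r / 2)) := by
          rw [integral_add (hfi _ (hz 0)) (hℓi.mul_const _), hf.mean _ (hz 0), integral_mul_const,
            zero_add]
      _ ≤ _ := mul_le_mul_of_nonneg_right hρ hη

lemma sum_inv_sq_le (T : ℕ) : ∑ t ∈ Finset.range T, 1 / ((t : ℝ) + 1) ^ 2 ≤ Real.pi ^ 2 / 6 := by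
  have h := (hasSum_nat_add_iff' 1).2 hasSum_zeta_two
  have h2 := sum_le_hasSum (Finset.range T) (fun i _ => by positivity) h
  simpa using h2

/-- The expected sum of the confidence widths, by the Cauchy–Schwarz inequality. -/
lemma IsIRGPUCBRun.sum_integral_width_le (hσ : 0 < σ) (hk : IsPSDKernelOn k X)
    (hk1 : ∀ x ∈ X, k x x ≤ 1) (hrun : IsIRGPUCBRun P X k σ s (1 / 2) f ε ζ x)
    (hw : ∀ t, Integrable (fun ω => √(ζ t ω) * √(postVar k σ (fun i : Fin t => x i ω) (x t ω))) P)
    {T : ℕ} {S : ℝ} (hS : 0 ≤ S) (hsS : ∀ t < T, s (t + 1) ≤ S) :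
    ∑ t ∈ Finset.range T, ∫ ω, √(ζ t ω) * √(postVar k σ (fun i : Fin t => x i ω) (x t ω)) ∂P ≤
      √(2 / Real.log (1 + σ⁻¹ ^ 2) * T * MIG k σ X T * (2 + S)) := by
  set B := 2 / Real.log (1 + σ⁻¹ ^ 2) * MIG k σ X T with hB
  have hζi : ∀ t, Integrable (fun ω => max (ζ t ω) 0) P ∧
      ∫ ω, max (ζ t ω) 0 ∂P ≤ max (s (t + 1)) 0 + 2 := by
    intro t
    have hm : Measurable fun z : ℝ => max z 0 := by fun_prop
    have h1 : Integrable (fun z : ℝ => max z 0) (shiftedExp (s (t + 1)) (1 / 2)) :=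
      (integrable_id_shiftedExp _).pos_part
    have h2 := integral_posPart_shiftedExp_le (s (t + 1))
    have law := hrun.conf_law t
    rw [← law.map_eq] at h1 h2
    rw [integral_map law.aemeasurable hm.aestronglyMeasurable] at h2
    exact ⟨(integrable_map_measure hm.aestronglyMeasurable law.aemeasurable).1 h1, h2⟩
  -- Cauchy–Schwarz in the form 2√ζ√V ≤ cV + ζ⁺/c, with a free constant c. The pathwise bound ∑ V ≤
  -- B then needs no measurability of the variances.
  have hamgm : ∀ c : ℝ, 0 < c →
      2 * ∑ t ∈ Finset.range T, ∫ ω, √(ζ t ω) * √(postVar k σ (fun i : Fin t => x i ω) (x t ω)) ∂P ≤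
        c * B + (T * (2 + S)) / c := by
    intro c hc
    have hgi : Integrable (fun ω => c * B + (∑ t ∈ Finset.range T, max (ζ t ω) 0) / c) P :=
      (integrable_const _).add ((integrable_finsetSum _ fun t _ => (hζi t).1).div_const _)
    calc _ = ∫ ω, 2 * ∑ t ∈ Finset.range T,
            √(ζ t ω) * √(postVar k σ (fun i : Fin t => x i ω) (x t ω)) ∂P := by
          rw [integral_const_mul, integral_finsetSum _ fun t _ => hw t]
      _ ≤ ∫ ω, (c * B + (∑ t ∈ Finset.range T, max (ζ t ω) 0) / c) ∂P := by
          refine integral_mono ((integrable_finsetSum _ fun t _ => hw t).const_mul 2) hgi fun ω => ?_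
          have hsum := sum_postVar_le hk hk1 hσ (x := fun t => x t ω)
            (fun t => hrun.query_mem t ω) T
          have hterm : ∀ t ∈ Finset.range T,
              2 * (√(ζ t ω) * √(postVar k σ (fun i : Fin t => x i ω) (x t ω))) ≤
                c * postVar k σ (fun i : Fin t => x i ω) (x t ω) + max (ζ t ω) 0 / c := by
            intro t _
            have hv := postVar_nonneg hk hσ (p := fun i : Fin t => x i ω)
              (fun i => hrun.query_mem i ω) (hrun.query_mem t ω)
            set V := postVar k σ (fun i : Fin t => x i ω) (x t ω)
            have h1 : √(ζ t ω) ^ 2 = max (ζ t ω) 0 := by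
              rcases le_total 0 (ζ t ω) with h | h
              · rw [Real.sq_sqrt h, max_eq_left h]
              · rw [Real.sqrt_eq_zero_of_nonpos h, max_eq_right h]
                norm_num
            have h2 : √V ^ 2 = V := Real.sq_sqrt hv
            rw [← h1]
            nth_rewrite 2 [← h2]
            have h3 : c * √V ^ 2 + √(ζ t ω) ^ 2 / c - 2 * (√(ζ t ω) * √V) =
                (c * √V - √(ζ t ω)) ^ 2 / c := by
              field_simp
              ring
            have h4 : 0 ≤ (c * √V - √(ζ t ω)) ^ 2 / c := by positivity
            linarith
          have := Finset.sum_le_sum hterm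
          rw [← Finset.mul_sum, Finset.sum_add_distrib, ← Finset.mul_sum, ← Finset.sum_div] at this
          have h5 := mul_le_mul_of_nonneg_left hsum hc.le
          simp only
          linarith
      _ = c * B + (∑ t ∈ Finset.range T, ∫ ω, max (ζ t ω) 0 ∂P) / c := by
          rw [integral_add (integrable_const _)
            ((integrable_finsetSum _ fun t _ => (hζi t).1).div_const _), integral_div,
            integral_finsetSum _ fun t _ => (hζi t).1]
          simp
      _ ≤ _ := by
          gcongr
          calc _ ≤ ∑ _t ∈ Finset.range T, (2 + S) := Finset.sum_le_sum fun t ht => by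
                have h1 := (hζi t).2
                have h2 := max_le (hsS t (Finset.mem_range.1 ht)) hS
                linarith
            _ = _ := by
                simp
                ring
  set A := ∑ t ∈ Finset.range T,
    ∫ ω, √(ζ t ω) * √(postVar k σ (fun i : Fin t => x i ω) (x t ω)) ∂P with hA
  have hA0 : 0 ≤ A := Finset.sum_nonneg fun t _ => integral_nonneg fun ω => by positivity
  set G := T * (2 + S) with hG
  have hG0 : 0 ≤ G := by positivity
  have hBG : 2 / Real.log (1 + σ⁻¹ ^ 2) * T * MIG k σ X T * (2 + S) = B * G := by
    rw [hB, hG]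
    ring
  rw [hBG]
  refine Real.le_sqrt_of_sq_le ?_
  rcases hA0.eq_or_lt with h0 | hpos
  · rw [← h0]
    have hB0 : 0 ≤ B := by
      refine mul_nonneg (div_nonneg zero_le_two (Real.log_nonneg ?_)) ENNReal.toReal_nonneg
      have : 0 ≤ σ⁻¹ ^ 2 := by positivity
      linarith
    have := mul_nonneg hB0 hG0
    simpa using this
  · rcases hG0.eq_or_lt with hG1 | hGpos
    -- If G = 0, this c makes c B ≤ A, so 2A ≤ A contradicts A > 0.
    · have hB1 := hamgm (A / (|B| + 1)) (by positivity)
      rw [← hG1, zero_div, add_zero] at hB1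
      have h1 : A / (|B| + 1) * B ≤ A := by
        rw [div_mul_eq_mul_div, div_le_iff₀ (by positivity)]
        nlinarith [le_abs_self B]
      linarith
    -- With c = G/A the inequality reads 2A ≤ (G/A) B + A, that is, A² ≤ BG.
    · have h1 := hamgm (G / A) (by positivity)
      have h2 : G / (G / A) = A := by field_simp
      rw [h2] at h1
      have h3 : A ≤ G / A * B := by linarith
      rw [div_mul_eq_mul_div, le_div_iff₀ hpos] at h3
      nlinarith

end Regret

/-! ### The grid size and the shift -/

section Shift

variable {a b r : ℝ} {d : ℕ}

/-- The bound on the expected diameter-scaled Lipschitz constant that enters the shifts. -/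
noncomputable def lipScale (a b r : ℝ) (d : ℕ) : ℝ :=
  b * (√(Real.log (a * d)) + √Real.pi / 2) * (d * r)

lemma lipScale_pos (hb : 0 < b) (hr : 0 < r) (hd : 0 < d) : 0 < lipScale a b r d := by
  have h1 : 0 < √Real.pi := Real.sqrt_pos.2 Real.pi_pos
  have h2 : (0 : ℝ) < d := by exact_mod_cast hd
  unfold lipScale
  positivity

lemma shift_eq (t : ℕ) : shift a b r d t =
    2 * d * Real.log (lipScale a b r d * (t : ℝ) ^ 2) - 2 * Real.log 2 := by
  rw [shift, lipScale]
  ring_nf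

lemma shift_mono (hb : 0 < b) (hr : 0 < r) (hd : 0 < d) {t T : ℕ} (ht : 0 < t) (htT : t ≤ T) :
    shift a b r d t ≤ shift a b r d T := by
  have h1 := lipScale_pos (a := a) hb hr hd
  have h2 : (0 : ℝ) < t := by exact_mod_cast ht
  have h3 : (t : ℝ) ≤ T := by exact_mod_cast htT
  rw [shift_eq, shift_eq]
  gcongr

lemma lipScale_lt_of_shift_neg (hd : 0 < d) {t : ℕ}
    (h : shift a b r d t < 0) : lipScale a b r d * (t : ℝ) ^ 2 < 2 := by
  by_contra! hcon
  have h1 : Real.log 2 ≤ Real.log (lipScale a b r d * (t : ℝ) ^ 2) :=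
    Real.log_le_log two_pos hcon
  have h2 : (1 : ℝ) ≤ d := by exact_mod_cast hd
  have h3 := Real.log_pos one_lt_two
  rw [shift_eq] at h
  nlinarith

/-- If the expected regret `R` of round `t` has a discretization bound for every admissible grid
size, then it is at most the width `A` plus `1 / t²`. -/
lemma le_inv_sq_add_of_grid (hb : 0 < b) (hr : 0 < r) (hd : 0 < d) {t : ℕ} (ht : 0 < t) {R A : ℝ}
    (hA : 0 ≤ A) (h1 : R ≤ lipScale a b r d)
    (h2 : ∀ m : ℕ, 0 < m → 2 * Real.log ((m : ℝ) ^ d / 2) ≤ shift a b r d t →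
      R ≤ lipScale a b r d / (2 * m) + A) : R ≤ 1 / (t : ℝ) ^ 2 + A := by
  have ht' : (0 : ℝ) < (t : ℝ) ^ 2 := by positivity
  have hl := lipScale_pos (a := a) hb hr hd
  set τ := lipScale a b r d * (t : ℝ) ^ 2 with hτ
  have hlτ : lipScale a b r d = τ * (1 / (t : ℝ) ^ 2) := by
    rw [hτ]
    field_simp
  have hinv : 0 < 1 / (t : ℝ) ^ 2 := by positivity
  rcases lt_or_ge τ 1 with hlt | hge
  -- If τ < 1 the floor would be 0, but the crude bound is already below 1/t².
  · nlinarith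
  · have hm : 0 < ⌊τ⌋₊ := Nat.floor_pos.2 hge
    have hm' : (1 : ℝ) ≤ (⌊τ⌋₊ : ℝ) := by exact_mod_cast hm
    have hfl : (⌊τ⌋₊ : ℝ) ≤ τ := Nat.floor_le (by linarith)
    have hfl2 := Nat.lt_floor_add_one τ
    -- The grid has m^d ≤ τ^d points, and 2 log(τ^d / 2) is exactly the shift.
    have hR := h2 ⌊τ⌋₊ hm (by
      rw [shift_eq, Real.log_div (by positivity) two_ne_zero, Real.log_pow, mul_sub, ← mul_assoc]
      gcongr)
    -- Here 2⌊τ⌋ ≥ ⌊τ⌋ + 1 > τ.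
    have h3 : lipScale a b r d / (2 * ⌊τ⌋₊) ≤ 1 / (t : ℝ) ^ 2 := by
      rw [hlτ, div_le_iff₀ (by positivity), mul_comm]
      exact mul_le_mul_of_nonneg_left (by linarith) hinv.le
    linarith

end Shift

end BayesOpt

/-! ### The cumulative regret bound -/

open BayesOpt in
theorem mainTheorem5 {Ω : Type*} [MeasurableSpace Ω] (P : Measure Ω) [IsProbabilityMeasure P]
    (d : ℕ) (hd : 0 < d) (r : ℝ) (hr : 0 < r) (X : Set (Pt d))
    (hXc : IsCompact X) (hXconv : Convex ℝ X) (hXr : ∀ x ∈ X, ∀ j, x j ∈ Set.Icc 0 r)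
    (σ : ℝ) (hσ : 0 < σ)
    (k : Pt d → Pt d → ℝ) (hk : IsPSDKernelOn k X) (hk1 : ∀ x ∈ X, k x x ≤ 1)
    (f : Pt d → Ω → ℝ) (hf : IsCenteredGPOn P X k f)
    (a b : ℝ) (ha : 0 < a) (hb : 0 < b) (hab : SubGaussianPartials P X f a b)
    (ε ζ : ℕ → Ω → ℝ) (x : ℕ → Ω → Pt d)
    (hrun : IsIRGPUCBRun P X k σ (shift a b r d) (1 / 2) f ε ζ x)
    (T : ℕ) (hT : 1 ≤ T) :
    Integrable (cumRegret X f x T) P ∧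
      ∫ ω, cumRegret X f x T ω ∂P ≤
        Real.pi ^ 2 / 6 +
          √(2 / Real.log (1 + σ⁻¹ ^ 2) * T * MIG k σ X T * (2 + shift a b r d T)) := by
  obtain ⟨ℓ, hℓi, hℓ0, hℓ, hℓρ⟩ := hab.exists_lipschitz hd hXconv
    (fun x hx => hf.gaussian.aemeasurable ⟨x, hx⟩) ha hb
  have hc : ∀ᵐ ω ∂P, ContinuousOn (fun s => f s ω) X := by
    obtain ⟨g, hg, -⟩ := hab
    filter_upwards [hg] with ω hω using hω.continuousOn
  have hround := hrun.integral_regret_le hXc hXconv hr hXr hσ hk hk1 hf hc hℓi hℓ0 hℓ hℓρ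
  have hcum : cumRegret X f x T =
      fun ω => ∑ t ∈ Finset.range T, (sSup ((fun z => f z ω) '' X) - f (x t ω) ω) := rfl
  rw [hcum]
  refine ⟨integrable_finsetSum _ fun t _ => (hround t).1, ?_⟩
  rw [integral_finsetSum _ fun t _ => (hround t).1]
  have hl := lipScale_pos (a := a) hb hr hd
  have hcrude : ∀ t, ∫ ω, (sSup ((fun z => f z ω) '' X) - f (x t ω) ω) ∂P ≤ lipScale a b r d :=
    fun t => (hround t).2.2.1
  rcases le_or_gt 0 (shift a b r d T) with hS | hS
  -- The sign of s_T matters for the width bound: monotonicity gives max(s_t, 0) ≤ s_T only if s_T ≥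
  -- 0.
  · have hwidth := hrun.sum_integral_width_le hσ hk hk1 (fun t => (hround t).2.1) (T := T) hS
      fun t ht => shift_mono hb hr hd (Nat.succ_pos t) ht
    refine le_trans (Finset.sum_le_sum fun t _ => ?_) ((Finset.sum_add_distrib
      (f := fun t : ℕ => 1 / ((t : ℝ) + 1) ^ 2)).trans_le (add_le_add (sum_inv_sq_le T) hwidth))
    have := le_inv_sq_add_of_grid hb hr hd (Nat.succ_pos t)
      (A := ∫ ω, √(ζ t ω) * √(postVar k σ (fun i : Fin t => x i ω) (x t ω)) ∂P)
      (integral_nonneg fun ω => by positivity) (hcrude t) fun m hm hms => by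
        refine ((hround t).2.2.2.1 m hm hms).trans (le_of_eq ?_)
        rw [lipScale]
        congr 1
        field_simp
    simpa using this
  -- Now 2 + s_T may be negative, so the square root is discarded. The scale is below 2/T²: for T ≥
  -- 2 the crude bound gives less than 2/T ≤ 1 in total, and for T = 1 the uninformed first query
  -- pays only half the scale.
  · have hτ := lipScale_lt_of_shift_neg hd hS
    have hpi : (1 : ℝ) ≤ Real.pi ^ 2 / 6 := by nlinarith [Real.pi_gt_three]
    refine le_trans (le_trans ?_ hpi) (le_add_of_nonneg_right (Real.sqrt_nonneg _))
    rcases hT.eq_or_lt with rfl | hT2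
    · have h1 := (hround 0).2.2.2.2
      have h2 : b * (√(Real.log (a * d)) + √Real.pi / 2) * (d * (r / 2)) = lipScale a b r d / 2 := by
        rw [lipScale]
        ring
      rw [Finset.sum_range_one]
      rw [h2] at h1
      norm_num at hτ
      linarith
    · have hT2' : (2 : ℝ) ≤ T := by exact_mod_cast hT2
      calc _ ≤ ∑ _t ∈ Finset.range T, lipScale a b r d := Finset.sum_le_sum fun t _ => hcrude t
        _ = T * lipScale a b r d := by simp
        _ ≤ 1 := by nlinarith
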